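/- **Conventions.** For a graded abelian group or graded module $M$ let $M\{j\}$ be $M$ with its grading shifted up by $j$. Let $\mathcal A=\mathbb Z[X]/(X^2)$, with $1$ in degree $-1$ and $X$ in degree $1$, be the commutative Frobenius ring with trace $\mathrm{tr}(1)=0$, $\mathrm{tr}(X)=1$, and let $\mathcal F$ be the corresponding two-dimensional topological quantum field theory: it assigns $\mathcal A^{\otimes r}$ to a disjoint union of $r$ circles, the multiplication of $\mathcal A$ to a merger of two circles, and the comultiplication $\Delta(1)=1\otimes X+X\otimes 1$, $\Delta(X)=X\otimes X$ to the splitting of a circle. **Arc rings.** Let $s$ be a finite set of $2m$ points on a line, and let $B(s)$ be the set of crossingless matchings of $s$ by arcs in a half-plane. Let $W$ denote reflection in the line. The arc ring of $s$ is $$H(s)=\bigoplus_{a,b\in B(s)}\mathcal F(W(b)a)\{m\},$$ a graded ring whose product $\mathcal F(W(c)b)\otimes\mathcal F(W(b)a)\to\mathcal F(W(c)a)$ is induced by the cobordism that contracts $b$ with $W(b)$ (other products are zero). The reflections $\mathcal F(W(b)a)\cong\mathcal F(W(a)b)$ define an anti-involution $\chi$ of $H(s)$. A flat tangle $T$ in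 a strip, with bottom endpoints $s$ ($2m$ points) and top endpoints $t$, defines a graded $(H(t),H(s))$-bimodule $$\mathcal F(T)=\bigoplus_{b\in B(t),\,a\in B(s)}\mathcal F(W(b)Ta)\{m\},$$ on which both rings act through contraction cobordisms. **The category.** Fix integers $n,k$ with $1\le k\le n-1$. A weight is a sequence $\lambda=(\lambda_1,\dots,\lambda_n)$ of integers; it is admissible if all $\lambda_j\in\{0,1,2\}$ and $\sum_j\lambda_j=2k$. For admissible $\lambda$ let $s(\lambda)=\{j:\lambda_j=1\}$ and $H_\lambda=H(s(\lambda))$, let $\mathcal C(\lambda)$ be the category of finitely generated graded left $H_\lambda$-modules and degree-preserving homomorphisms, and let $\mathcal C=\bigoplus_\lambda\mathcal C(\lambda)$, the sum over all admissible $\lambda$. **The functors.** Let $1\le i\le n-1$ and let $\epsilon_i$ be the sequence with $1$ in place $i$, $-1$ in place $i+1$, and $0$ elsewhere. The functor $\mathcal E_i:\mathcal C\to\mathcal C$ (respectively $\mathcal F_i:\mathcal C\to\mathcal C$) is the sum over all admissible $\lambda$ of functors $\mathcal C(\lambda)\to\mathcal C(\mu)$, where $\mu=\lambda+\epsilon_i$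 (respectively $\mu=\lambda-\epsilon_i$). This is the zero functor if $\mu$ is not admissible. Otherwise it is $\mathcal F(T)\otimes_{H_\lambda}-$, where $T$ is the following flat tangle with bottom endpoints $s(\lambda)$ and top endpoints $s(\mu)$, all of whose strands in places other than $i,i+1$ are vertical: * if exactly one of $\lambda_i,\lambda_{i+1}$ equals $1$, a strand joins the bottom endpoint in place $i$ or $i+1$ to the top endpoint in the other one of these two places; * if $\lambda_i,\lambda_{i+1}\ne1$ (so that $\mu_i=\mu_{i+1}=1$), a cup joins the top endpoints $i$ and $i+1$; * if $\lambda_i=\lambda_{i+1}=1$, a cap joins the bottom endpoints $i$ and $i+1$. The functor $\mathcal K_i^{\pm1}:\mathcal C\to\mathcal C$ takes $M\in\mathcal C(\lambda)$ to $M\{\pm(\lambda_i-\lambda_{i+1})\}$. **The pairing.** For $M\in\mathcal C(\lambda)$ let ${}_\psi M$ be the right $H_\lambda$-module with underlying graded group $M$ and action $m\cdot h=\chi(h)m$. For objects $M=(M_\lambda)$ and $N=(N_\lambda)$ of $\mathcal C$ let $${}_\psi M\otimes N=\bigoplus_\lambda {}_\psi M_\lambda\otimes_{H_\lambda}N_\lambda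 ,$$ a graded abelian group that depends functorially on $M$ and $N$. **Proposition.** For every $i$ with $1\le i\le n-1$ there are isomorphisms of graded abelian groups, natural in $M,N\in\mathcal C$, $${}_\psi(\mathcal E_iM)\otimes N\;\cong\;{}_\psi M\otimes(\mathcal K_i\mathcal F_iN)\{1\},$$ $${}_\psi(\mathcal F_iM)\otimes N\;\cong\;{}_\psi M\otimes(\mathcal K_i^{-1}\mathcal E_iN)\{1\},$$ $${}_\psi(\mathcal K_iM)\otimes N\;\cong\;{}_\psi M\otimes(\mathcal K_iN).$$ -/

import Mathlib

open CategoryTheory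
open scoped TensorProduct

/-! # Arc rings, flat tangles and their bimodules

A closed one-manifold in the plane is encoded as follows. Orient it and mark points on it so that
every circle carries at least one mark; let `π` be the permutation that sends a marked point to the
next one along the orientation. The circles are the cycles of `π`. The two-dimensional topological
quantum field theory attached to the Frobenius ring `A = ℤ[X]/(X²)` (with `tr 1 = 0`, `tr X = 1`)
takes the value `A ⊗ ⋯ ⊗ A` (one factor for each circle) on it, which is the ring `Circ π` with one
generator `X x` for every mark `x`, subject to `X x ^ 2 = 0` and to `X x = X y` if `x` and `y` lie
on the same circle.

A saddle that reconnects the arcs leaving the marks `x` and `y` replaces `π` by `π * swap x y`. It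
merges two circles, and induces the multiplication of `A`, if `x` and `y` lie on different circles;
it splits a circle, and induces the comultiplication `Δ(1) = X ⊗ 1 + 1 ⊗ X`, `Δ(X) = X ⊗ X`, if they
lie on the same circle. In terms of the generators the induced map is multiplication by `1` and by
`X x + X y`, respectively. -/

namespace ArcAlg

set_option linter.unusedSectionVars false

section Saddles

open Equiv MvPolynomial

variable {Ω Ω' : Type} [Finite Ω] [Finite Ω']

open Classical in
/-- The polynomial that multiplies under the saddle reconnecting the arcs that leave the distinct
marks `x` and `y`: it is `1` if two circles merge (multiplication of `A`) and `X x + X y` if a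
circle splits (comultiplication of `A`). -/
noncomputable def saddleStep (π : Perm Ω) (x y : Ω) : MvPolynomial Ω ℤ :=
  if π.SameCycle x y then X x + X y else 1

open Classical in
/-- The product of the polynomials of a sequence of saddles that are performed one after the
other. -/
noncomputable def saddleFactor : Perm Ω → List (Ω × Ω) → MvPolynomial Ω ℤ
  | _, [] => 1
  | π, (x, y) :: L =>
      saddleStep π x y * saddleFactor (π * swap x y) L

open Classical in
/-- The one-manifold after a sequence of saddles. -/
noncomputable def afterSaddles : Perm Ω → List (Ω × Ω) → Perm Ω
  | π, [] => π
  | π, (x, y) :: L => afterSaddles (π * swap x y) L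

/-- The relations `X x ^ 2 = 0` and `X x = X (π x)`. -/
noncomputable def circIdeal (π : Perm Ω) : Ideal (MvPolynomial Ω ℤ) :=
  Ideal.span ({f | ∃ x, f = X x ^ 2} ∪ {f | ∃ x, f = X x - X (π x)})

theorem sq_mem_circIdeal (π : Perm Ω) (x : Ω) : X x ^ 2 ∈ circIdeal π :=
  Ideal.subset_span (Or.inl ⟨x, rfl⟩)

theorem step_mem_circIdeal (π : Perm Ω) (x : Ω) : X x - X (π x) ∈ circIdeal π :=
  Ideal.subset_span (Or.inr ⟨x, rfl⟩)

theorem sc_ind {π : Perm Ω} {r : Ω → Ω → Prop} (h0 : ∀ x, r x x) (h1 : ∀ x, r x (π x))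
    (ht : ∀ x y z, r x y → r y z → r x z) {x y : Ω} (h : π.SameCycle x y) : r x y := by
  obtain ⟨n, rfl⟩ := h.exists_nat_pow_eq
  clear h
  induction n with
  | zero => simpa using h0 x
  | succ n ih =>
    rw [pow_succ', Perm.mul_apply]
    exact ht _ _ _ ih (h1 _)

theorem sc_step (π : Perm Ω) (x : Ω) : π.SameCycle x (π x) := ⟨1, by simp⟩

theorem sub_mem_circIdeal {π : Perm Ω} {x y : Ω} (h : π.SameCycle x y) :
    (X x - X y : MvPolynomial Ω ℤ) ∈ circIdeal π := by
  refine sc_ind (r := fun x y => (X x - X y : MvPolynomial Ω ℤ) ∈ circIdeal π) ?_ ?_ ?_ h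
  · intro x; simp
  · exact step_mem_circIdeal π
  · intro x y z h1 h2
    simpa using Ideal.add_mem _ h1 h2

open Classical in
theorem sc_mul_swap (π : Perm Ω) (x y : Ω) {u v : Ω} (h : π.SameCycle u v) :
    (π * swap x y).SameCycle u v ∨
      (((π * swap x y).SameCycle x u ∨ (π * swap x y).SameCycle y u) ∧
        ((π * swap x y).SameCycle x v ∨ (π * swap x y).SameCycle y v)) := by
  set π' := π * swap x y with hπ
  refine sc_ind (r := fun u v => π'.SameCycle u v ∨ ((π'.SameCycle x u ∨ π'.SameCycle y u) ∧
    (π'.SameCycle x v ∨ π'.SameCycle y v))) ?_ ?_ ?_ h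
  · intro z; exact Or.inl (Perm.SameCycle.refl _ _)
  · intro w
    have hs : ∀ z, π'.SameCycle z (π' z) := sc_step π'
    have hx : π' x = π y := by simp [hπ]
    have hy : π' y = π x := by simp [hπ]
    by_cases h1 : w = x
    · subst h1
      right
      exact ⟨Or.inl (Perm.SameCycle.refl _ _), Or.inr (hy ▸ hs y)⟩
    by_cases h2 : w = y
    · subst h2
      right
      exact ⟨Or.inr (Perm.SameCycle.refl _ _), Or.inl (hx ▸ hs x)⟩
    · left
      have : π' w = π w := by simp [hπ, swap_apply_of_ne_of_ne h1 h2]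
      exact this ▸ hs w
  · intro a b c h1 h2
    rcases h1 with h1 | ⟨h1, h1'⟩ <;> rcases h2 with h2 | ⟨h2, h2'⟩
    · exact Or.inl (h1.trans h2)
    · exact Or.inr ⟨h2.imp (fun h => h.trans h1.symm) (fun h => h.trans h1.symm), h2'⟩
    · exact Or.inr ⟨h1, h1'.imp (fun h => h.trans h2) (fun h => h.trans h2)⟩
    · exact Or.inr ⟨h1, h2'⟩

open Classical in
theorem sc_merge (π : Perm Ω) {x y : Ω} (h : ¬ π.SameCycle x y) :
    (π * swap x y).SameCycle x y := by
  set π' := π * swap x y with hπ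
  by_contra hc
  have hx : π' x = π y := by simp [hπ]
  have key : ∀ j : ℕ, π'.SameCycle x ((π ^ (j + 1)) y) := by
    intro j
    induction j with
    | zero => simpa [hx] using sc_step π' x
    | succ j ih =>
      set w := (π ^ (j + 1)) y with hw
      have e : (π ^ (j + 1 + 1)) y = π w := by rw [pow_succ', Perm.mul_apply]
      have h1 : w ≠ x := by
        intro hwx
        apply h
        have : π.SameCycle y w := ⟨((j + 1 : ℕ) : ℤ), by rw [hw, zpow_natCast]⟩
        rw [hwx] at this
        exact this.symm
      have h2 : w ≠ y := by
        intro hwy; rw [hwy] at ih; exact hc ih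
      have : π' w = π w := by simp [hπ, swap_apply_of_ne_of_ne h1 h2]
      rw [e, ← this]
      exact ih.trans (sc_step π' w)
  have hN := orderOf_pos π
  have := key (orderOf π - 1)
  rw [Nat.sub_add_cancel hN, pow_orderOf_eq_one] at this
  exact hc this

open Classical in
theorem sc_split (π : Perm Ω) {x y : Ω} (hxy : x ≠ y) (h : π.SameCycle x y) :
    ¬ (π * swap x y).SameCycle x y := by
  set π' := π * swap x y with hπ
  have hy : π' y = π x := by simp [hπ]
  have hex : ∃ k : ℕ, 0 < k ∧ (π ^ k) x = y := by
    obtain ⟨k, hk⟩ := h.exists_nat_pow_eq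
    refine ⟨k, Nat.pos_of_ne_zero ?_, hk⟩
    rintro rfl
    exact hxy (by simpa using hk)
  obtain ⟨hk0, hk⟩ := Nat.find_spec hex
  have hmin := fun m => Nat.find_min hex (m := m)
  set k := Nat.find hex with hkdef
  have hnx : ∀ j, 1 ≤ j → j ≤ k → (π ^ j) x ≠ x := by
    intro j h1 h2 hj
    rcases Nat.lt_or_ge j k with hlt | hge
    · apply hmin (k - j) (by omega)
      refine ⟨by omega, ?_⟩
      have : (π ^ k) x = (π ^ (k - j)) ((π ^ j) x) := by
        rw [← Perm.mul_apply, ← pow_add]; congr 2; omega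
      rw [hj] at this
      rw [← this, hk]
    · have : j = k := by omega
      subst this
      exact hxy (hj.symm.trans hk)
  have key : ∀ n : ℕ, ∃ j, 1 ≤ j ∧ j ≤ k ∧ (π' ^ n) y = (π ^ j) x := by
    intro n
    induction n with
    | zero => exact ⟨k, hk0, le_rfl, by simp [hk]⟩
    | succ n ih =>
      obtain ⟨j, h1, h2, e⟩ := ih
      rw [pow_succ', Perm.mul_apply, e]
      rcases Nat.lt_or_ge j k with hlt | hge
      · refine ⟨j + 1, by omega, by omega, ?_⟩
        have hy' : (π ^ j) x ≠ y := fun hh => hmin j hlt ⟨h1, hh⟩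
        rw [hπ, Perm.mul_apply, swap_apply_of_ne_of_ne (hnx j h1 h2) hy', pow_succ',
          Perm.mul_apply]
      · have : j = k := by omega
        refine ⟨1, le_rfl, hk0, ?_⟩
        rw [this, hk, hy, pow_one]
  intro hc
  obtain ⟨n, hn⟩ := hc.symm.exists_nat_pow_eq
  obtain ⟨j, h1, h2, e⟩ := key n
  exact hnx j h1 h2 (e ▸ hn)

/-- The way a saddle at `x` and `y` changes the relation of lying on the same circle. -/
structure SaddleRel (r r' : Ω → Ω → Prop) (x y : Ω) : Prop where
  eqv : Equivalence r
  eqv' : Equivalence r'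
  split : r x y → ¬ r' x y
  merge : ¬ r x y → r' x y
  fwd : ∀ u v, r u v → r' u v ∨ ((r' x u ∨ r' y u) ∧ (r' x v ∨ r' y v))
  bwd : ∀ u v, r' u v → r u v ∨ ((r x u ∨ r y u) ∧ (r x v ∨ r y v))

open Classical in
theorem saddleRel (π : Perm Ω) {x y : Ω} (h : x ≠ y) :
    SaddleRel π.SameCycle (π * swap x y).SameCycle x y where
  eqv := Perm.SameCycle.equivalence _
  eqv' := Perm.SameCycle.equivalence _
  split := sc_split π h
  merge := sc_merge π
  fwd _ _ := sc_mul_swap π x y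
  bwd u v hh := by
    have := sc_mul_swap (π * swap x y) x y hh
    simpa [mul_assoc] using this

open Classical in
theorem saddleRel_left (π : Perm Ω) {x y : Ω} (h : x ≠ y) :
    SaddleRel π.SameCycle (swap x y * π).SameCycle x y := by
  have := saddleRel π⁻¹ h
  have e : (π⁻¹ * swap x y) = (swap x y * π)⁻¹ := by simp
  rw [e] at this
  have e1 : ∀ σ : Perm Ω, σ⁻¹.SameCycle = σ.SameCycle := by
    intro σ; ext a b; exact Perm.sameCycle_inv
  rwa [e1, e1] at this

open Classical in
/-- Two saddles commute. -/
theorem SaddleRel.comm {R : Type} [CommRing R] {r0 r1 r2 r3 : Ω → Ω → Prop} {x y x' y' : Ω}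
    (h01 : SaddleRel r0 r1 x y) (h13 : SaddleRel r1 r3 x' y')
    (h02 : SaddleRel r0 r2 x' y') (h23 : SaddleRel r2 r3 x y) (f : Ω → R)
    (hf : ∀ u v, r3 u v → f u = f v) :
    (if r0 x y then f x + f y else 1) * (if r1 x' y' then f x' + f y' else 1) =
    (if r0 x' y' then f x' + f y' else 1) * (if r2 x y then f x + f y else 1) := by
  have q0 := h01.eqv.refl
  have q3 := h13.eqv'.refl
  have t0 := fun a b c => @Equivalence.trans _ _ h01.eqv a b c
  have s0 := fun a b => @Equivalence.symm _ _ h01.eqv a b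
  have t1 := fun a b c => @Equivalence.trans _ _ h01.eqv' a b c
  have s1 := fun a b => @Equivalence.symm _ _ h01.eqv' a b
  have t2 := fun a b c => @Equivalence.trans _ _ h02.eqv' a b c
  have s2 := fun a b => @Equivalence.symm _ _ h02.eqv' a b
  have t3 := fun a b c => @Equivalence.trans _ _ h13.eqv' a b c
  have s3 := fun a b => @Equivalence.symm _ _ h13.eqv' a b
  have a1 := h01.split
  have a2 := h01.merge
  have a3 := h01.fwd x' y'
  have a4 := h01.bwd x' y'
  have b1 := h13.split
  have b2 := h13.merge
  have b3 := h13.fwd x y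
  have b4 := h13.bwd x y
  have c1 := h02.split
  have c2 := h02.merge
  have c3 := h02.fwd x y
  have c4 := h02.bwd x y
  have d1 := h23.split
  have d2 := h23.merge
  have d3 := h23.fwd x' y'
  have d4 := h23.bwd x' y'
  have e1 := hf x x'
  have e2 := hf x y'
  have e3 := hf y x'
  have e4 := hf y y'
  have g1 := h13.fwd x x'
  have g2 := h13.fwd x y'
  have g3 := h13.fwd y x'
  have g4 := h13.fwd y y'
  have g5 := h23.fwd x x'
  have g6 := h23.fwd x y'
  have g7 := h23.fwd y x'
  have g8 := h23.fwd y y'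
  clear h01 h13 h02 h23 hf
  by_cases p1 : r0 x y <;> by_cases p2 : r1 x' y' <;> by_cases p3 : r0 x' y' <;>
    by_cases p4 : r2 x y <;> simp only [p1, p2, p3, p4, if_true, if_false]
  all_goals first | ring1 | (exfalso; grind) | grind

open Classical in
theorem SaddleRel.kill {R : Type} [CommRing R] {r r' : Ω → Ω → Prop} {x y : Ω}
    (h : SaddleRel r r' x y) (f : Ω → R) (hf : ∀ u v, r' u v → f u = f v)
    (hsq : ∀ u, f u ^ 2 = 0) {u v : Ω} (huv : r u v) :
    (f u - f v) * (if r x y then f x + f y else 1) = 0 := by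
  have key : (f x - f y) * (if r x y then f x + f y else 1) = 0 := by
    split_ifs with hxy
    · have h1 := hsq x
      have h2 := hsq y
      linear_combination h1 - h2
    · rw [hf _ _ (h.merge hxy)]; ring
  rcases h.fwd u v huv with h1 | ⟨h1, h2⟩
  · rw [hf _ _ h1]; ring
  · rcases h1 with h1 | h1 <;> rcases h2 with h2 | h2 <;>
      rw [← hf _ _ h1, ← hf _ _ h2]
    · ring
    · exact key
    · linear_combination -key
    · ring

open Classical in
theorem mem_circIdeal_saddle (π : Perm Ω) {x y : Ω} (hxy : x ≠ y) {g : MvPolynomial Ω ℤ}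
    (hg : g ∈ circIdeal π) :
    g * saddleStep π x y ∈ circIdeal (π * swap x y) := by
  have hR := saddleRel π hxy
  set δ : MvPolynomial Ω ℤ := saddleStep π x y with hδ
  set q := Ideal.Quotient.mk (circIdeal (π * swap x y)) with hq
  have hqδ : q δ = if π.SameCycle x y then q (X x) + q (X y) else 1 := by
    rw [hδ, saddleStep]; split_ifs <;> simp
  have hsq : ∀ u, q (X u) ^ 2 = 0 := fun u => by
    rw [← map_pow]; exact Ideal.Quotient.eq_zero_iff_mem.2 (sq_mem_circIdeal _ _)
  refine Submodule.span_induction (p := fun g _ => g * δ ∈ circIdeal (π * swap x y))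
    ?_ ?_ ?_ ?_ hg
  · rintro _ (⟨u, rfl⟩ | ⟨u, rfl⟩)
    · exact Ideal.mul_mem_right _ _ (sq_mem_circIdeal _ _)
    · apply Ideal.Quotient.eq_zero_iff_mem.1
      have := hR.kill (fun u => q (X u))
        (fun u v h => Ideal.Quotient.eq.2 (sub_mem_circIdeal h)) hsq (sc_step π u)
      rw [map_mul, map_sub, ← hq, hqδ]
      exact this
  · simp
  · intro a b _ _ h1 h2
    rw [add_mul]; exact Ideal.add_mem _ h1 h2
  · intro a b _ h1
    rw [smul_eq_mul, mul_assoc]; exact Ideal.mul_mem_left _ _ h1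

/-- Every pair consists of two distinct points. -/
def Proper (L : List (Ω × Ω)) : Prop := ∀ p ∈ L, p.1 ≠ p.2

theorem mem_circIdeal_saddles {L : List (Ω × Ω)} (hL : Proper L) {π : Perm Ω}
    {g : MvPolynomial Ω ℤ} (hg : g ∈ circIdeal π) :
    g * saddleFactor π L ∈ circIdeal (afterSaddles π L) := by
  classical
  induction L generalizing π g with
  | nil => simpa [saddleFactor, afterSaddles] using hg
  | cons p L ih =>
    obtain ⟨x, y⟩ := p
    have hxy : x ≠ y := hL (x, y) (by simp)
    rw [saddleFactor, afterSaddles, ← mul_assoc]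
    apply ih (fun p hp => hL p (by simp [hp]))
    convert mem_circIdeal_saddle π hxy hg

theorem circIdeal_inv (π : Perm Ω) : circIdeal π⁻¹ = circIdeal π := by
  have key : ∀ π : Perm Ω, circIdeal π⁻¹ ≤ circIdeal π := by
    intro π
    refine Ideal.span_le.2 ?_
    rintro _ (⟨u, rfl⟩ | ⟨u, rfl⟩)
    · exact sq_mem_circIdeal _ _
    · exact sub_mem_circIdeal (Perm.sameCycle_inv.1 (sc_step π⁻¹ u))
  exact le_antisymm (key π) (by simpa using key π⁻¹)

open Classical in
theorem saddle_comm_one (π : Perm Ω) {x y x' y' : Ω} (h : x ≠ y) (h' : x' ≠ y') :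
    saddleStep π x y *
        saddleStep (swap x y * π) x' y' -
      saddleStep π x' y' *
        saddleStep (π * swap x' y') x y ∈
      circIdeal (swap x y * π * swap x' y') := by
  set q := Ideal.Quotient.mk (circIdeal (swap x y * π * swap x' y')) with hq
  have h23 := saddleRel_left (π * swap x' y') h
  rw [← mul_assoc] at h23
  have := (saddleRel_left π h).comm (saddleRel (swap x y * π) h') (saddleRel π h') h23
    (fun u => q (X u)) (fun u v h => Ideal.Quotient.eq.2 (sub_mem_circIdeal h))
  apply Ideal.Quotient.eq.1
  rw [map_mul, map_mul, ← hq]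
  simp only [saddleStep, apply_ite q, map_add, map_one]
  exact this

open Classical in
theorem saddle_comm_list (π : Perm Ω) {x y : Ω} (h : x ≠ y) {L : List (Ω × Ω)} (hL : Proper L) :
    saddleStep π x y *
        saddleFactor (swap x y * π) L -
      saddleFactor π L * saddleStep (afterSaddles π L) x y ∈
      circIdeal (afterSaddles (swap x y * π) L) := by
  induction L generalizing π with
  | nil => simp [saddleFactor, afterSaddles]
  | cons p L ih =>
    obtain ⟨x', y'⟩ := p
    have h' : x' ≠ y' := hL (x', y') (by simp)
    have hL' : Proper L := fun p hp => hL p (by simp [hp])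
    have e1 := mem_circIdeal_saddles hL' (saddle_comm_one π h h')
    have e2 := ih (π * swap x' y') hL'
    rw [mul_assoc] at e1
    simp only [saddleFactor, afterSaddles]
    rw [mul_assoc]
    have := Ideal.add_mem _ e1 (Ideal.mul_mem_left _
      (saddleStep π x' y') e2)
    convert this using 1
    ring

/-- Saddles performed on the arcs entering the given points. -/
noncomputable def saddleFactorL (π : Perm Ω) (L : List (Ω × Ω)) : MvPolynomial Ω ℤ :=
  saddleFactor π⁻¹ L

/-- The one-manifold after saddles on the arcs entering the given points. -/
noncomputable def afterSaddlesL (π : Perm Ω) (L : List (Ω × Ω)) : Perm Ω :=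
  (afterSaddles π⁻¹ L)⁻¹

open Classical in
theorem saddleFactorL_cons (π : Perm Ω) (x y : Ω) (L : List (Ω × Ω)) :
    saddleFactorL π ((x, y) :: L) =
      saddleStep π x y * saddleFactorL (swap x y * π) L := by
  simp [saddleFactorL, saddleFactor, saddleStep]

open Classical in
theorem afterSaddlesL_cons (π : Perm Ω) (x y : Ω) (L : List (Ω × Ω)) :
    afterSaddlesL π ((x, y) :: L) = afterSaddlesL (swap x y * π) L := by
  simp [afterSaddlesL, afterSaddles]

open Classical in
/-- The product of the transpositions of the given pairs. -/
noncomputable def swapProd (L : List (Ω × Ω)) : Perm Ω := (L.map fun p => swap p.1 p.2).prod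

open Classical in
theorem afterSaddles_eq (π : Perm Ω) (L : List (Ω × Ω)) :
    afterSaddles π L = π * swapProd L := by
  induction L generalizing π with
  | nil => simp [afterSaddles, swapProd]
  | cons p L ih =>
    obtain ⟨x, y⟩ := p
    rw [afterSaddles, ih]
    simp [swapProd, mul_assoc]

theorem afterSaddlesL_eq (π : Perm Ω) (L : List (Ω × Ω)) :
    afterSaddlesL π L = (swapProd L)⁻¹ * π := by
  rw [afterSaddlesL, afterSaddles_eq]; simp

theorem mem_circIdeal_saddlesL {L : List (Ω × Ω)} (hL : Proper L) {π : Perm Ω}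
    {g : MvPolynomial Ω ℤ} (hg : g ∈ circIdeal π) :
    g * saddleFactorL π L ∈ circIdeal (afterSaddlesL π L) := by
  rw [afterSaddlesL, circIdeal_inv]
  rw [← circIdeal_inv] at hg
  exact mem_circIdeal_saddles hL hg

theorem saddles_comm (π : Perm Ω) {L₁ L₂ : List (Ω × Ω)} (h₁ : Proper L₁) (h₂ : Proper L₂) :
    saddleFactorL π L₁ * saddleFactor (afterSaddlesL π L₁) L₂ -
      saddleFactor π L₂ * saddleFactorL (afterSaddles π L₂) L₁ ∈
      circIdeal (afterSaddles (afterSaddlesL π L₁) L₂) := by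
  classical
  induction L₁ generalizing π with
  | nil => simp [saddleFactorL, afterSaddlesL, saddleFactor, afterSaddles]
  | cons p L ih =>
    obtain ⟨x, y⟩ := p
    have h : x ≠ y := h₁ (x, y) (by simp)
    have hL' : Proper L := fun p hp => h₁ p (by simp [hp])
    rw [saddleFactorL_cons, saddleFactorL_cons, afterSaddlesL_cons]
    have e1 := mem_circIdeal_saddlesL hL' (saddle_comm_list π h h₂)
    have e2 := ih (swap x y * π) hL'
    have e3 : afterSaddlesL (afterSaddles (swap x y * π) L₂) L =
        afterSaddles (afterSaddlesL (swap x y * π) L) L₂ := by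
      simp only [afterSaddlesL_eq, afterSaddles_eq, mul_assoc]
    have e4 : afterSaddles (swap x y * π) L₂ = swap x y * afterSaddles π L₂ := by
      simp only [afterSaddles_eq, mul_assoc]
    rw [e3] at e1
    rw [e4] at e1 e2
    have := Ideal.add_mem _ e1 (Ideal.mul_mem_left _
      (saddleStep π x y) e2)
    convert this using 1
    ring

/-- `π'` is the permutation `π` with some marked points forgotten. -/
structure Marks (ι j : Ω' → Ω) (π' : Perm Ω') (π : Perm Ω) : Prop where
  inj : Function.Injective ι
  sep : ∀ x y, ι x = j y → x = y
  out : ∀ x, π (ι x) = j (π' x)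
  inn : ∀ x, j x = ι x ∨ π (j x) = ι x

namespace Marks

variable {ι j : Ω' → Ω} {π' : Perm Ω'} {π : Perm Ω}

theorem inj' (h : Marks ι j π' π) : Function.Injective j := by
  intro x y hxy
  have : π (ι (π'⁻¹ x)) = π (ι (π'⁻¹ y)) := by simp [h.out, hxy]
  simpa using h.inj (π.injective this)

theorem inv (h : Marks ι j π' π) : Marks j ι π'⁻¹ π⁻¹ where
  inj := h.inj'
  sep x y hxy := (h.sep y x hxy.symm).symm
  out x := by
    rw [Perm.inv_eq_iff_eq, h.out]; simp
  inn x := by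
    rcases h.inn x with h1 | h1
    · exact Or.inl h1.symm
    · right; rw [Perm.inv_eq_iff_eq, h1]

theorem sc_j (h : Marks ι j π' π) (x : Ω') : π.SameCycle (j x) (ι x) := by
  rcases h.inn x with h1 | h1
  · rw [h1]
  · rw [← h1]; exact sc_step _ _

theorem sc_iff (h : Marks ι j π' π) {x y : Ω'} :
    π.SameCycle (ι x) (ι y) ↔ π'.SameCycle x y := by
  constructor
  · intro hh
    obtain ⟨n, hn⟩ := hh.exists_nat_pow_eq
    have key : ∀ n : ℕ, ∃ z, π'.SameCycle x z ∧ ((π ^ n) (ι x) = ι z ∨ (π ^ n) (ι x) = j z) := by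
      intro n
      induction n with
      | zero => exact ⟨x, Perm.SameCycle.refl _ _, Or.inl rfl⟩
      | succ n ih =>
        obtain ⟨z, hz, h1⟩ := ih
        rw [pow_succ', Perm.mul_apply]
        have hι : (π ^ n) (ι x) = ι z → ∃ z, π'.SameCycle x z ∧
            (π ((π ^ n) (ι x)) = ι z ∨ π ((π ^ n) (ι x)) = j z) := by
          intro e
          exact ⟨π' z, hz.trans (sc_step _ _), Or.inr (by rw [e, h.out])⟩
        rcases h1 with h1 | h1
        · exact hι h1
        · rcases h.inn z with h2 | h2
          · exact hι (h1.trans h2)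
          · exact ⟨z, hz, Or.inl (by rw [h1, h2])⟩
    obtain ⟨z, hz, h1⟩ := key n
    rw [hn] at h1
    rcases h1 with h1 | h1
    · rwa [h.inj h1]
    · rwa [h.sep _ _ h1]
  · refine sc_ind (r := fun x y => π.SameCycle (ι x) (ι y)) ?_ ?_ ?_
    · intro x; exact Perm.SameCycle.refl _ _
    · intro x
      have := sc_step π (ι x)
      rw [h.out] at this
      exact this.trans (h.sc_j _)
    · intro x y z h1 h2; exact h1.trans h2

open Classical in
theorem swap (h : Marks ι j π' π) (x y : Ω') :
    Marks ι j (π' * Equiv.swap x y) (π * Equiv.swap (ι x) (ι y)) where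
  inj := h.inj
  sep := h.sep
  out z := by
    rw [Perm.mul_apply, h.inj.swap_apply, h.out, Perm.mul_apply]
  inn z := by
    rcases h.inn z with h1 | h1
    · exact Or.inl h1
    · by_cases hx : j z = ι x
      · have := h.sep _ _ hx.symm
        subst this; exact Or.inl hx
      by_cases hy : j z = ι y
      · have := h.sep _ _ hy.symm
        subst this; exact Or.inl hy
      right
      rw [Perm.mul_apply, swap_apply_of_ne_of_ne hx hy, h1]

theorem saddleFactor (h : Marks ι j π' π) (L : List (Ω' × Ω')) :
    ArcAlg.saddleFactor π (L.map (Prod.map ι ι)) = rename ι (ArcAlg.saddleFactor π' L) := by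
  classical
  induction L generalizing π π' with
  | nil => simp [ArcAlg.saddleFactor]
  | cons p L ih =>
    obtain ⟨x, y⟩ := p
    simp only [List.map_cons, Prod.map_apply, ArcAlg.saddleFactor]
    rw [ih (h.swap x y), map_mul, saddleStep, saddleStep, h.sc_iff, apply_ite (rename ι)]
    simp

theorem saddleFactorL (h : Marks ι j π' π) (L : List (Ω' × Ω')) :
    ArcAlg.saddleFactorL π (L.map (Prod.map j j)) = rename j (ArcAlg.saddleFactorL π' L) :=
  h.inv.saddleFactor L

end Marks

open Classical in
/-- The two ways to describe a saddle agree. -/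
theorem saddleFactor_eq_L (π : Perm Ω) {L : List (Ω × Ω)} (hp : Proper L)
    (hL : L.Pairwise fun p q => p.1 ≠ q.1 ∧ p.1 ≠ q.2 ∧ p.2 ≠ q.1 ∧ p.2 ≠ q.2) :
    afterSaddlesL π (L.map (Prod.map π π)) = afterSaddles π L ∧
    saddleFactor π L - saddleFactorL π (L.map (Prod.map π π)) ∈ circIdeal (afterSaddles π L) := by
  induction L generalizing π with
  | nil => simp [saddleFactorL, saddleFactor, afterSaddlesL, afterSaddles]
  | cons p L ih =>
    obtain ⟨x, y⟩ := p
    have hxy : x ≠ y := hp (x, y) (by simp)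
    have hp' : Proper L := fun p h => hp p (by simp [h])
    rw [List.pairwise_cons] at hL
    obtain ⟨hL1, hL2⟩ := hL
    have e : swap (π x) (π y) * π = π * swap x y := by
      rw [mul_swap_eq_swap_mul]
    have eL : L.map (Prod.map π π) =
        L.map (Prod.map (π * swap x y) (π * swap x y)) := by
      apply List.map_congr_left
      intro q hq
      obtain ⟨h1, h2, h3, h4⟩ := hL1 q hq
      obtain ⟨a, b⟩ := q
      simp only at h1 h2 h3 h4
      simp [swap_apply_of_ne_of_ne h1.symm h3.symm, swap_apply_of_ne_of_ne h2.symm h4.symm]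
    obtain ⟨i1, i2⟩ := ih (π * swap x y) hp' hL2
    simp only [List.map_cons, Prod.map_apply, saddleFactorL_cons, afterSaddlesL_cons, e,
      saddleFactor, afterSaddles]
    rw [eL]
    refine ⟨i1, ?_⟩
    have s1 : (X x - X (π y) : MvPolynomial Ω ℤ) ∈ circIdeal (π * swap x y) := by
      simpa using step_mem_circIdeal (π * swap x y) x
    have s2 : (X y - X (π x) : MvPolynomial Ω ℤ) ∈ circIdeal (π * swap x y) := by
      simpa using step_mem_circIdeal (π * swap x y) y
    have s3 : saddleStep π x y -
        saddleStep π (π x) (π y) ∈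
          circIdeal (π * swap x y) := by
      simp only [saddleStep, Perm.sameCycle_apply_left, Perm.sameCycle_apply_right]
      split_ifs
      · convert Ideal.add_mem _ s1 s2 using 1
        ring
      · simp
    have e1 := mem_circIdeal_saddles hp' s3
    have := Ideal.add_mem _ e1 (Ideal.mul_mem_left _
      (saddleStep π (π x) (π y)) i2)
    convert this using 1
    ring

/-- Saddles with a circle that carries a single marked point are mergers with the unit. -/
theorem saddleStep_of_fixed (π : Perm Ω) {x y : Ω} (hxy : x ≠ y) (h : π x = x ∨ π y = y) :
    saddleStep π x y = 1 := by
  rw [saddleStep, if_neg]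
  intro hs
  rcases h with h | h
  · exact hxy (hs.eq_of_left h)
  · exact hxy (hs.eq_of_right h)

/-- The number of circles, that is of cycles, fixed points included. -/
noncomputable def numCircles (π : Perm Ω) : ℕ := Nat.card (Quotient (Perm.SameCycle.setoid π))

theorem numCircles_split {r r' : Setoid Ω} {x y : Ω} (hxy : r x y) (hxy' : ¬ r' x y)
    (h : ∀ u v, r' u v → r u v)
    (h' : ∀ u v, r u v → r' u v ∨ ((r' x u ∨ r' y u) ∧ (r' x v ∨ r' y v))) :
    Nat.card (Quotient r') = Nat.card (Quotient r) + 1 := by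
  classical
  let g : Quotient r' → Option (Quotient r) := fun c =>
    if c = Quotient.mk r' y then none else some (Quotient.map' (s₁ := r') (s₂ := r) id h c)
  have hg : Function.Bijective g := by
    constructor
    · intro a b
      induction a using Quotient.inductionOn with | _ a =>
      induction b using Quotient.inductionOn with | _ b =>
      intro hab
      simp only [g] at hab
      split_ifs at hab with h1 h2 h2
      · rw [h1, h2]
      · have h3 : r a b := by
          have := Option.some.inj hab
          exact Quotient.exact this
        have n1 : ¬ r' y a := fun hh => h1 (Quotient.sound (r'.symm hh))
        have n2 : ¬ r' y b := fun hh => h2 (Quotient.sound (r'.symm hh))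
        apply Quotient.sound
        rcases h' _ _ h3 with h4 | ⟨h4, h5⟩
        · exact h4
        · exact r'.trans (r'.symm (h4.resolve_right n1)) (h5.resolve_right n2)
    · intro b
      cases b with
      | none => exact ⟨Quotient.mk r' y, by simp [g]⟩
      | some b =>
        induction b using Quotient.inductionOn with | _ b =>
        by_cases hb : r' y b
        · refine ⟨Quotient.mk r' x, ?_⟩
          have : Quotient.mk r' x ≠ Quotient.mk r' y := fun hh => hxy' (Quotient.exact hh)
          simp only [g, if_neg this]
          congr 1
          exact Quotient.sound (r.trans hxy (h _ _ hb))
        · refine ⟨Quotient.mk r' b, ?_⟩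
          have : Quotient.mk r' b ≠ Quotient.mk r' y :=
            fun hh => hb (r'.symm (Quotient.exact hh))
          simp only [g, if_neg this]
          rfl
  rw [Nat.card_congr (Equiv.ofBijective g hg), Finite.card_option]

open Classical in
theorem numCircles_mul_swap (π : Perm Ω) {x y : Ω} (hxy : x ≠ y) :
    (numCircles (π * swap x y) : ℤ) =
      numCircles π + if π.SameCycle x y then 1 else -1 := by
  have h := saddleRel π hxy
  have hr := @Equivalence.refl _ _ h.eqv
  have ht := fun a b c => @Equivalence.trans _ _ h.eqv a b c
  have hs := fun a b => @Equivalence.symm _ _ h.eqv a b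
  have ht' := fun a b c => @Equivalence.trans _ _ h.eqv' a b c
  have hs' := fun a b => @Equivalence.symm _ _ h.eqv' a b
  split_ifs with hc
  · have := numCircles_split (r := Perm.SameCycle.setoid π)
      (r' := Perm.SameCycle.setoid (π * swap x y)) hc (h.split hc) (fun u v huv => by
        rcases h.bwd u v huv with h1 | ⟨h1, h2⟩
        · exact h1
        · change π.SameCycle u v
          grind) h.fwd
    simp only [numCircles]; rw [this]; push_cast; ring
  · have := numCircles_split (r' := Perm.SameCycle.setoid π)
      (r := Perm.SameCycle.setoid (π * swap x y)) (h.merge hc) hc (fun u v huv => by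
        have hm := h.merge hc
        rcases h.fwd u v huv with h1 | ⟨h1, h2⟩
        · exact h1
        · change (π * swap x y).SameCycle u v
          grind) h.bwd
    simp only [numCircles]; rw [this]; push_cast; ring

theorem numCircles_marks {ι j : Ω' → Ω} {π' : Perm Ω'} {π : Perm Ω} (h : Marks ι j π' π)
    (hc : ∀ z, ∃ x, z = ι x ∨ z = j x) : numCircles π = numCircles π' := by
  symm
  let g : Quotient (Perm.SameCycle.setoid π') → Quotient (Perm.SameCycle.setoid π) :=
    Quotient.map' ι fun a b hab => h.sc_iff.2 hab
  refine Nat.card_congr (Equiv.ofBijective g ⟨?_, ?_⟩)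
  · intro a b
    induction a using Quotient.inductionOn with | _ a =>
    induction b using Quotient.inductionOn with | _ b =>
    intro hab
    exact Quotient.sound (h.sc_iff.1 (Quotient.exact hab))
  · intro b
    induction b using Quotient.inductionOn with | _ b =>
    obtain ⟨x, hx⟩ := hc b
    refine ⟨Quotient.mk _ x, Quotient.sound ?_⟩
    change π.SameCycle (ι x) b
    rcases hx with rfl | rfl
    · exact Perm.SameCycle.refl _ _
    · exact (h.sc_j x).symm

theorem numCircles_disjoint {Ω₁ Ω₂ : Type} [Finite Ω₁] [Finite Ω₂] {e₁ : Ω₁ → Ω} {e₂ : Ω₂ → Ω}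
    {π₁ : Perm Ω₁} {π₂ : Perm Ω₂} {π : Perm Ω} (h₁ : Marks e₁ e₁ π₁ π) (h₂ : Marks e₂ e₂ π₂ π)
    (hd : ∀ x y, e₁ x ≠ e₂ y) (hc : ∀ z, (∃ x, e₁ x = z) ∨ ∃ x, e₂ x = z) :
    numCircles π = numCircles π₁ + numCircles π₂ := by
  have hn : ∀ x y, ¬ π.SameCycle (e₁ x) (e₂ y) := by
    intro x y hxy
    obtain ⟨n, hn⟩ := hxy.exists_nat_pow_eq
    have : ∀ n : ℕ, ∃ z, (π ^ n) (e₁ x) = e₁ z := by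
      intro n
      induction n with
      | zero => exact ⟨x, rfl⟩
      | succ n ih =>
        obtain ⟨z, hz⟩ := ih
        exact ⟨π₁ z, by rw [pow_succ', Perm.mul_apply, hz, h₁.out]⟩
    obtain ⟨z, hz⟩ := this n
    exact hd _ _ (hz.symm.trans hn)
  symm
  let g : Quotient (Perm.SameCycle.setoid π₁) ⊕ Quotient (Perm.SameCycle.setoid π₂) →
      Quotient (Perm.SameCycle.setoid π) :=
    Sum.elim (Quotient.map' e₁ fun a b hab => h₁.sc_iff.2 hab)
      (Quotient.map' e₂ fun a b hab => h₂.sc_iff.2 hab)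
  have hg : Function.Bijective g := by
    constructor
    · rintro (a | a) (b | b) <;>
      · induction a using Quotient.inductionOn with | _ a =>
        induction b using Quotient.inductionOn with | _ b =>
        intro hab
        have hab' := Quotient.exact hab
        first
          | exact congrArg Sum.inl (Quotient.sound (h₁.sc_iff.1 hab'))
          | exact congrArg Sum.inr (Quotient.sound (h₂.sc_iff.1 hab'))
          | exact absurd hab' (hn _ _)
          | exact absurd (Perm.SameCycle.symm hab') (hn _ _)
    · intro b
      induction b using Quotient.inductionOn with | _ b =>
      rcases hc b with ⟨x, rfl⟩ | ⟨x, rfl⟩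
      · exact ⟨Sum.inl (Quotient.mk _ x), rfl⟩
      · exact ⟨Sum.inr (Quotient.mk _ x), rfl⟩
  simp only [numCircles]
  rw [← Nat.card_congr (Equiv.ofBijective g hg), Nat.card_sum]

theorem numCircles_one : numCircles (1 : Perm Ω) = Nat.card Ω := by
  refine (Nat.card_congr (Equiv.ofBijective
    (fun x => Quotient.mk (Perm.SameCycle.setoid (1 : Perm Ω)) x) ⟨?_, ?_⟩)).symm
  · intro a b hab
    exact Perm.sameCycle_one.1 (Quotient.exact hab)
  · exact Quotient.mk_surjective

theorem numCircles_inv (π : Perm Ω) : numCircles π⁻¹ = numCircles π := by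
  refine Nat.card_congr (Quotient.congr (Equiv.refl _) ?_)
  intro a b
  exact Perm.sameCycle_inv

theorem saddleFactor_homogeneous (π : Perm Ω) {L : List (Ω × Ω)} (hL : Proper L) :
    IsWeightedHomogeneous (fun _ : Ω => (2 : ℤ)) (saddleFactor π L)
      (numCircles (afterSaddles π L) - numCircles π + L.length) := by
  classical
  induction L generalizing π with
  | nil => simpa [saddleFactor, afterSaddles] using isWeightedHomogeneous_one ℤ _
  | cons p L ih =>
    obtain ⟨x, y⟩ := p
    have h : x ≠ y := hL (x, y) (by simp)
    have h1 := ih (π * swap x y) (fun p hp => hL p (by simp [hp]))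
    have h2 := numCircles_mul_swap π h
    have h3 : IsWeightedHomogeneous (fun _ : Ω => (2 : ℤ)) (saddleStep π x y)
        ((if π.SameCycle x y then 1 else -1) + 1) := by
      rw [saddleStep]
      split_ifs
      · exact (isWeightedHomogeneous_X ℤ _ x).add (isWeightedHomogeneous_X ℤ _ y)
      · exact isWeightedHomogeneous_one ℤ _
    rw [saddleFactor, afterSaddles]
    have h4 := h3.mul h1
    convert h4 using 1
    · rw [h2, List.length_cons]
      push_cast
      split_ifs <;> ring

section SwapProd

variable {O : Type} {f g : O → Ω}

open Classical in
theorem swapProd_fixed (l : List O) {z : Ω} (h : ∀ o ∈ l, z ≠ f o ∧ z ≠ g o) :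
    swapProd (l.map fun o => (f o, g o)) z = z := by
  induction l with
  | nil => simp [swapProd]
  | cons a l ih =>
    have h1 := h a (by simp)
    have h2 := ih (fun o ho => h o (by simp [ho]))
    simp only [swapProd, List.map_cons, List.prod_cons, Perm.mul_apply] at h2 ⊢
    rw [h2, swap_apply_of_ne_of_ne h1.1 h1.2]

open Classical in
theorem swapProd_apply {l : List O} (hl : l.Nodup) (hf : Function.Injective f)
    (hg : Function.Injective g) (hfg : ∀ a b, f a ≠ g b) {o : O} (ho : o ∈ l) :
    swapProd (l.map fun o => (f o, g o)) (f o) = g o ∧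
    swapProd (l.map fun o => (f o, g o)) (g o) = f o := by
  induction l with
  | nil => simp at ho
  | cons a l ih =>
    rw [List.nodup_cons] at hl
    have e : ∀ z, swapProd ((a :: l).map fun o => (f o, g o)) z =
        swap (f a) (g a) (swapProd (l.map fun o => (f o, g o)) z) := by
      intro z
      simp [swapProd]
    rw [e, e]
    rcases List.mem_cons.1 ho with rfl | ho
    · rw [swapProd_fixed, swapProd_fixed]
      · simp
      · intro b hb
        exact ⟨(hfg _ _).symm, fun hh => hl.1 (hg hh ▸ hb)⟩
      · intro b hb
        exact ⟨fun hh => hl.1 (hf hh ▸ hb), hfg _ _⟩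
    · obtain ⟨h1, h2⟩ := ih hl.2 ho
      have hoa : o ≠ a := fun hh => hl.1 (hh ▸ ho)
      rw [h1, h2, swap_apply_of_ne_of_ne (hfg _ _).symm (fun hh => hoa (hg hh)),
        swap_apply_of_ne_of_ne (fun hh => hoa (hf hh)) (hfg _ _)]
      exact ⟨rfl, rfl⟩

theorem swapProd_inv {l : List O} (hl : l.Nodup) (hf : Function.Injective f)
    (hg : Function.Injective g) (hfg : ∀ a b, f a ≠ g b) :
    (swapProd (l.map fun o => (f o, g o)))⁻¹ = swapProd (l.map fun o => (f o, g o)) := by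
  ext z
  rw [Perm.inv_eq_iff_eq]
  by_cases h : ∃ o ∈ l, z = f o ∨ z = g o
  · obtain ⟨o, ho, rfl | rfl⟩ := h
    · rw [(swapProd_apply hl hf hg hfg ho).1, (swapProd_apply hl hf hg hfg ho).2]
    · rw [(swapProd_apply hl hf hg hfg ho).2, (swapProd_apply hl hf hg hfg ho).1]
  · push Not at h
    rw [swapProd_fixed l h, swapProd_fixed l h]

theorem proper_map {l : List O} (hfg : ∀ a b, f a ≠ g b) :
    Proper (l.map fun o => (f o, g o)) := by
  intro p hp
  obtain ⟨o, -, rfl⟩ := List.mem_map.1 hp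
  exact hfg _ _

end SwapProd

section Contraction

variable {O : Type} [LinearOrder O] [Fintype O]

/-- The elements of a finite linear order, listed from left to right. -/
def pointList (O : Type) [LinearOrder O] [Fintype O] : List O := Finset.univ.sort (· ≤ ·)

theorem mem_pointList (o : O) : o ∈ pointList O := by simp [pointList]

theorem nodup_pointList : (pointList O).Nodup := Finset.sort_nodup _ _

/-- The saddles of a contraction cobordism. Let `u` and `v` be the one-manifolds `W(c)b` and `W(b)a`,
both marked in the odd points, and draw the first one above the second. The arc of `b` that starts
in the odd point `o` lies on the arc of `u` that leaves the mark `o` of the upper manifold, and its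
mirror image in `W(b)` lies on the arc of `v` that enters the mark `o` of the lower manifold, that
is on the arc that leaves the mark `v⁻¹ o`. There is one saddle for each arc of `b`. -/
def contractionList (v : Perm O) : List ((O ⊕ O) × (O ⊕ O)) :=
  (pointList O).map fun o => (Sum.inl o, Sum.inr (v⁻¹ o))

/-- The polynomial that describes a contraction cobordism: the product of the polynomials of the
saddles, after which the two marks `o` (upper and lower), which now lie on the same vertical strand,
are identified. -/
noncomputable def contractionFactor (u v : Perm O) : MvPolynomial O ℤ :=
  rename (Sum.elim id id) (saddleFactor (Perm.sumCongr u v) (contractionList v))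

theorem proper_contractionList (v : Perm O) : Proper (contractionList v) :=
  proper_map (by simp)

theorem afterSaddles_contraction (u v : Perm O) (o : O) :
    afterSaddles (Perm.sumCongr u v) (contractionList v) (Sum.inl o) = Sum.inr o ∧
    afterSaddles (Perm.sumCongr u v) (contractionList v) (Sum.inr o) = Sum.inl (u (v o)) := by
  have h1 := (swapProd_apply (f := (Sum.inl : O → O ⊕ O)) (g := fun o => Sum.inr (v⁻¹ o))
    nodup_pointList Sum.inl_injective (Sum.inr_injective.comp (v⁻¹).injective) (by simp)
    (mem_pointList o)).1
  have h2 := (swapProd_apply (f := (Sum.inl : O → O ⊕ O)) (g := fun o => Sum.inr (v⁻¹ o))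
    nodup_pointList Sum.inl_injective (Sum.inr_injective.comp (v⁻¹).injective) (by simp)
    (mem_pointList (v o))).2
  rw [afterSaddles_eq, Perm.mul_apply, Perm.mul_apply, contractionList, h1]
  have e : v⁻¹ (v o) = o := by simp
  simp only [e] at h2
  rw [h2]
  simp

theorem marks_contraction (u v : Perm O) :
    Marks (Sum.inr : O → O ⊕ O) Sum.inl (u * v)
      (afterSaddles (Perm.sumCongr u v) (contractionList v)) where
  inj := Sum.inr_injective
  sep := by simp
  out o := (afterSaddles_contraction u v o).2
  inn o := Or.inr (afterSaddles_contraction u v o).1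

/-- Forgetting marked points. -/
theorem rename_mem_circIdeal {π : Perm Ω} {π' : Perm Ω'} (f : Ω → Ω')
    (h : ∀ z, π'.SameCycle (f z) (f (π z))) {g : MvPolynomial Ω ℤ} (hg : g ∈ circIdeal π) :
    rename f g ∈ circIdeal π' := by
  have : circIdeal π ≤ Ideal.comap (rename f : _ →ₐ[ℤ] _) (circIdeal π') := by
    refine Ideal.span_le.2 ?_
    rintro _ (⟨u, rfl⟩ | ⟨u, rfl⟩)
    · simpa using sq_mem_circIdeal π' (f u)
    · simpa using sub_mem_circIdeal (h u)
  exact this hg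

theorem fold_mem (u v : Perm O) {g : MvPolynomial (O ⊕ O) ℤ}
    (hg : g ∈ circIdeal (afterSaddles (Perm.sumCongr u v) (contractionList v))) :
    rename (Sum.elim id id) g ∈ circIdeal (u * v) := by
  refine rename_mem_circIdeal _ ?_ hg
  rintro (o | o)
  · rw [(afterSaddles_contraction u v o).1]; exact Perm.SameCycle.refl _ _
  · rw [(afterSaddles_contraction u v o).2]; exact sc_step _ _

theorem mem_contraction_left (u v : Perm O) {g : MvPolynomial O ℤ} (hg : g ∈ circIdeal u) :
    g * contractionFactor u v ∈ circIdeal (u * v) := by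
  have h1 : rename Sum.inl g ∈ circIdeal (Perm.sumCongr u v) :=
    rename_mem_circIdeal _ (fun z => sc_step (Perm.sumCongr u v) (Sum.inl z)) hg
  have h2 := fold_mem u v (mem_circIdeal_saddles (proper_contractionList v) h1)
  rw [map_mul, rename_rename] at h2
  simpa [contractionFactor] using h2

theorem mem_contraction_right (u v : Perm O) {g : MvPolynomial O ℤ} (hg : g ∈ circIdeal v) :
    g * contractionFactor u v ∈ circIdeal (u * v) := by
  have h1 : rename Sum.inr g ∈ circIdeal (Perm.sumCongr u v) :=
    rename_mem_circIdeal _ (fun z => sc_step (Perm.sumCongr u v) (Sum.inr z)) hg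
  have h2 := fold_mem u v (mem_circIdeal_saddles (proper_contractionList v) h1)
  rw [map_mul, rename_rename] at h2
  simpa [contractionFactor] using h2

/-- The saddles of a contraction, described by means of the arcs that enter the marks. -/
def contractionListL (u : Perm O) : List ((O ⊕ O) × (O ⊕ O)) :=
  (pointList O).map fun o => (Sum.inl (u o), Sum.inr o)

/-- The polynomial of a contraction, described by means of the arcs that enter the marks. -/
noncomputable def contractionFactorL (u v : Perm O) : MvPolynomial O ℤ :=
  rename (Sum.elim id id) (saddleFactorL (Perm.sumCongr u v) (contractionListL u))

theorem contraction_sub_mem (u v : Perm O) :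
    contractionFactor u v - contractionFactorL u v ∈ circIdeal (u * v) := by
  have := (saddleFactor_eq_L (Perm.sumCongr u v) (proper_contractionList v) (by
    rw [contractionList, List.pairwise_map]
    refine nodup_pointList.imp ?_
    intro a b hab
    simpa using hab)).2
  have e : (contractionList v).map (Prod.map (Perm.sumCongr u v) (Perm.sumCongr u v)) =
      contractionListL u := by
    simp [contractionList, contractionListL]
  rw [e] at this
  have := fold_mem u v this
  rwa [map_sub] at this

theorem contraction_assoc (u v w : Perm O) :
    contractionFactor u v * contractionFactor (u * v) w -
      contractionFactor v w * contractionFactor u (v * w) ∈ circIdeal (u * v * w) := by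
  -- three levels
  let i1 : O → O ⊕ (O ⊕ O) := Sum.inl
  let i2 : O → O ⊕ (O ⊕ O) := fun o => Sum.inr (Sum.inl o)
  let i3 : O → O ⊕ (O ⊕ O) := fun o => Sum.inr (Sum.inr o)
  have hi1 : Function.Injective i1 := Sum.inl_injective
  have hi2 : Function.Injective i2 := Sum.inr_injective.comp Sum.inl_injective
  have hi3 : Function.Injective i3 := Sum.inr_injective.comp Sum.inr_injective
  have h12 : ∀ a b, i1 a ≠ i2 b := by simp [i1, i2]
  have h13 : ∀ a b, i1 a ≠ i3 b := by simp [i1, i3]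
  have h23 : ∀ a b, i2 a ≠ i3 b := by simp [i2, i3]
  let π₀ : Perm (O ⊕ (O ⊕ O)) := Perm.sumCongr u (Perm.sumCongr v w)
  have p1 : ∀ o, π₀ (i1 o) = i1 (u o) := fun o => rfl
  have p2 : ∀ o, π₀ (i2 o) = i2 (v o) := fun o => rfl
  have p3 : ∀ o, π₀ (i3 o) = i3 (w o) := fun o => rfl
  let L₁ := (pointList O).map fun o => (i1 (u o), i2 o)
  let L₂ := (pointList O).map fun o => (i2 o, i3 (w⁻¹ o))
  have hu : Function.Injective fun o => i1 (u o) := hi1.comp u.injective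
  have hw : Function.Injective fun o => i3 (w⁻¹ o) := hi3.comp (w⁻¹).injective
  have P₁ : Proper L₁ := proper_map (fun a b => h12 _ _)
  have P₂ : Proper L₂ := proper_map (fun a b => h23 _ _)
  have s1 := fun o => swapProd_apply nodup_pointList hu hi2 (fun a b => h12 _ _) (mem_pointList o)
  have s2 := fun o => swapProd_apply nodup_pointList hi2 hw (fun a b => h23 _ _) (mem_pointList o)
  have s13 : ∀ o, swapProd L₁ (i3 o) = i3 o := fun o =>
    swapProd_fixed _ fun a _ => ⟨(h13 _ _).symm, (h23 _ _).symm⟩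
  have s21 : ∀ o, swapProd L₂ (i1 o) = i1 o := fun o =>
    swapProd_fixed _ fun a _ => ⟨(h12 _ _), (h13 _ _)⟩
  have s11 : ∀ o, swapProd L₁ (i1 o) = i2 (u⁻¹ o) := fun o => by
    have := (s1 (u⁻¹ o)).1
    simpa using this
  have s12 : ∀ o, swapProd L₁ (i2 o) = i1 (u o) := fun o => (s1 o).2
  have s22 : ∀ o, swapProd L₂ (i2 o) = i3 (w⁻¹ o) := fun o => (s2 o).1
  have s23 : ∀ o, swapProd L₂ (i3 o) = i2 (w o) := fun o => by
    have := (s2 (w o)).2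
    have e : w⁻¹ (w o) = o := by simp
    rwa [e] at this
  have inv1 : (swapProd L₁)⁻¹ = swapProd L₁ :=
    swapProd_inv nodup_pointList hu hi2 (fun a b => h12 _ _)
  have key := saddles_comm π₀ P₁ P₂
  -- the four factors
  let φ : O ⊕ (O ⊕ O) → O := Sum.elim id (Sum.elim id id)
  have M1 : Marks (Sum.elim i1 i2) (Sum.elim i1 i2) (Perm.sumCongr u v) π₀ := by
    refine ⟨?_, ?_, ?_, fun x => Or.inl rfl⟩
    · exact Function.Injective.sumElim hi1 hi2 h12
    · intro x y hxy
      exact Function.Injective.sumElim hi1 hi2 h12 hxy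
    · rintro (o | o) <;> simp [p1, p2]
  have M2 : Marks (Sum.elim i2 i3) (Sum.elim i1 i3) (Perm.sumCongr (u * v) w)
      (afterSaddlesL π₀ L₁) := by
    have f2 : ∀ o, afterSaddlesL π₀ L₁ (i2 o) = i1 (u (v o)) := fun o => by
      rw [afterSaddlesL_eq, inv1, Perm.mul_apply, p2, s12]
    have f3 : ∀ o, afterSaddlesL π₀ L₁ (i3 o) = i3 (w o) := fun o => by
      rw [afterSaddlesL_eq, inv1, Perm.mul_apply, p3, s13]
    have f1 : ∀ o, afterSaddlesL π₀ L₁ (i1 o) = i2 o := fun o => by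
      rw [afterSaddlesL_eq, inv1, Perm.mul_apply, p1, s11]; simp
    refine ⟨Function.Injective.sumElim hi2 hi3 h23, ?_, ?_, ?_⟩
    · rintro (a | a) (b | b) hab
      · exact absurd hab.symm (h12 _ _)
      · exact absurd hab (h23 _ _)
      · exact absurd hab.symm (h13 _ _)
      · exact congrArg _ (hi3 hab)
    · rintro (o | o) <;> simp [f2, f3]
    · rintro (o | o) <;> simp [f1]
  have M3 : Marks (Sum.elim i2 i3) (Sum.elim i2 i3) (Perm.sumCongr v w) π₀ := by
    refine ⟨?_, ?_, ?_, fun x => Or.inl rfl⟩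
    · exact Function.Injective.sumElim hi2 hi3 h23
    · intro x y hxy
      exact Function.Injective.sumElim hi2 hi3 h23 hxy
    · rintro (o | o) <;> simp [p2, p3]
  have M4 : Marks (Sum.elim i1 i3) (Sum.elim i1 i2) (Perm.sumCongr u (v * w))
      (afterSaddles π₀ L₂) := by
    have f2 : ∀ o, afterSaddles π₀ L₂ (i2 o) = i3 o := fun o => by
      rw [afterSaddles_eq, Perm.mul_apply, s22, p3]; simp
    have f3 : ∀ o, afterSaddles π₀ L₂ (i3 o) = i2 (v (w o)) := fun o => by
      rw [afterSaddles_eq, Perm.mul_apply, s23, p2]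
    have f1 : ∀ o, afterSaddles π₀ L₂ (i1 o) = i1 (u o) := fun o => by
      rw [afterSaddles_eq, Perm.mul_apply, s21, p1]
    refine ⟨Function.Injective.sumElim hi1 hi3 h13, ?_, ?_, ?_⟩
    · rintro (a | a) (b | b) hab
      · exact congrArg _ (hi1 hab)
      · exact absurd hab (h12 _ _)
      · exact absurd hab.symm (h13 _ _)
      · exact absurd hab.symm (h23 _ _)
    · rintro (o | o) <;> simp [f1, f3]
    · rintro (o | o) <;> simp [f2]
  have F1 : rename φ (saddleFactorL π₀ L₁) = contractionFactorL u v := by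
    have := M1.saddleFactorL (contractionListL u)
    have e : (contractionListL u).map (Prod.map (Sum.elim i1 i2) (Sum.elim i1 i2)) = L₁ := by
      simp [contractionListL, L₁]
    rw [e] at this
    rw [this, rename_rename, contractionFactorL]
    congr 2
    ext (o | o) <;> rfl
  have F2 : rename φ (saddleFactor (afterSaddlesL π₀ L₁) L₂) = contractionFactor (u * v) w := by
    have := M2.saddleFactor (contractionList w)
    have e : (contractionList w).map (Prod.map (Sum.elim i2 i3) (Sum.elim i2 i3)) = L₂ := by
      simp [contractionList, L₂]
    rw [e] at this
    rw [this, rename_rename, contractionFactor]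
    congr 2
    ext (o | o) <;> rfl
  have F3 : rename φ (saddleFactor π₀ L₂) = contractionFactor v w := by
    have := M3.saddleFactor (contractionList w)
    have e : (contractionList w).map (Prod.map (Sum.elim i2 i3) (Sum.elim i2 i3)) = L₂ := by
      simp [contractionList, L₂]
    rw [e] at this
    rw [this, rename_rename, contractionFactor]
    congr 2
    ext (o | o) <;> rfl
  have F4 : rename φ (saddleFactorL (afterSaddles π₀ L₂) L₁) = contractionFactorL u (v * w) := by
    have := M4.saddleFactorL (contractionListL u)
    have e : (contractionListL u).map (Prod.map (Sum.elim i1 i2) (Sum.elim i1 i2)) = L₁ := by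
      simp [contractionListL, L₁]
    rw [e] at this
    rw [this, rename_rename, contractionFactorL]
    congr 2
    ext (o | o) <;> rfl
  have key2 : rename φ (saddleFactorL π₀ L₁ * saddleFactor (afterSaddlesL π₀ L₁) L₂ -
      saddleFactor π₀ L₂ * saddleFactorL (afterSaddles π₀ L₂) L₁) ∈ circIdeal (u * v * w) := by
    refine rename_mem_circIdeal φ ?_ key
    rw [afterSaddles_eq, afterSaddlesL_eq, inv1]
    rintro (o | o | o)
    · change (u * v * w).SameCycle o (φ ((swapProd L₁ * π₀ * swapProd L₂) (i1 o)))
      simp only [Perm.mul_apply, s21, p1, s11]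
      simpa [φ, i2] using Perm.SameCycle.refl _ _
    · change (u * v * w).SameCycle o (φ ((swapProd L₁ * π₀ * swapProd L₂) (i2 o)))
      simp only [Perm.mul_apply, s22, p3, s13]
      simpa [φ, i3] using Perm.SameCycle.refl _ _
    · change (u * v * w).SameCycle o (φ ((swapProd L₁ * π₀ * swapProd L₂) (i3 o)))
      simp only [Perm.mul_apply, s23, p2, s12]
      exact sc_step (u * v * w) o
  rw [map_sub, map_mul, map_mul, F1, F2, F3, F4] at key2
  have a1 := mem_contraction_left (u * v) w (contraction_sub_mem u v)
  have a2 := contraction_sub_mem u (v * w)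
  rw [← mul_assoc] at a2
  have a3 := Ideal.mul_mem_left _ (contractionFactor v w) a2
  have := Ideal.sub_mem _ (Ideal.add_mem _ a1 key2) a3
  convert this using 1
  ring

open Classical in
/-- Marked points which lie alone on their circle can be ignored. -/
theorem saddleFactor_skip {O₁ O₂ : Type} {e : O₁ → O₂}
    {ι : Ω' → Ω} {f g : O₂ → Ω} {f' g' : O₁ → Ω'} (hf : Function.Injective f)
    (hg : Function.Injective g) (hfg : ∀ a b, f a ≠ g b) (hfe : ∀ o, f (e o) = ι (f' o))
    (hge : ∀ o, g (e o) = ι (g' o)) {π' : Perm Ω'} {π : Perm Ω} (h : Marks ι ι π' π)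
    {l : List O₂} (hl : l.Nodup) {l' : List O₁}
    (hll : l.filter (fun o => ∃ o', e o' = o) = l'.map e)
    (hex : ∀ o ∈ l, (¬ ∃ o', e o' = o) → (∀ z, ι z ≠ f o ∧ ι z ≠ g o) ∧
      (π (f o) = f o ∨ π (g o) = g o)) :
    saddleFactor π (l.map fun o => (f o, g o)) =
      rename ι (saddleFactor π' (l'.map fun o => (f' o, g' o))) := by
  induction l generalizing l' π π' with
  | nil =>
    have : l' = [] := by simpa using hll.symm
    subst this
    simp [saddleFactor]
  | cons a l ih =>
    rw [List.nodup_cons] at hl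
    have hfix : ∀ o ∈ l, (¬ ∃ o', e o' = o) → (∀ z, ι z ≠ f o ∧ ι z ≠ g o) ∧
        ((π * swap (f a) (g a)) (f o) = f o ∨ (π * swap (f a) (g a)) (g o) = g o) := by
      intro o ho hoe
      obtain ⟨h1, h2⟩ := hex o (by simp [ho]) hoe
      have hoa : o ≠ a := fun hh => hl.1 (hh ▸ ho)
      refine ⟨h1, h2.imp ?_ ?_⟩ <;> intro h3
      · rw [Perm.mul_apply, swap_apply_of_ne_of_ne (fun hh => hoa (hf hh)) (hfg _ _), h3]
      · rw [Perm.mul_apply, swap_apply_of_ne_of_ne (hfg _ _).symm (fun hh => hoa (hg hh)), h3]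
    by_cases ha : ∃ o', e o' = a
    · rw [List.filter_cons_of_pos (by simpa using ha)] at hll
      cases l' with
      | nil => simp at hll
      | cons b l' =>
        simp only [List.map_cons, List.cons.injEq] at hll
        obtain ⟨rfl, hll⟩ := hll
        simp only [List.map_cons, saddleFactor]
        rw [hfe, hge] at hfix ⊢
        rw [ih (h.swap _ _) hl.2 hll hfix, map_mul, saddleStep, saddleStep, h.sc_iff,
          apply_ite (rename ι)]
        simp
    · rw [List.filter_cons_of_neg (by simpa using ha)] at hll
      obtain ⟨h1, h2⟩ := hex a (by simp) ha
      have h' : Marks ι ι π' (π * swap (f a) (g a)) := by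
        refine ⟨h.inj, h.sep, fun x => ?_, fun x => Or.inl rfl⟩
        rw [Perm.mul_apply, swap_apply_of_ne_of_ne (h1 x).1 (h1 x).2, h.out]
      simp only [List.map_cons, saddleFactor]
      rw [saddleStep_of_fixed π (hfg _ _) h2, one_mul]
      exact ih h' hl.2 hll hfix

theorem saddleFactor_eq_one {O₂ : Type} {f g : O₂ → Ω} (hf : Function.Injective f)
    (hg : Function.Injective g) (hfg : ∀ a b, f a ≠ g b) {π : Perm Ω}
    {l : List O₂} (hl : l.Nodup) (hex : ∀ o ∈ l, π (f o) = f o ∨ π (g o) = g o) :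
    saddleFactor π (l.map fun o => (f o, g o)) = 1 := by
  have h : Marks (Empty.elim : Empty → Ω) Empty.elim (1 : Perm Empty) π :=
    ⟨fun x => x.elim, fun x => x.elim, fun x => x.elim, fun x => x.elim⟩
  have := saddleFactor_skip (O₁ := Empty) (e := Empty.elim) hf hg hfg
    (f' := id) (g' := id) (fun x => x.elim) (fun x => x.elim) h hl (l' := []) (by simp)
    (fun o ho _ => ⟨fun z => z.elim, hex o ho⟩)
  simpa [saddleFactor] using this

theorem contractionFactor_one_left (v : Perm O) : contractionFactor 1 v = 1 := by
  rw [contractionFactor, contractionList, saddleFactor_eq_one (f := (Sum.inl : O → O ⊕ O))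
    (g := fun o => Sum.inr (v⁻¹ o)) Sum.inl_injective (Sum.inr_injective.comp (v⁻¹).injective)
    (by simp) nodup_pointList (fun o _ => Or.inl rfl), map_one]

theorem contractionFactor_one_right (u : Perm O) : contractionFactor u 1 = 1 := by
  rw [contractionFactor, contractionList, saddleFactor_eq_one (f := (Sum.inl : O → O ⊕ O))
    (g := fun o => Sum.inr ((1 : Perm O)⁻¹ o)) Sum.inl_injective
    (Sum.inr_injective.comp (1⁻¹ : Perm O).injective)
    (by simp) nodup_pointList (fun o _ => Or.inr (by simp)), map_one]

theorem saddleFactor_flip (π : Perm Ω) (L : List (Ω × Ω)) :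
    saddleFactor π (L.map Prod.swap) = saddleFactor π L := by
  classical
  induction L generalizing π with
  | nil => rfl
  | cons p L ih =>
    obtain ⟨x, y⟩ := p
    simp only [List.map_cons, Prod.swap_prod_mk, saddleFactor, ih]
    rw [swap_comm, saddleStep, saddleStep, Perm.sameCycle_comm, add_comm]

theorem contractionFactor_inv (u v : Perm O) :
    contractionFactor v⁻¹ u⁻¹ = contractionFactorL u v := by
  have M : Marks (Sum.swap : O ⊕ O → O ⊕ O) Sum.swap (Perm.sumCongr u v) (Perm.sumCongr v u) := by
    refine ⟨(Equiv.sumComm O O).injective, fun x y h => (Equiv.sumComm O O).injective h, ?_,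
      fun x => Or.inl rfl⟩
    rintro (o | o) <;> rfl
  have h1 := M.saddleFactorL ((contractionListL u).map Prod.swap)
  have e : ((contractionListL u).map Prod.swap).map (Prod.map Sum.swap Sum.swap) =
      contractionList u⁻¹ := by
    simp [contractionListL, contractionList]
  rw [e] at h1
  rw [contractionFactor, contractionFactorL]
  have e2 : Perm.sumCongr v⁻¹ u⁻¹ = (Perm.sumCongr v u)⁻¹ := by
    simp
  rw [e2]
  change rename _ (saddleFactorL (Perm.sumCongr v u) _) = _
  rw [h1, rename_rename]
  have e3 : (Sum.elim id id : O ⊕ O → O) ∘ Sum.swap = Sum.elim id id := by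
    ext (o | o) <;> rfl
  rw [e3, saddleFactorL, saddleFactor_flip]
  rfl

theorem contractionFactor_rename {O' : Type} [LinearOrder O'] [Fintype O'] (e : O' ↪o O)
    {u' v' : Perm O'} {u v : Perm O} (hu : ∀ o, u (e o) = e (u' o))
    (hv : ∀ o, v (e o) = e (v' o)) (hv1 : ∀ o, (¬ ∃ o', e o' = o) → v o = o) :
    contractionFactor u v = rename e (contractionFactor u' v') := by
  classical
  have M : Marks (Sum.map e e) (Sum.map e e) (Perm.sumCongr u' v') (Perm.sumCongr u v) := by
    refine ⟨Function.Injective.sumMap e.injective e.injective,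
      fun x y h => Function.Injective.sumMap e.injective e.injective h, ?_,
      fun x => Or.inl rfl⟩
    rintro (o | o)
    · simp [hu]
    · simp [hv]
  have hvi : ∀ o, v⁻¹ (e o) = e (v'⁻¹ o) := by
    intro o
    rw [Perm.inv_eq_iff_eq, hv]
    simp
  have hll : (pointList O).filter (fun o => ∃ o', e o' = o) = (pointList O').map e := by
    apply List.Perm.eq_of_pairwise (le := (· ≤ ·))
    · intro a b _ _ h1 h2; exact le_antisymm h1 h2
    · exact (Finset.pairwise_sort _ _).filter _
    · rw [List.pairwise_map]
      exact (Finset.pairwise_sort _ _).imp fun h => e.monotone h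
    · rw [List.perm_ext_iff_of_nodup (nodup_pointList.filter _)
        (nodup_pointList.map e.injective)]
      intro a
      simp [mem_pointList]
  have := saddleFactor_skip (e := e) (ι := Sum.map e e) (f := Sum.inl)
    (g := fun o => Sum.inr (v⁻¹ o)) (f' := Sum.inl) (g' := fun o => Sum.inr (v'⁻¹ o))
    Sum.inl_injective (Sum.inr_injective.comp (v⁻¹).injective) (by simp) (by simp)
    (fun o => by rw [hvi]; rfl) M nodup_pointList (l' := pointList O') (by convert hll) (by
      intro o _ ho
      have hvo : v⁻¹ o = o := by rw [Perm.inv_eq_iff_eq, hv1 o ho]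
      refine ⟨?_, Or.inr ?_⟩
      · rintro (z | z)
        · refine ⟨?_, by simp⟩
          intro hz
          exact ho ⟨z, by simpa using hz⟩
        · refine ⟨by simp, ?_⟩
          intro hz
          rw [hvo] at hz
          exact ho ⟨z, by simpa using hz⟩
      · simp only [hvo]
        simp [hv1 o ho])
  rw [contractionFactor, contractionFactor, contractionList, this, rename_rename, rename_rename]
  congr 2
  ext (o | o) <;> rfl

theorem numCircles_rename {O' : Type} [LinearOrder O'] [Fintype O'] (e : O' ↪o O)
    {u' : Perm O'} {u : Perm O} (hu : ∀ o, u (e o) = e (u' o))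
    (hu1 : ∀ o, (¬ ∃ o', e o' = o) → u o = o) :
    (numCircles u : ℤ) = numCircles u' + (Fintype.card O - Fintype.card O') := by
  have M1 : Marks e e u' u := ⟨e.injective, fun x y h => e.injective h, hu, fun x => Or.inl rfl⟩
  have M2 : Marks (Subtype.val : {o : O // ¬ ∃ o', e o' = o} → O) Subtype.val 1 u :=
    ⟨Subtype.val_injective, fun x y h => Subtype.val_injective h, fun x => hu1 x.1 x.2,
      fun x => Or.inl rfl⟩
  have h1 := numCircles_disjoint M1 M2 (fun x y h => y.2 ⟨x, h⟩) (fun z => by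
    by_cases hz : ∃ o', e o' = z
    · exact Or.inl hz
    · exact Or.inr ⟨⟨z, hz⟩, rfl⟩)
  have h2 : Nat.card O = Nat.card O' + Nat.card {o : O // ¬ ∃ o', e o' = o} := by
    have M3 : Marks e e 1 (1 : Perm O) :=
      ⟨e.injective, fun x y h => e.injective h, fun x => rfl, fun x => Or.inl rfl⟩
    have M4 : Marks (Subtype.val : {o : O // ¬ ∃ o', e o' = o} → O) Subtype.val 1 (1 : Perm O) :=
      ⟨Subtype.val_injective, fun x y h => Subtype.val_injective h, fun x => rfl,
        fun x => Or.inl rfl⟩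
    have := numCircles_disjoint M3 M4 (fun x y h => y.2 ⟨x, h⟩) (fun z => by
      by_cases hz : ∃ o', e o' = z
      · exact Or.inl hz
      · exact Or.inr ⟨⟨z, hz⟩, rfl⟩)
    simpa only [numCircles_one] using this
  rw [numCircles_one] at h1
  rw [Nat.card_eq_fintype_card, Nat.card_eq_fintype_card] at h2
  rw [h1]
  push_cast
  have h3 : (Fintype.card O : ℤ) = Fintype.card O' + Nat.card {o : O // ¬ ∃ o', e o' = o} := by
    exact_mod_cast h2
  rw [h3]; ring

theorem IsWeightedHomogeneous_rename {f : Ω → Ω'} {g : MvPolynomial Ω ℤ} {d : ℤ}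
    (h : IsWeightedHomogeneous (fun _ : Ω => (2 : ℤ)) g d) :
    IsWeightedHomogeneous (fun _ : Ω' => (2 : ℤ)) (rename f g) d := by
  classical
  intro m hm
  have hm' : m ∈ (rename f g).support := by simpa [mem_support_iff] using hm
  obtain ⟨n, hn, hnm⟩ : ∃ n ∈ g.support, Finsupp.mapDomain f n = m := by
    by_contra hc
    push Not at hc
    apply hm
    apply coeff_rename_eq_zero
    intro n hn
    by_contra h0
    exact hc n (mem_support_iff.2 h0) hn
  have := h (mem_support_iff.1 hn)
  rw [← hnm, ← this, Finsupp.weight_apply, Finsupp.weight_apply, Finsupp.sum_mapDomain_index]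
  · simp
  · intro b m₁ m₂; simp [add_mul]

theorem contractionFactor_homogeneous (u v : Perm O) :
    IsWeightedHomogeneous (fun _ : O => (2 : ℤ)) (contractionFactor u v)
      (numCircles (u * v) - numCircles u - numCircles v + Fintype.card O) := by
  have h1 := saddleFactor_homogeneous (Perm.sumCongr u v) (proper_contractionList v)
  have h2 := numCircles_marks (marks_contraction u v) (by
    rintro (o | o)
    · exact ⟨o, Or.inr rfl⟩
    · exact ⟨o, Or.inl rfl⟩)
  have h3 : numCircles (Perm.sumCongr u v) = numCircles u + numCircles v := by
    refine numCircles_disjoint (e₁ := Sum.inl) (e₂ := Sum.inr)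
      ⟨Sum.inl_injective, fun x y h => Sum.inl_injective h, fun x => rfl, fun x => Or.inl rfl⟩
      ⟨Sum.inr_injective, fun x y h => Sum.inr_injective h, fun x => rfl, fun x => Or.inl rfl⟩
      (by simp) ?_
    rintro (o | o)
    · exact Or.inl ⟨o, rfl⟩
    · exact Or.inr ⟨o, rfl⟩
  have h4 : (contractionList v).length = Fintype.card O := by
    simp [contractionList, pointList]
  rw [h2, h3, h4] at h1
  have h5 := IsWeightedHomogeneous_rename (f := Sum.elim id id) h1
  rw [contractionFactor]
  convert h5 using 1
  push_cast; ring

end Contraction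

section Circles

variable {O : Type} [LinearOrder O] [Fintype O]

/-- The value of the topological quantum field theory on the one-manifold given by `π`: the tensor
product of copies of `A = ℤ[X]/(X²)`, one for each circle. -/
abbrev Circ (π : Perm Ω) : Type := MvPolynomial Ω ℤ ⧸ circIdeal π

/-- Multiplication by the polynomial of a contraction. -/
noncomputable def contractAux {u v w : Perm O} (h : u * v = w) :
    Circ v →ₗ[MvPolynomial O ℤ] Circ w :=
  Submodule.mapQ (circIdeal v) (circIdeal w) (contractionFactor u v • LinearMap.id) (by
    intro g hg
    subst h
    have := mem_contraction_right u v hg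
    rw [Submodule.mem_comap, LinearMap.smul_apply, LinearMap.id_apply, smul_eq_mul, mul_comm]
    exact this)

/-- The map `F(W(c)b) ⊗ F(W(b)a) → F(W(c)a)` induced by the contraction cobordism, as a bilinear
map; here `u = W(c)b`, `v = W(b)a`, and `w = W(c)a`. -/
noncomputable def contract {u v w : Perm O} (h : u * v = w) :
    Circ u →ₗ[MvPolynomial O ℤ] Circ v →ₗ[MvPolynomial O ℤ] Circ w :=
  Submodule.liftQ (circIdeal u) (LinearMap.toSpanSingleton _ _ (contractAux h)) (by
    intro f hf
    subst h
    rw [LinearMap.mem_ker, LinearMap.toSpanSingleton_apply]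
    apply LinearMap.ext
    intro y
    obtain ⟨g, rfl⟩ := Ideal.Quotient.mk_surjective y
    change Ideal.Quotient.mk (circIdeal (u * v)) (f * (contractionFactor u v * g)) = 0
    rw [Ideal.Quotient.eq_zero_iff_mem, ← mul_assoc]
    exact Ideal.mul_mem_right _ _ (mem_contraction_left u v hf))

theorem contract_mk {u v w : Perm O} (h : u * v = w) (f g : MvPolynomial O ℤ) :
    contract h (Ideal.Quotient.mk _ f) (Ideal.Quotient.mk _ g) =
      Ideal.Quotient.mk _ (f * g * contractionFactor u v) := by
  change Ideal.Quotient.mk (circIdeal w) (f * (contractionFactor u v * g)) = _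
  congr 1; ring

theorem contract_assoc {u v w uv vw t : Perm O} (h1 : u * v = uv) (h2 : uv * w = t)
    (h3 : v * w = vw) (h4 : u * vw = t) (x : Circ u) (y : Circ v) (z : Circ w) :
    contract h2 (contract h1 x y) z = contract h4 x (contract h3 y z) := by
  subst h1 h3 h2
  obtain ⟨f, rfl⟩ := Ideal.Quotient.mk_surjective x
  obtain ⟨g, rfl⟩ := Ideal.Quotient.mk_surjective y
  obtain ⟨k, rfl⟩ := Ideal.Quotient.mk_surjective z
  rw [contract_mk, contract_mk, contract_mk, contract_mk, Ideal.Quotient.eq]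
  convert Ideal.mul_mem_left _ (f * g * k) (contraction_assoc u v w) using 1
  ring

theorem contract_one_left {u v : Perm O} (hu : u = 1) (h : u * v = v) (y : Circ v) :
    contract h 1 y = y := by
  subst hu
  obtain ⟨g, rfl⟩ := Ideal.Quotient.mk_surjective y
  rw [← map_one (Ideal.Quotient.mk (circIdeal 1)), contract_mk, contractionFactor_one_left]
  simp

theorem contract_one_right {u v : Perm O} (hv : v = 1) (h : u * v = u) (x : Circ u) :
    contract h x 1 = x := by
  subst hv
  obtain ⟨g, rfl⟩ := Ideal.Quotient.mk_surjective x
  rw [← map_one (Ideal.Quotient.mk (circIdeal 1)), contract_mk, contractionFactor_one_right]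
  simp

/-- The isomorphism `F(W(b)a) ≅ F(W(a)b)` induced by the reflection, which takes each circle of the
first manifold to its mirror image and so reverses the orientation. -/
noncomputable def mirror {u v : Perm Ω} (h : v = u⁻¹) : Circ u →+* Circ v :=
  Ideal.Quotient.factor (by rw [h, circIdeal_inv])

theorem mirror_mk {u v : Perm Ω} (h : v = u⁻¹) (f : MvPolynomial Ω ℤ) :
    mirror h (Ideal.Quotient.mk _ f) = Ideal.Quotient.mk _ f := rfl

theorem mirror_contract {u v w u' v' w' : Perm O} (h : u * v = w) (h' : v' * u' = w')
    (hu : u' = u⁻¹) (hv : v' = v⁻¹) (hw : w' = w⁻¹) (x : Circ u) (y : Circ v) :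
    mirror hw (contract h x y) = contract h' (mirror hv y) (mirror hu x) := by
  subst h hu hv hw
  obtain ⟨f, rfl⟩ := Ideal.Quotient.mk_surjective x
  obtain ⟨g, rfl⟩ := Ideal.Quotient.mk_surjective y
  rw [contract_mk, mirror_mk, mirror_mk, mirror_mk, contract_mk, contractionFactor_inv,
    Ideal.Quotient.eq, circIdeal_inv]
  convert Ideal.mul_mem_left _ (f * g) (contraction_sub_mem u v) using 1
  ring

/-- The map that labels the circles that do not carry any of the old marks by `1`. The marks `e o`
lie on the old circles, in the old cyclic order. -/
noncomputable def addMarks {u' : Perm Ω'} {u : Perm Ω} (e : Ω' → Ω)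
    (h : ∀ o, u (e o) = e (u' o)) : Circ u' →+* Circ u :=
  Ideal.quotientMap (circIdeal u) (rename e : _ →ₐ[ℤ] _).toRingHom (by
    intro f hf
    refine rename_mem_circIdeal e ?_ hf
    intro z
    rw [← h]; exact sc_step _ _)

theorem addMarks_mk {u' : Perm Ω'} {u : Perm Ω} (e : Ω' → Ω)
    (h : ∀ o, u (e o) = e (u' o)) (f : MvPolynomial Ω' ℤ) :
    addMarks e h (Ideal.Quotient.mk _ f) = Ideal.Quotient.mk _ (rename e f) := rfl

theorem addMarks_contract {O' : Type} [LinearOrder O'] [Fintype O'] (e : O' ↪o O)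
    {u' v' w' : Perm O'} {u v w : Perm O} (h' : u' * v' = w') (h : u * v = w)
    (hu : ∀ o, u (e o) = e (u' o)) (hv : ∀ o, v (e o) = e (v' o))
    (hw : ∀ o, w (e o) = e (w' o)) (hv1 : ∀ o, (¬ ∃ o', e o' = o) → v o = o)
    (x : Circ u') (y : Circ v') :
    addMarks e hw (contract h' x y) = contract h (addMarks e hu x) (addMarks e hv y) := by
  obtain ⟨f, rfl⟩ := Ideal.Quotient.mk_surjective x
  obtain ⟨g, rfl⟩ := Ideal.Quotient.mk_surjective y
  rw [contract_mk, addMarks_mk, addMarks_mk, addMarks_mk, contract_mk,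
    contractionFactor_rename e hu hv hv1]
  simp

end Circles

end Saddles

section Matchings

open Equiv

/-- A crossingless matching of the points of a finite linearly ordered set `s`, given by the
fixed point free involution that exchanges the two endpoints of every arc: two arcs drawn in a
half-plane whose left endpoints are `x < y` must not satisfy `x < y < a x < a y`. -/
structure Matching (s : Type) [LinearOrder s] where
  perm : Perm s
  perm_perm : ∀ x, perm (perm x) = x
  perm_ne : ∀ x, perm x ≠ x
  perm_crossingless : ∀ x y, ¬ (x < y ∧ y < perm x ∧ perm x < perm y)

variable {s : Type} [LinearOrder s] [Fintype s]

namespace Matching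

instance : CoeFun (Matching s) (fun _ => s → s) := ⟨fun a => a.perm⟩

@[ext] theorem ext {a b : Matching s} (h : ∀ x, a x = b x) : a = b := by
  cases a; cases b
  congr 1
  exact Equiv.ext h

theorem invol (a : Matching s) (x : s) : a (a x) = x := a.perm_perm x

theorem ne (a : Matching s) (x : s) : a x ≠ x := a.perm_ne x

theorem crossingless (a : Matching s) {x y : s} (h1 : x < y) (h2 : y < a x) (h3 : a x < a y) :
    False := a.perm_crossingless x y ⟨h1, h2, h3⟩

end Matching

instance : Finite (Matching s) :=
  Finite.of_injective (fun a : Matching s => a.perm) fun _ _ h =>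
    Matching.ext fun x => congrArg (fun p : Perm s => p x) h

noncomputable instance : Fintype (Matching s) := Fintype.ofFinite _

noncomputable instance : DecidableEq (Matching s) := Classical.decEq _

/-- The point `x` has odd position, where the leftmost point has position `1`. The two endpoints of
an arc of a crossingless matching have positions of different parity. -/
def IsOdd (x : s) : Prop := Even (Finset.univ.filter fun y => y < x).card

theorem even_card_of_invol {α : Type} (S : Finset α) (g : α → α) (hg : ∀ x ∈ S, g x ∈ S)
    (hgg : ∀ x ∈ S, g (g x) = x) (hne : ∀ x ∈ S, g x ≠ x) : Even S.card := by
  have : (∑ _x ∈ S, (1 : ZMod 2)) = 0 :=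
    Finset.sum_involution (fun x _ => g x) (fun x _ => by decide) (fun x hx _ => hne x hx)
      hg hgg
  rw [Finset.sum_const, nsmul_one] at this
  exact (ZMod.natCast_eq_zero_iff_even).1 this

theorem isOdd_matching_aux (a : Matching s) {x : s} (h : x < a x) :
    IsOdd (a x) ↔ ¬ IsOdd x := by
  have e : (Finset.univ.filter fun y => y < a x) =
      insert x ((Finset.univ.filter fun y => y < x) ∪
        Finset.univ.filter fun y => x < y ∧ y < a x) := by
    ext y
    simp only [Finset.mem_filter, Finset.mem_univ, true_and, Finset.mem_insert, Finset.mem_union]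
    constructor
    · intro hy
      rcases lt_trichotomy y x with h1 | h1 | h1
      · exact Or.inr (Or.inl h1)
      · exact Or.inl h1
      · exact Or.inr (Or.inr ⟨h1, hy⟩)
    · rintro (h1 | h1 | h1)
      · rwa [h1]
      · exact h1.trans h
      · exact h1.2
  have hev : Even (Finset.univ.filter fun y => x < y ∧ y < a x).card := by
    apply even_card_of_invol _ a
    · intro y hy
      simp only [Finset.mem_filter, Finset.mem_univ, true_and] at hy ⊢
      obtain ⟨h1, h2⟩ := hy
      constructor
      · by_contra hc
        have hc' : a y < x := lt_of_le_of_ne (not_lt.1 hc) (by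
          intro hh
          rw [← hh, a.invol] at h2
          exact lt_irrefl _ h2)
        have := a.crossingless (x := a y) (y := x) hc' (by rwa [a.invol]) (by rwa [a.invol])
        exact this
      · by_contra hc
        have hc' : a x < a y := lt_of_le_of_ne (not_lt.1 hc) (by
          intro hh
          have := congrArg a hh
          rw [a.invol, a.invol] at this
          exact h1.ne this)
        exact a.crossingless h1 h2 hc'
    · intro y _; exact a.invol y
    · intro y _; exact a.ne y
  rw [IsOdd, IsOdd, e, Finset.card_insert_of_notMem (by simp), Finset.card_union_of_disjoint]
  · rw [Nat.even_add_one, Nat.even_add]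
    simp [hev]
  · rw [Finset.disjoint_left]
    intro y hy
    simp only [Finset.mem_filter, Finset.mem_univ, true_and] at hy ⊢
    exact fun hh => lt_asymm hy hh.1

theorem isOdd_matching (a : Matching s) (x : s) : IsOdd (a x) ↔ ¬ IsOdd x := by
  rcases lt_or_gt_of_ne (a.ne x) with h | h
  · have := isOdd_matching_aux a (x := a x) (by rwa [a.invol])
    rw [a.invol] at this
    tauto
  · exact isOdd_matching_aux a h

variable (s) in
/-- The points in odd position. Each arc of a crossingless matching has exactly one such endpoint. -/
abbrev OddPoint : Type := {x : s // IsOdd x}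

noncomputable instance : Fintype (OddPoint s) := Fintype.ofFinite _

/-- The closed one-manifold `W(b)a` obtained by gluing the reflection of `b` to `a`. It is oriented
such that the arcs of `a` lead from odd to even points; the marks are the odd points. -/
def loop (b a : Matching s) : Perm (OddPoint s) where
  toFun o := ⟨b (a o.1), by rw [isOdd_matching, isOdd_matching, not_not]; exact o.2⟩
  invFun o := ⟨a (b o.1), by rw [isOdd_matching, isOdd_matching, not_not]; exact o.2⟩
  left_inv o := Subtype.ext (by simp [Matching.invol])
  right_inv o := Subtype.ext (by simp [Matching.invol])

theorem loop_mul (c b a : Matching s) : loop c b * loop b a = loop c a := by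
  ext o
  simp [loop, Matching.invol]

theorem loop_self (a : Matching s) : loop a a = 1 := by
  ext o
  simp [loop, Matching.invol]

theorem loop_inv (b a : Matching s) : loop a b = (loop b a)⁻¹ := rfl

/-- A flat tangle without caps or circles, with bottom endpoints `s` and top endpoints `t`: the bottom
endpoint `x` is joined to the top endpoint `strand x`, in an order preserving way, and the other top
endpoints are joined in pairs of neighbours by cups. -/
structure CupDiagram (s t : Type) [LinearOrder s] [LinearOrder t] where
  strand : s ↪o t
  cup : t → t
  cup_notMem : ∀ p, p ∉ Set.range strand → cup p ∉ Set.range strand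
  cup_cup : ∀ p, p ∉ Set.range strand → cup (cup p) = p
  cup_ne : ∀ p, p ∉ Set.range strand → cup p ≠ p
  cup_adj : ∀ p, p ∉ Set.range strand → ∀ q, ¬ (p < q ∧ q < cup p)

namespace CupDiagram

variable {t : Type} [LinearOrder t] [Fintype t] (T : CupDiagram s t)

open Classical in
/-- The involution of the matching `T a`. -/
noncomputable def extFun (a : Matching s) (p : t) : t :=
  if h : ∃ x, T.strand x = p then T.strand (a h.choose) else T.cup p

theorem extFun_strand (a : Matching s) (x : s) : T.extFun a (T.strand x) = T.strand (a x) := by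
  have h : ∃ y, T.strand y = T.strand x := ⟨x, rfl⟩
  rw [extFun, dif_pos h]
  rw [T.strand.injective h.choose_spec]

theorem extFun_cup (a : Matching s) {p : t} (h : p ∉ Set.range T.strand) :
    T.extFun a p = T.cup p := dif_neg h

theorem extFun_invol (a : Matching s) (p : t) : T.extFun a (T.extFun a p) = p := by
  by_cases h : p ∈ Set.range T.strand
  · obtain ⟨x, rfl⟩ := h
    rw [extFun_strand, extFun_strand, a.invol]
  · rw [extFun_cup T a h, extFun_cup T a (T.cup_notMem p h), T.cup_cup p h]

/-- The crossingless matching `T a` obtained by gluing `T` to `a`. -/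
noncomputable def comp (a : Matching s) : Matching t :=
  ⟨⟨T.extFun a, T.extFun a, T.extFun_invol a, T.extFun_invol a⟩, T.extFun_invol a, by
    intro p
    change T.extFun a p ≠ p
    by_cases h : p ∈ Set.range T.strand
    · obtain ⟨x, rfl⟩ := h
      rw [extFun_strand]
      exact fun hh => a.ne x (T.strand.injective hh)
    · rw [extFun_cup T a h]
      exact T.cup_ne p h, by
    rintro p q ⟨h1, h2, h3⟩
    change q < T.extFun a p at h2
    change T.extFun a p < T.extFun a q at h3
    by_cases hp : p ∈ Set.range T.strand
    · by_cases hq : q ∈ Set.range T.strand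
      · obtain ⟨x, rfl⟩ := hp
        obtain ⟨y, rfl⟩ := hq
        rw [extFun_strand] at h2 h3
        rw [extFun_strand] at h3
        exact a.crossingless (T.strand.lt_iff_lt.1 h1) (T.strand.lt_iff_lt.1 h2)
          (T.strand.lt_iff_lt.1 h3)
      · rw [extFun_cup T a hq] at h3
        exact T.cup_adj q hq _ ⟨h2, h3⟩
    · rw [extFun_cup T a hp] at h2
      exact T.cup_adj p hp _ ⟨h1, h2⟩⟩

theorem comp_strand (a : Matching s) (x : s) : T.comp a (T.strand x) = T.strand (a x) :=
  T.extFun_strand a x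

theorem comp_cup (a : Matching s) {p : t} (h : p ∉ Set.range T.strand) :
    T.comp a p = T.cup p := T.extFun_cup a h

theorem isOdd_strand (x : s) : IsOdd (T.strand x) ↔ IsOdd x := by
  classical
  have e : (Finset.univ.filter fun q => q < T.strand x) =
      ((Finset.univ.filter fun y => y < x).map T.strand.toEmbedding) ∪
        Finset.univ.filter fun q => q < T.strand x ∧ q ∉ Set.range T.strand := by
    ext q
    simp only [Finset.mem_filter, Finset.mem_univ, true_and, Finset.mem_union, Finset.mem_map]
    constructor
    · intro h
      by_cases hq : q ∈ Set.range T.strand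
      · obtain ⟨y, rfl⟩ := hq
        exact Or.inl ⟨y, T.strand.lt_iff_lt.1 h, rfl⟩
      · exact Or.inr ⟨h, hq⟩
    · rintro (⟨y, h, rfl⟩ | h)
      · exact T.strand.lt_iff_lt.2 h
      · exact h.1
  have hev : Even (Finset.univ.filter fun q => q < T.strand x ∧ q ∉ Set.range T.strand).card := by
    apply even_card_of_invol _ T.cup
    · intro q hq
      simp only [Finset.mem_filter, Finset.mem_univ, true_and] at hq ⊢
      refine ⟨?_, T.cup_notMem q hq.2⟩
      by_contra hc
      refine T.cup_adj q hq.2 (T.strand x) ⟨hq.1, lt_of_le_of_ne (not_lt.1 hc) ?_⟩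
      intro hh
      exact T.cup_notMem q hq.2 ⟨x, hh⟩
    · intro q hq
      simp only [Finset.mem_filter, Finset.mem_univ, true_and] at hq
      exact T.cup_cup q hq.2
    · intro q hq
      simp only [Finset.mem_filter, Finset.mem_univ, true_and] at hq
      exact T.cup_ne q hq.2
  rw [IsOdd, IsOdd, e, Finset.card_union_of_disjoint, Finset.card_map, Nat.even_add]
  · simp only [hev, iff_true]
  · rw [Finset.disjoint_left]
    intro q hq hq'
    simp only [Finset.mem_filter, Finset.mem_univ, true_and, Finset.mem_map] at hq hq'
    obtain ⟨y, -, rfl⟩ := hq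
    exact hq'.2 ⟨y, rfl⟩

/-- The strands of `T` that start in odd points also end in odd points. -/
def oddStrand : OddPoint s ↪o OddPoint t where
  toFun o := ⟨T.strand o.1, (T.isOdd_strand o.1).2 o.2⟩
  inj' x y h := Subtype.ext (T.strand.injective (congrArg Subtype.val h))
  map_rel_iff' := by
    intro x y
    exact T.strand.le_iff_le

theorem loop_comp (b a : Matching s) (o : OddPoint s) :
    loop (T.comp b) (T.comp a) (T.oddStrand o) = T.oddStrand (loop b a o) := by
  apply Subtype.ext
  change T.comp b (T.comp a (T.strand o.1)) = T.strand (b (a o.1))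
  rw [comp_strand, comp_strand]

theorem loop_comp_fixed (b a : Matching s) (o : OddPoint t)
    (h : ¬ ∃ o', T.oddStrand o' = o) : loop (T.comp b) (T.comp a) o = o := by
  apply Subtype.ext
  change T.comp b (T.comp a o.1) = o.1
  have ho : o.1 ∉ Set.range T.strand := by
    rintro ⟨x, hx⟩
    exact h ⟨⟨x, (T.isOdd_strand x).1 (hx ▸ o.2)⟩, Subtype.ext hx⟩
  rw [comp_cup T a ho, comp_cup T b (T.cup_notMem _ ho), T.cup_cup _ ho]

end CupDiagram

end Matchings

section Gradings

variable {M N : Type} [AddCommGroup M] [AddCommGroup N]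

/-- `δ` sends an element to the family of its homogeneous components. -/
structure IsSplitting (g : ℤ → AddSubgroup M) (δ : M →+ (ℤ →₀ M)) : Prop where
  mem : ∀ m i, δ m i ∈ g i
  sum : ∀ m, (δ m).sum (fun _ x => x) = m
  single : ∀ i, ∀ m ∈ g i, δ m = Finsupp.single i m

theorem IsSplitting.isInternal {g : ℤ → AddSubgroup M} {δ : M →+ (ℤ →₀ M)}
    (h : IsSplitting g δ) : DirectSum.IsInternal g := by
  have key : ∀ x : DirectSum ℤ fun i => g i,
      ∀ i, δ (DirectSum.coeAddMonoidHom g x) i = (x i : M) := by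
    intro x i
    induction x using DirectSum.induction_on with
    | zero => simp
    | of j y =>
      rw [DirectSum.coeAddMonoidHom_of, h.single j y y.2]
      by_cases hij : j = i
      · subst hij; simp
      · rw [Finsupp.single_eq_of_ne (Ne.symm hij), DirectSum.of_eq_of_ne _ _ _ (Ne.symm hij)]; simp
    | add x y hx hy => simp [hx, hy]
  constructor
  · rw [injective_iff_map_eq_zero]
    intro x hx
    ext i
    rw [← key x i, hx]; simp
  · intro m
    refine ⟨∑ i ∈ (δ m).support, DirectSum.of (fun i => g i) i ⟨δ m i, h.mem m i⟩, ?_⟩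
    rw [map_sum]
    simp only [DirectSum.coeAddMonoidHom_of]
    exact h.sum m

theorem exists_splitting {g : ℤ → AddSubgroup M} (h : DirectSum.IsInternal g) :
    ∃ δ, IsSplitting g δ := by
  let e := AddEquiv.ofBijective (DirectSum.coeAddMonoidHom g) h
  have he : ∀ x, e x = DirectSum.coeAddMonoidHom g x := fun _ => rfl
  let ψ : (DirectSum ℤ fun i => g i) →+ (ℤ →₀ M) :=
    DirectSum.toAddMonoid fun i => (Finsupp.singleAddHom i).comp (g i).subtype
  have hψ : ∀ x i, ψ x i = (x i : M) := by
    intro x i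
    induction x using DirectSum.induction_on with
    | zero => simp
    | of j y =>
      simp only [ψ, DirectSum.toAddMonoid_of]
      by_cases hij : j = i
      · subst hij; simp
      · rw [DirectSum.of_eq_of_ne _ _ _ (Ne.symm hij)]
        simp [Finsupp.single_eq_of_ne (Ne.symm hij)]
    | add x y hx hy => simp [hx, hy]
  have hψs : ∀ x, (ψ x).sum (fun _ y => y) = e x := by
    intro x
    induction x using DirectSum.induction_on with
    | zero => simp
    | of j y =>
      simp only [ψ, DirectSum.toAddMonoid_of]
      rw [he]; simp
    | add x y hx hy =>
      rw [map_add, map_add, Finsupp.sum_add_index' (by simp) (by simp), hx, hy]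
  refine ⟨ψ.comp e.symm.toAddMonoidHom, ?_, ?_, ?_⟩
  · intro m i
    change ψ (e.symm m) i ∈ g i
    rw [hψ]; exact Subtype.property _
  · intro m
    change (ψ (e.symm m)).sum _ = m
    rw [hψs]; simp
  · intro i m hm
    change ψ (e.symm m) = _
    have : e.symm m = DirectSum.of (fun i => g i) i ⟨m, hm⟩ := by
      rw [AddEquiv.symm_apply_eq, he]
      simp
    rw [this]
    simp [ψ]

/-- The grading of `M{k}`, which is the grading of `M` shifted up by `k`. -/
def shiftGr (g : ℤ → AddSubgroup M) (k : ℤ) : ℤ → AddSubgroup M := fun d => g (d - k)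

theorem isInternal_shift {g : ℤ → AddSubgroup M} (h : DirectSum.IsInternal g) (k : ℤ) :
    DirectSum.IsInternal (shiftGr g k) := by
  obtain ⟨δ, hδ⟩ := exists_splitting h
  have hinj : Function.Injective fun d : ℤ => d + k := add_left_injective k
  refine IsSplitting.isInternal (δ := (Finsupp.mapDomain.addMonoidHom fun d => d + k).comp δ)
    ⟨?_, ?_, ?_⟩
  · intro m i
    have : i = (i - k) + k := by ring
    change Finsupp.mapDomain (fun d => d + k) (δ m) i ∈ g (i - k)
    rw [this, Finsupp.mapDomain_apply hinj]
    simpa using hδ.mem m (i - k)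
  · intro m
    change (Finsupp.mapDomain (fun d => d + k) (δ m)).sum _ = m
    rw [Finsupp.sum_mapDomain_index (by simp) (by simp)]
    exact hδ.sum m
  · intro i m hm
    change Finsupp.mapDomain (fun d => d + k) (δ m) = _
    rw [hδ.single _ m hm, Finsupp.mapDomain_single]
    simp

/-- Gradings descend to quotients by subgroups that contain the components of their elements. -/
theorem isInternal_quotient {g : ℤ → AddSubgroup M} {δ : M →+ (ℤ →₀ M)} (hδ : IsSplitting g δ)
    {q : M →+ N} (hq : Function.Surjective q) (hk : ∀ m, q m = 0 → ∀ i, q (δ m i) = 0) :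
    DirectSum.IsInternal fun d => (g d).map q := by
  let φ : M →+ (ℤ →₀ N) := (Finsupp.mapRange.addMonoidHom q).comp δ
  have hφ : ∀ m m', q m = q m' → φ m = φ m' := by
    intro m m' hm
    ext i
    have := hk (m - m') (by simp [hm]) i
    rw [map_sub, Finsupp.sub_apply, map_sub, sub_eq_zero] at this
    simpa [φ] using this
  let s : N → M := Function.surjInv hq
  have hs : ∀ n, q (s n) = n := Function.surjInv_eq hq
  let δ' : N →+ (ℤ →₀ N) := AddMonoidHom.mk' (fun n => φ (s n)) (by
    intro a b
    rw [← map_add]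
    exact hφ _ _ (by simp [hs]))
  have hδ' : ∀ m, δ' (q m) = φ m := fun m => hφ _ _ (hs _)
  refine IsSplitting.isInternal (δ := δ') ⟨?_, ?_, ?_⟩
  · intro n i
    exact ⟨δ (s n) i, hδ.mem _ _, rfl⟩
  · intro n
    obtain ⟨m, rfl⟩ := hq n
    rw [hδ']
    change (Finsupp.mapRange q (map_zero q) (δ m)).sum _ = _
    rw [Finsupp.sum_mapRange_index (by simp)]
    conv_rhs => rw [← hδ.sum m]
    rw [Finsupp.sum, Finsupp.sum, map_sum]
  · rintro i _ ⟨m, hm, rfl⟩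
    rw [hδ']
    simp [φ, hδ.single i m hm]

theorem isInternal_pi {ι : Type} [Finite ι] {P : ι → Type} [∀ i, AddCommGroup (P i)]
    {g : ∀ i, ℤ → AddSubgroup (P i)} (h : ∀ i, DirectSum.IsInternal (g i)) :
    DirectSum.IsInternal fun d => AddSubgroup.pi Set.univ fun i => g i d := by
  classical
  have := Fintype.ofFinite ι
  choose δ hδ using fun i => exists_splitting (h i)
  let δ' : (∀ i, P i) →+ (ℤ →₀ ∀ i, P i) :=
    ∑ i, (Finsupp.mapRange.addMonoidHom (AddMonoidHom.single P i)).comp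
      ((δ i).comp (Pi.evalAddMonoidHom P i))
  have hδ' : ∀ x d i, δ' x d i = δ i (x i) d := by
    intro x d i
    simp only [δ', AddMonoidHom.finsetSum_apply, Finsupp.finsetSum_apply, Finset.sum_apply]
    rw [Finset.sum_eq_single i]
    · simp
    · intro j _ hj
      simp [Pi.single_eq_of_ne (Ne.symm hj)]
    · simp
  refine IsSplitting.isInternal (δ := δ') ⟨?_, ?_, ?_⟩
  · intro x d i _
    rw [hδ']
    exact (hδ i).mem _ _
  · intro x
    ext i
    have h1 := (hδ i).sum (x i)
    conv_rhs => rw [← h1]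
    rw [Finsupp.sum, Finset.sum_apply]
    symm
    rw [Finsupp.sum]
    apply Finset.sum_subset_zero_on_sdiff
    · intro d hd
      rw [Finsupp.mem_support_iff] at hd ⊢
      intro hc
      apply hd
      rw [← hδ', hc]; rfl
    · intro d hd
      rw [Finset.mem_sdiff] at hd
      rw [hδ']
      simpa using hd.2
    · intro d _
      rw [hδ']
  · intro d x hx
    ext d' i
    rw [hδ', (hδ i).single d (x i) (hx i trivial)]
    by_cases hd : d = d'
    · subst hd; simp
    · simp [Finsupp.single_eq_of_ne (Ne.symm hd)]

end Gradings

section CircGrading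

open MvPolynomial Equiv

variable {Ω Ω' : Type} [Finite Ω] [Finite Ω']

theorem isInternal_poly : DirectSum.IsInternal fun d : ℤ =>
    (weightedHomogeneousSubmodule ℤ (fun _ : Ω => (2 : ℤ)) d).toAddSubgroup := by
  have := weightedDecomposition ℤ (fun _ : Ω => (2 : ℤ))
  exact DirectSum.Decomposition.isInternal (weightedHomogeneousSubmodule ℤ (fun _ : Ω => (2 : ℤ)))

theorem IsSplitting.eq_of_sum {M : Type} [AddCommGroup M] {g : ℤ → AddSubgroup M}
    {δ : M →+ (ℤ →₀ M)} (h : IsSplitting g δ) {m : M} (S : Finset ℤ) (c : ℤ → M)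
    (hc : ∀ i, c i ∈ g i) (h0 : ∀ i ∉ S, c i = 0) (hm : ∑ i ∈ S, c i = m) (i : ℤ) :
    δ m i = c i := by
  rw [← hm, map_sum, Finsupp.finsetSum_apply]
  by_cases hi : i ∈ S
  · rw [Finset.sum_eq_single_of_mem i hi]
    · rw [h.single i _ (hc i)]; simp
    · intro j _ hj
      rw [h.single j _ (hc j), Finsupp.single_eq_of_ne hj.symm]
  · rw [h0 i hi]
    apply Finset.sum_eq_zero
    intro j hj
    have : i ≠ j := fun hh => hi (hh ▸ hj)
    rw [h.single j _ (hc j), Finsupp.single_eq_of_ne this]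

theorem circIdeal_components (π : Perm Ω) {δ : MvPolynomial Ω ℤ →+ (ℤ →₀ MvPolynomial Ω ℤ)}
    (hδ : IsSplitting (fun d : ℤ =>
      (weightedHomogeneousSubmodule ℤ (fun _ : Ω => (2 : ℤ)) d).toAddSubgroup) δ)
    {f : MvPolynomial Ω ℤ} (hf : f ∈ circIdeal π) (i : ℤ) : δ f i ∈ circIdeal π := by
  classical
  have hG := weightedGradedAlgebra ℤ (fun _ : Ω => (2 : ℤ))
  have hI : (circIdeal π).IsHomogeneous
      (weightedHomogeneousSubmodule ℤ (fun _ : Ω => (2 : ℤ))) := by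
    apply Ideal.homogeneous_span
    rintro _ (⟨x, rfl⟩ | ⟨x, rfl⟩)
    · exact ⟨2 • 2, (isWeightedHomogeneous_X ℤ (fun _ : Ω => (2 : ℤ)) x).pow 2⟩
    · exact ⟨2, Submodule.sub_mem _ (isWeightedHomogeneous_X ℤ (fun _ : Ω => (2 : ℤ)) x)
        (isWeightedHomogeneous_X ℤ (fun _ : Ω => (2 : ℤ)) (π x))⟩
  have := hδ.eq_of_sum (m := f) (DirectSum.decompose
    (weightedHomogeneousSubmodule ℤ (fun _ : Ω => (2 : ℤ))) f).support
    (fun i => DirectSum.decompose (weightedHomogeneousSubmodule ℤ (fun _ : Ω => (2 : ℤ))) f i)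
    (fun i => Subtype.property _) (fun i hi => by
      simpa using hi) (DirectSum.sum_support_decompose _ f) i
  rw [this]
  exact hI i hf

/-- The grading on `F(W(b)a)`, in which each tensor factor `A` has `1` in degree `-1` and `X` in
degree `1`. -/
noncomputable def circGr (π : Perm Ω) (d : ℤ) : AddSubgroup (Circ π) :=
  (weightedHomogeneousSubmodule ℤ (fun _ : Ω => (2 : ℤ)) (d + numCircles π)).toAddSubgroup.map
    (Ideal.Quotient.mk (circIdeal π)).toAddMonoidHom

theorem isInternal_circGr (π : Perm Ω) : DirectSum.IsInternal (circGr π) := by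
  obtain ⟨δ, hδ⟩ := exists_splitting (isInternal_poly (Ω := Ω))
  have h1 := isInternal_quotient hδ (q := (Ideal.Quotient.mk (circIdeal π)).toAddMonoidHom)
    Ideal.Quotient.mk_surjective (by
      intro f hf i
      have hf' := Ideal.Quotient.eq_zero_iff_mem.1 hf
      exact Ideal.Quotient.eq_zero_iff_mem.2 (circIdeal_components π hδ hf' i))
  have h2 := isInternal_shift h1 (-(numCircles π : ℤ))
  have e : circGr π = shiftGr (fun d : ℤ => AddSubgroup.map
      (Ideal.Quotient.mk (circIdeal π)).toAddMonoidHom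
        (weightedHomogeneousSubmodule ℤ (fun _ : Ω => (2 : ℤ)) d).toAddSubgroup)
      (-(numCircles π : ℤ)) := by
    funext d
    simp only [circGr, shiftGr, sub_neg_eq_add]
  rw [e]
  exact h2

theorem mem_circGr {π : Perm Ω} {d : ℤ} {x : Circ π} : x ∈ circGr π d ↔
    ∃ f, IsWeightedHomogeneous (fun _ : Ω => (2 : ℤ)) f (d + numCircles π) ∧
      Ideal.Quotient.mk _ f = x := Iff.rfl

theorem one_mem_circGr {π : Perm Ω} (h : π = 1) :
    (1 : Circ π) ∈ circGr π (-(Nat.card Ω : ℤ)) := by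
  subst h
  rw [mem_circGr]
  refine ⟨1, ?_, map_one _⟩
  rw [numCircles_one]
  simpa using isWeightedHomogeneous_one ℤ (fun _ : Ω => (2 : ℤ))

theorem mirror_mem {u v : Perm Ω} (h : v = u⁻¹) {d : ℤ} {x : Circ u} (hx : x ∈ circGr u d) :
    mirror h x ∈ circGr v d := by
  obtain ⟨f, hf, rfl⟩ := mem_circGr.1 hx
  rw [mem_circGr]
  refine ⟨f, ?_, rfl⟩
  rwa [h, numCircles_inv]

variable {O : Type} [LinearOrder O] [Fintype O]

theorem contract_mem {u v w : Perm O} (h : u * v = w) {d d' : ℤ} {x : Circ u} {y : Circ v}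
    (hx : x ∈ circGr u d) (hy : y ∈ circGr v d') :
    contract h x y ∈ circGr w (d + d' + Fintype.card O) := by
  obtain ⟨f, hf, rfl⟩ := mem_circGr.1 hx
  obtain ⟨g, hg, rfl⟩ := mem_circGr.1 hy
  rw [contract_mk, mem_circGr]
  refine ⟨_, ?_, rfl⟩
  have := (hf.mul hg).mul (contractionFactor_homogeneous u v)
  rw [h] at this
  convert this using 1
  ring

theorem addMarks_mem {O' : Type} [LinearOrder O'] [Fintype O'] (e : O' ↪o O)
    {u' : Perm O'} {u : Perm O} (hu : ∀ o, u (e o) = e (u' o))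
    (hu1 : ∀ o, (¬ ∃ o', e o' = o) → u o = o) {d : ℤ} {x : Circ u'} (hx : x ∈ circGr u' d) :
    addMarks e hu x ∈ circGr u (d - (Fintype.card O - Fintype.card O')) := by
  obtain ⟨f, hf, rfl⟩ := mem_circGr.1 hx
  rw [addMarks_mk, mem_circGr]
  refine ⟨_, ?_, rfl⟩
  have := IsWeightedHomogeneous_rename (f := e) hf
  rw [numCircles_rename e hu hu1]
  convert this using 1
  ring

theorem finite_circ (π : Perm Ω) : Module.Finite ℤ (Circ π) := by
  have h1 : Algebra.FiniteType ℤ (Circ π) := inferInstance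
  have h2 : Algebra.IsIntegral ℤ (Circ π) := by
    have hX : ∀ x : Ω, IsIntegral ℤ (Ideal.Quotient.mk (circIdeal π) (X x)) := by
      intro x
      apply IsIntegral.of_pow (n := 2) (by norm_num)
      rw [← map_pow, Ideal.Quotient.eq_zero_iff_mem.2 (sq_mem_circIdeal π x)]
      exact isIntegral_zero
    constructor
    intro y
    obtain ⟨f, rfl⟩ := Ideal.Quotient.mk_surjective y
    induction f using MvPolynomial.induction_on with
    | C a =>
      have : Ideal.Quotient.mk (circIdeal π) (C a) = algebraMap ℤ (Circ π) a := rfl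
      rw [this]; exact isIntegral_algebraMap
    | add p q hp hq => rw [map_add]; exact hp.add hq
    | mul_X p x hp => rw [map_mul]; exact hp.mul (hX x)
  exact Algebra.finite_iff_isIntegral_and_finiteType.2 ⟨h2, h1⟩

end CircGrading

section ArcRings

variable {s t : Type} [LinearOrder s] [Fintype s] [LinearOrder t] [Fintype t]
variable {I J K L : Type}

/-- The direct sum of the groups `F(W(f i) (g j))` over all `i` and `j`, written as matrices. -/
def ArcMat (f : I → Matching s) (g : J → Matching s) : Type := ∀ i j, Circ (loop (f i) (g j))

noncomputable instance (f : I → Matching s) (g : J → Matching s) : AddCommGroup (ArcMat f g) :=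
  inferInstanceAs (AddCommGroup (∀ i j, Circ (loop (f i) (g j))))

namespace ArcMat

variable {f : I → Matching s} {g : J → Matching s} {h : K → Matching s} {k : L → Matching s}

@[ext] theorem ext {x y : ArcMat f g} (H : ∀ i j, x i j = y i j) : x = y :=
  funext fun i => funext fun j => H i j

theorem add_apply (x y : ArcMat f g) (i : I) (j : J) : (x + y) i j = x i j + y i j := rfl

theorem zero_apply (i : I) (j : J) : (0 : ArcMat f g) i j = 0 := rfl

/-- The product of matrices given by the contraction maps
`F(W(f i) (g j)) ⊗ F(W(g j) (h l)) → F(W(f i) (h l))`. -/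
noncomputable def mul [Fintype J] (x : ArcMat f g) (y : ArcMat g h) : ArcMat f h :=
  fun i l => ∑ j, contract (loop_mul (f i) (g j) (h l)) (x i j) (y j l)

theorem mul_assoc [Fintype J] [Fintype K] (x : ArcMat f g) (y : ArcMat g h) (z : ArcMat h k) :
    (x.mul y).mul z = x.mul (y.mul z) := by
  ext i l
  simp only [mul, map_sum, LinearMap.sum_apply]
  rw [Finset.sum_comm]
  refine Finset.sum_congr rfl fun j _ => Finset.sum_congr rfl fun c _ => ?_
  exact contract_assoc _ _ _ _ _ _ _

theorem add_mul [Fintype J] (x x' : ArcMat f g) (y : ArcMat g h) :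
    (x + x').mul y = x.mul y + x'.mul y := by
  ext i l
  simp [mul, add_apply, Finset.sum_add_distrib]

theorem mul_add [Fintype J] (x : ArcMat f g) (y y' : ArcMat g h) :
    x.mul (y + y') = x.mul y + x.mul y' := by
  ext i l
  simp [mul, add_apply, Finset.sum_add_distrib]

theorem zero_mul [Fintype J] (y : ArcMat g h) : (0 : ArcMat f g).mul y = 0 := by
  ext i l
  simp [mul, zero_apply]

theorem mul_zero [Fintype J] (x : ArcMat f g) : x.mul (0 : ArcMat g h) = 0 := by
  ext i l
  simp [mul, zero_apply]

/-- The matrix with entry `1 ⊗ ⋯ ⊗ 1` in each diagonal place and zeros elsewhere. -/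
noncomputable def one [DecidableEq I] (f : I → Matching s) : ArcMat f f :=
  fun i j => if i = j then 1 else 0

theorem one_mul [Fintype I] [DecidableEq I] (x : ArcMat f g) : (one f).mul x = x := by
  ext i l
  simp only [mul, one]
  rw [Finset.sum_eq_single i]
  · rw [if_pos rfl]
    exact contract_one_left (loop_self _) _ _
  · intro j _ hj
    rw [if_neg hj.symm]; simp
  · simp

theorem mul_one [Fintype J] [DecidableEq J] (x : ArcMat f g) : x.mul (one g) = x := by
  ext i l
  simp only [mul, one]
  rw [Finset.sum_eq_single l]
  · rw [if_pos rfl]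
    exact contract_one_right (loop_self _) _ _
  · intro j _ hj
    rw [if_neg hj]; simp
  · simp

/-- The map induced by the reflections `F(W(f i) (g j)) ≅ F(W(g j) (f i))`. -/
noncomputable def flip (x : ArcMat f g) : ArcMat g f :=
  fun j i => mirror (loop_inv (f i) (g j)) (x i j)

theorem flip_mul [Fintype J] (x : ArcMat f g) (y : ArcMat g h) :
    (x.mul y).flip = y.flip.mul x.flip := by
  ext l i
  simp only [flip, mul, map_sum]
  exact Finset.sum_congr rfl fun j _ => mirror_contract _ _ _ _ _ _ _

theorem flip_add (x y : ArcMat f g) : (x + y).flip = x.flip + y.flip := by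
  ext j i
  simp [flip, add_apply]

theorem flip_flip (x : ArcMat f g) : x.flip.flip = x := by
  ext i j
  obtain ⟨p, hp⟩ := Ideal.Quotient.mk_surjective (x i j)
  simp only [flip, ← hp]
  rfl

/-- The maps `F(W(f i) (g j)) → F(W(T (f i)) T (g j))`. The manifold `W(b) W(T) T a` consists of the
circles of `W(b) a` and of one more circle for each cup of `T`; the latter are labelled by `1`. -/
noncomputable def addCups (T : CupDiagram s t) (x : ArcMat f g) :
    ArcMat (fun i => T.comp (f i)) (fun j => T.comp (g j)) :=
  fun i j => addMarks T.oddStrand (T.loop_comp (f i) (g j)) (x i j)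

theorem addCups_mul (T : CupDiagram s t) [Fintype J] (x : ArcMat f g) (y : ArcMat g h) :
    (x.mul y).addCups T = (x.addCups T).mul (y.addCups T) := by
  ext i l
  simp only [addCups, mul, map_sum]
  exact Finset.sum_congr rfl fun j _ => addMarks_contract T.oddStrand _ _ _ _ _
    (T.loop_comp_fixed _ _) _ _

theorem addCups_add (T : CupDiagram s t) (x y : ArcMat f g) :
    (x + y).addCups T = x.addCups T + y.addCups T := by
  ext i j
  simp [addCups, add_apply]

theorem addCups_zero (T : CupDiagram s t) : (0 : ArcMat f g).addCups T = 0 := by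
  ext i j
  simp [addCups, zero_apply]

theorem addCups_one (T : CupDiagram s t) [DecidableEq I] :
    (one f).addCups T = one (fun i => T.comp (f i)) := by
  ext i j
  simp only [addCups, one]
  split_ifs <;> simp

/-- The grading on matrices, before any shift. -/
noncomputable def gr (f : I → Matching s) (g : J → Matching s) (d : ℤ) :
    AddSubgroup (ArcMat f g) where
  carrier := {x | ∀ i j, x i j ∈ circGr (loop (f i) (g j)) d}
  add_mem' hx hy i j := AddSubgroup.add_mem _ (hx i j) (hy i j)
  zero_mem' _ _ := AddSubgroup.zero_mem _
  neg_mem' hx i j := AddSubgroup.neg_mem _ (hx i j)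

theorem mem_gr {d : ℤ} {x : ArcMat f g} : x ∈ gr f g d ↔ ∀ i j, x i j ∈ circGr _ d :=
  Iff.rfl

theorem isInternal_gr [Finite I] [Finite J] : DirectSum.IsInternal (gr f g) := by
  have h := isInternal_pi (g := fun i d => AddSubgroup.pi Set.univ
    fun j => circGr (loop (f i) (g j)) d) fun i => isInternal_pi fun j => isInternal_circGr _
  have e : gr f g = fun d => AddSubgroup.pi Set.univ fun i => AddSubgroup.pi Set.univ
      fun j => circGr (loop (f i) (g j)) d := by
    funext d
    apply SetLike.coe_injective
    ext x
    exact ⟨fun H i _ j _ => H i j, fun H i j => H i trivial j trivial⟩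
  rw [e]
  exact h

theorem mul_mem [Fintype J] {d d' : ℤ} {x : ArcMat f g} {y : ArcMat g h} (hx : x ∈ gr f g d)
    (hy : y ∈ gr g h d') : x.mul y ∈ gr f h (d + d' + Fintype.card (OddPoint s)) := by
  rw [mem_gr] at *
  intro i l
  exact AddSubgroup.sum_mem _ fun j _ => contract_mem _ (hx i j) (hy j l)

theorem one_mem [DecidableEq I] : one f ∈ gr f f (-(Fintype.card (OddPoint s) : ℤ)) := by
  rw [mem_gr]
  intro i j
  simp only [one]
  split_ifs with h
  · subst h
    rw [← Nat.card_eq_fintype_card]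
    exact one_mem_circGr (loop_self _)
  · exact AddSubgroup.zero_mem _

theorem flip_mem {d : ℤ} {x : ArcMat f g} (hx : x ∈ gr f g d) : x.flip ∈ gr g f d := by
  rw [mem_gr] at *
  intro j i
  exact mirror_mem _ (hx i j)

theorem addCups_mem (T : CupDiagram s t) {d : ℤ} {x : ArcMat f g} (hx : x ∈ gr f g d) :
    x.addCups T ∈ gr _ _ (d - (Fintype.card (OddPoint t) - Fintype.card (OddPoint s))) := by
  rw [mem_gr] at *
  intro i j
  exact addMarks_mem _ _ (T.loop_comp_fixed _ _) (hx i j)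

theorem finite [Finite I] [Finite J] : Module.Finite ℤ (ArcMat f g) := by
  have := fun i j => finite_circ (loop (f i) (g j))
  have h : Module.Finite ℤ (∀ i j, Circ (loop (f i) (g j))) := inferInstance
  exact h

end ArcMat

variable (s) in
/-- The arc ring `H(s)`, the direct sum of the groups `F(W(b)a){m}` over all crossingless matchings
`a` and `b` of the points `s`, where `m` is the number of arcs. -/
def ArcRing : Type := ArcMat (fun b : Matching s => b) (fun a : Matching s => a)

namespace ArcRing

noncomputable instance : AddCommGroup (ArcRing s) :=
  inferInstanceAs (AddCommGroup (ArcMat (fun b : Matching s => b) (fun a : Matching s => a)))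

noncomputable instance : Ring (ArcRing s) :=
  { (inferInstance : AddCommGroup (ArcRing s)) with
    mul := ArcMat.mul
    one := ArcMat.one _
    mul_assoc := ArcMat.mul_assoc
    one_mul := ArcMat.one_mul
    mul_one := ArcMat.mul_one
    zero_mul := ArcMat.zero_mul
    mul_zero := ArcMat.mul_zero
    left_distrib := ArcMat.mul_add
    right_distrib := ArcMat.add_mul }

variable (s) in
/-- The grading of `H(s)`. The shift `m` is the number of arcs of a matching, which is the number of
points in odd position. -/
noncomputable def gr : ℤ → AddSubgroup (ArcRing s) :=
  shiftGr (M := ArcMat (fun b : Matching s => b) (fun a : Matching s => a)) (ArcMat.gr _ _)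
    (Fintype.card (OddPoint s))

theorem isInternal_gr : DirectSum.IsInternal (gr s) :=
  isInternal_shift ArcMat.isInternal_gr _

noncomputable instance : GradedRing (gr s) :=
  { isInternal_gr.chooseDecomposition with
    one_mem := by
      change ArcMat.one _ ∈ ArcMat.gr _ _ (0 - _)
      rw [zero_sub]; exact ArcMat.one_mem
    mul_mem := by
      intro i j x y hx hy
      change ArcMat.mul x y ∈ ArcMat.gr _ _ (i + j - _)
      have := ArcMat.mul_mem hx hy
      convert this using 1
      ring_nf }

/-- The anti-involution of `H(s)` induced by the reflections `F(W(b)a) ≅ F(W(a)b)`. -/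
noncomputable def chi : ArcRing s ≃+* (ArcRing s)ᵐᵒᵖ where
  toFun x := MulOpposite.op (ArcMat.flip x)
  invFun x := ArcMat.flip x.unop
  left_inv x := ArcMat.flip_flip x
  right_inv x := MulOpposite.unop_injective (ArcMat.flip_flip x.unop)
  map_mul' x y := MulOpposite.unop_injective (ArcMat.flip_mul x y)
  map_add' x y := MulOpposite.unop_injective (ArcMat.flip_add x y)

end ArcRing

end ArcRings

section BalancedTensor



variable (R S X M : Type) [Ring R] [Ring S] [AddCommGroup X] [AddCommGroup M]
  [Module R X] [Module Sᵐᵒᵖ X] [SMulCommClass R Sᵐᵒᵖ X] [Module S M]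

/-- The relations `x s ⊗ m = x ⊗ s m`. -/
def balancedRelations : Submodule R (X ⊗[ℤ] M) :=
  Submodule.span R
    {t | ∃ (x : X) (s : S) (m : M), t = (MulOpposite.op s • x) ⊗ₜ[ℤ] m - x ⊗ₜ[ℤ] (s • m)}

/-- The tensor product `X ⊗ M` over `S` of an `(R, S)`-bimodule and a left `S`-module. -/
abbrev BalancedTensor : Type := (X ⊗[ℤ] M) ⧸ balancedRelations R S X M

namespace BalancedTensor

variable {R S X M}

variable (R S) in
/-- The element `x ⊗ m`. -/
def tmul (x : X) (m : M) : BalancedTensor R S X M :=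
  (balancedRelations R S X M).mkQ (x ⊗ₜ[ℤ] m)

theorem smul_tmul' (r : R) (x : X) (m : M) :
    r • tmul R S x m = tmul R S (r • x) m := rfl

theorem op_smul_tmul (x : X) (s : S) (m : M) :
    tmul R S (MulOpposite.op s • x) m = tmul R S x (s • m) := by
  rw [tmul, tmul, Submodule.mkQ_apply, Submodule.mkQ_apply, Submodule.Quotient.eq]
  exact Submodule.subset_span ⟨x, s, m, rfl⟩

theorem add_tmul (x x' : X) (m : M) :
    tmul R S (x + x') m = tmul R S x m + tmul R S x' m := by
  simp only [tmul, TensorProduct.add_tmul, map_add]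

theorem tmul_add (x : X) (m m' : M) :
    tmul R S x (m + m') = tmul R S x m + tmul R S x m' := by
  simp only [tmul, TensorProduct.tmul_add, map_add]

theorem zero_tmul (m : M) : tmul R S (0 : X) m = 0 := by
  simp [tmul]

theorem tmul_zero (x : X) : tmul R S x (0 : M) = 0 := by
  simp [tmul]

theorem induction_on {p : BalancedTensor R S X M → Prop} (z : BalancedTensor R S X M)
    (h0 : p 0) (h1 : ∀ x m, p (tmul R S x m)) (h2 : ∀ a b, p a → p b → p (a + b)) : p z := by
  obtain ⟨t, rfl⟩ := Submodule.mkQ_surjective _ z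
  induction t using TensorProduct.induction_on with
  | zero => simpa using h0
  | tmul x m => exact h1 x m
  | add a b ha hb => rw [map_add]; exact h2 _ _ ha hb

theorem finite [Module.Finite R X] [Module.Finite S M] :
    Module.Finite R (BalancedTensor R S X M) := by
  classical
  obtain ⟨GX, hX⟩ := (‹Module.Finite R X›).fg_top
  obtain ⟨GM, hM⟩ := (‹Module.Finite S M›).fg_top
  refine ⟨⟨(GX ×ˢ GM).image fun p => tmul R S p.1 p.2, ?_⟩⟩
  rw [eq_top_iff]
  rintro z -
  set N := Submodule.span R (((GX ×ˢ GM).image fun p => tmul R S p.1 p.2 : Finset _) :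
    Set (BalancedTensor R S X M)) with hN
  have key : ∀ m : M, ∀ x : X, tmul R S x m ∈ N := by
    intro m
    have hm : m ∈ Submodule.span S (GM : Set M) := hM ▸ Submodule.mem_top
    refine Submodule.span_induction (p := fun m _ => ∀ x : X, tmul R S x m ∈ N) ?_ ?_ ?_ ?_ hm
    · intro m hm x
      have hx : x ∈ Submodule.span R (GX : Set X) := hX ▸ Submodule.mem_top
      refine Submodule.span_induction (p := fun x _ => tmul R S x m ∈ N) ?_ ?_ ?_ ?_ hx
      · intro x hx
        refine Submodule.subset_span ?_
        rw [Finset.mem_coe, Finset.mem_image]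
        exact ⟨(x, m), Finset.mem_product.2 ⟨hx, hm⟩, rfl⟩
      · rw [zero_tmul]; exact N.zero_mem
      · intro a b _ _ ha hb
        rw [add_tmul]; exact N.add_mem ha hb
      · intro r a _ ha
        rw [← smul_tmul']; exact N.smul_mem r ha
    · intro x; rw [tmul_zero]; exact N.zero_mem
    · intro a b _ _ ha hb x
      rw [tmul_add]; exact N.add_mem (ha x) (hb x)
    · intro s a _ ha x
      rw [← op_smul_tmul]; exact ha _
  exact induction_on z N.zero_mem (fun x m => key m x) (fun a b ha hb => N.add_mem ha hb)

/-- The homomorphism `f ⊗ g`. -/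
noncomputable def map {X' M' : Type} [AddCommGroup X'] [AddCommGroup M'] [Module R X']
    [Module Sᵐᵒᵖ X'] [SMulCommClass R Sᵐᵒᵖ X'] [Module S M'] (f : X →ₗ[R] X')
    (hf : ∀ (s : S) (x : X), f (MulOpposite.op s • x) = MulOpposite.op s • f x) (g : M →ₗ[S] M') :
    BalancedTensor R S X M →ₗ[R] BalancedTensor R S X' M' :=
  Submodule.mapQ _ _
    (TensorProduct.AlgebraTensorModule.map f g.toAddMonoidHom.toIntLinearMap) (by
      refine Submodule.span_le.2 ?_
      rintro _ ⟨x, s, m, rfl⟩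
      refine Submodule.subset_span ⟨f x, s, g m, ?_⟩
      rw [map_sub, TensorProduct.AlgebraTensorModule.map_tmul,
        TensorProduct.AlgebraTensorModule.map_tmul, hf]
      simp)

theorem map_tmul {X' M' : Type} [AddCommGroup X'] [AddCommGroup M'] [Module R X']
    [Module Sᵐᵒᵖ X'] [SMulCommClass R Sᵐᵒᵖ X'] [Module S M'] (f : X →ₗ[R] X')
    (hf : ∀ (s : S) (x : X), f (MulOpposite.op s • x) = MulOpposite.op s • f x) (g : M →ₗ[S] M') (x : X) (m : M) :
    map f hf g (tmul R S x m) = tmul R S (f x) (g m) := rfl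

theorem map_id_apply (z : BalancedTensor R S X M) :
    map (R := R) (S := S) LinearMap.id (fun _ _ => rfl) LinearMap.id z = z := by
  refine induction_on (p := fun z => map (R := R) (S := S) LinearMap.id (fun _ _ => rfl)
    LinearMap.id z = z) z (map_zero _) (fun _ _ => rfl) fun a b ha hb => ?_
  rw [map_add, ha, hb]

theorem map_comp_apply {X' M' X'' M'' : Type} [AddCommGroup X'] [AddCommGroup M'] [Module R X']
    [Module Sᵐᵒᵖ X'] [SMulCommClass R Sᵐᵒᵖ X'] [Module S M'] [AddCommGroup X'']
    [AddCommGroup M''] [Module R X''] [Module Sᵐᵒᵖ X''] [SMulCommClass R Sᵐᵒᵖ X''] [Module S M'']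
    (f : X →ₗ[R] X') (hf : ∀ (s : S) (x : X), f (MulOpposite.op s • x) = MulOpposite.op s • f x)
    (g : M →ₗ[S] M') (f' : X' →ₗ[R] X'')
    (hf' : ∀ (s : S) (x : X'), f' (MulOpposite.op s • x) = MulOpposite.op s • f' x)
    (g' : M' →ₗ[S] M'') (z : BalancedTensor R S X M) :
    map (f'.comp f) (fun s x => by rw [LinearMap.comp_apply, hf, hf', LinearMap.comp_apply])
      (g'.comp g) z = map f' hf' g' (map f hf g z) := by
  refine induction_on (p := fun z => map (f'.comp f)
    (fun s x => by rw [LinearMap.comp_apply, hf, hf', LinearMap.comp_apply])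
      (g'.comp g) z = map f' hf' g' (map f hf g z)) z ?_ (fun _ _ => rfl) fun a b ha hb => ?_
  · rw [map_zero, map_zero, map_zero]
  · rw [map_add, ha, hb, map_add, map_add]

variable (R S) in
/-- The grading of the tensor product, in which `x ⊗ m` has degree `deg x + deg m`. -/
def gr (gX : ℤ → AddSubgroup X) (gM : ℤ → AddSubgroup M) (d : ℤ) :
    AddSubgroup (BalancedTensor R S X M) :=
  AddSubgroup.closure {z | ∃ i j x m, x ∈ gX i ∧ m ∈ gM j ∧ i + j = d ∧ z = tmul R S x m}

theorem tmul_mem_gr {gX : ℤ → AddSubgroup X} {gM : ℤ → AddSubgroup M} {i j d : ℤ} {x : X} {m : M}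
    (hx : x ∈ gX i) (hm : m ∈ gM j) (h : i + j = d) : tmul R S x m ∈ gr R S gX gM d :=
  AddSubgroup.subset_closure ⟨i, j, x, m, hx, hm, h, rfl⟩

theorem map_mem_gr {X' M' : Type} [AddCommGroup X'] [AddCommGroup M'] [Module R X']
    [Module Sᵐᵒᵖ X'] [SMulCommClass R Sᵐᵒᵖ X'] [Module S M'] (f : X →ₗ[R] X')
    (hf : ∀ (s : S) (x : X), f (MulOpposite.op s • x) = MulOpposite.op s • f x) (g : M →ₗ[S] M')
    {gX : ℤ → AddSubgroup X} {gM : ℤ → AddSubgroup M}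
    {gX' : ℤ → AddSubgroup X'} {gM' : ℤ → AddSubgroup M'}
    (h1 : ∀ i, ∀ x ∈ gX i, f x ∈ gX' i) (h2 : ∀ i, ∀ m ∈ gM i, g m ∈ gM' i) {d : ℤ}
    {z : BalancedTensor R S X M} (hz : z ∈ gr R S gX gM d) :
    map f hf g z ∈ gr R S gX' gM' d := by
  refine AddSubgroup.closure_induction (p := fun z _ => map f hf g z ∈ gr R S gX' gM' d)
    ?_ ?_ ?_ ?_ hz
  · rintro _ ⟨i, j, x, m, hx, hm, h, rfl⟩
    exact tmul_mem_gr (h1 i x hx) (h2 j m hm) h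
  · rw [map_zero]; exact AddSubgroup.zero_mem _
  · intro a b _ _ ha hb
    rw [map_add]; exact AddSubgroup.add_mem _ ha hb
  · intro a _ ha
    rw [map_neg]; exact AddSubgroup.neg_mem _ ha

theorem smul_mem_gr {gX : ℤ → AddSubgroup X} {gM : ℤ → AddSubgroup M} {gR : ℤ → AddSubgroup R}
    (h : ∀ i j r x, r ∈ gR i → x ∈ gX j → r • x ∈ gX (i + j)) {i j : ℤ} {r : R}
    {z : BalancedTensor R S X M} (hr : r ∈ gR i) (hz : z ∈ gr R S gX gM j) :
    r • z ∈ gr R S gX gM (i + j) := by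
  refine AddSubgroup.closure_induction (p := fun z _ => r • z ∈ gr R S gX gM (i + j))
    ?_ ?_ ?_ ?_ hz
  · rintro _ ⟨a, b, x, m, hx, hm, rfl, rfl⟩
    rw [smul_tmul']
    exact tmul_mem_gr (h i a r x hr hx) hm (by ring)
  · rw [smul_zero]; exact AddSubgroup.zero_mem _
  · intro a b _ _ ha hb
    rw [smul_add]; exact AddSubgroup.add_mem _ ha hb
  · intro a _ ha
    rw [smul_neg]; exact AddSubgroup.neg_mem _ ha

theorem hom_induction {N : Type} [AddCommGroup N] {g : ℤ → AddSubgroup N}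
    (h : DirectSum.IsInternal g) {p : N → Prop} (h0 : p 0) (h1 : ∀ i, ∀ x ∈ g i, p x)
    (h2 : ∀ a b, p a → p b → p (a + b)) (x : N) : p x := by
  obtain ⟨δ, hδ⟩ := exists_splitting h
  rw [← hδ.sum x, Finsupp.sum]
  exact Finset.sum_induction _ p h2 h0 fun i _ => h1 i _ (hδ.mem x i)

theorem exists_tensor_splitting {gX : ℤ → AddSubgroup X} {gM : ℤ → AddSubgroup M}
    (hX : DirectSum.IsInternal gX) (hM : DirectSum.IsInternal gM) :
    ∃ δ : (X ⊗[ℤ] M) →+ (ℤ →₀ X ⊗[ℤ] M), IsSplitting (fun d => AddSubgroup.closure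
      {z | ∃ i j x m, x ∈ gX i ∧ m ∈ gM j ∧ i + j = d ∧ z = x ⊗ₜ[ℤ] m}) δ := by
  obtain ⟨δX, hδX⟩ := exists_splitting hX
  obtain ⟨δM, hδM⟩ := exists_splitting hM
  let δ : (X ⊗[ℤ] M) →+ (ℤ →₀ X ⊗[ℤ] M) :=
    (Finsupp.mapDomain.addMonoidHom fun p : ℤ × ℤ => p.1 + p.2).comp
      ((finsuppTensorFinsupp ℤ ℤ X M ℤ ℤ).toLinearMap.comp
        (TensorProduct.map δX.toIntLinearMap δM.toIntLinearMap)).toAddMonoidHom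
  have hδ : ∀ i j x m, x ∈ gX i → m ∈ gM j →
      δ (x ⊗ₜ[ℤ] m) = Finsupp.single (i + j) (x ⊗ₜ[ℤ] m) := by
    intro i j x m hx hm
    simp only [δ, AddMonoidHom.comp_apply, LinearMap.toAddMonoidHom_coe, LinearMap.comp_apply,
      TensorProduct.map_tmul, AddMonoidHom.coe_toIntLinearMap, hδX.single i x hx,
      hδM.single j m hm, LinearEquiv.coe_coe, finsuppTensorFinsupp_single,
      Finsupp.mapDomain.addMonoidHom_apply, Finsupp.mapDomain_single]
  have gen : ∀ (p : X ⊗[ℤ] M → Prop), p 0 → (∀ a b, p a → p b → p (a + b)) →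
      (∀ i j x m, x ∈ gX i → m ∈ gM j → p (x ⊗ₜ[ℤ] m)) → ∀ t, p t := by
    intro p h0 h2 h1 t
    induction t using TensorProduct.induction_on with
    | zero => exact h0
    | tmul x m =>
      refine hom_induction hX (p := fun x => p (x ⊗ₜ[ℤ] m)) (by simpa using h0) ?_ ?_ x
      · intro i x hx
        refine hom_induction hM (p := fun m => p (x ⊗ₜ[ℤ] m)) (by simpa using h0) ?_ ?_ m
        · intro j m hm; exact h1 i j x m hx hm
        · intro a b ha hb; rw [TensorProduct.tmul_add]; exact h2 _ _ ha hb
      · intro a b ha hb; rw [TensorProduct.add_tmul]; exact h2 _ _ ha hb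
    | add a b ha hb => exact h2 _ _ ha hb
  refine ⟨δ, ?_, ?_, ?_⟩
  · intro t
    refine gen (fun t => ∀ d, δ t d ∈ AddSubgroup.closure
      {z | ∃ i j x m, x ∈ gX i ∧ m ∈ gM j ∧ i + j = d ∧ z = x ⊗ₜ[ℤ] m}) ?_ ?_ ?_ t
    · intro d; simp
    · intro a b ha hb d
      rw [map_add]; exact AddSubgroup.add_mem _ (ha d) (hb d)
    · intro i j x m hx hm d
      rw [hδ i j x m hx hm]
      by_cases hd : i + j = d
      · subst hd
        rw [Finsupp.single_eq_same]
        exact AddSubgroup.subset_closure ⟨i, j, x, m, hx, hm, rfl, rfl⟩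
      · rw [Finsupp.single_eq_of_ne (Ne.symm hd)]; exact AddSubgroup.zero_mem _
  · refine gen _ (by simp) ?_ ?_
    · intro a b ha hb
      rw [map_add, Finsupp.sum_add_index' (by simp) (by simp), ha, hb]
    · intro i j x m hx hm
      rw [hδ i j x m hx hm]; simp
  · intro d t ht
    refine AddSubgroup.closure_induction (p := fun t _ => δ t = Finsupp.single d t) ?_ ?_ ?_ ?_ ht
    · rintro _ ⟨i, j, x, m, hx, hm, rfl, rfl⟩
      exact hδ i j x m hx hm
    · simp
    · intro a b _ _ ha hb
      rw [map_add, ha, hb, Finsupp.single_add]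
    · intro a _ ha
      rw [map_neg, ha, Finsupp.single_neg]

theorem isInternal_gr {gX : ℤ → AddSubgroup X} {gM : ℤ → AddSubgroup M} {gS : ℤ → AddSubgroup S}
    (hX : DirectSum.IsInternal gX) (hM : DirectSum.IsInternal gM) (hS : DirectSum.IsInternal gS)
    (h1 : ∀ i j s x, s ∈ gS i → x ∈ gX j → MulOpposite.op s • x ∈ gX (i + j))
    (h2 : ∀ i j s m, s ∈ gS i → m ∈ gM j → s • m ∈ gM (i + j)) :
    DirectSum.IsInternal (gr R S gX gM) := by
  obtain ⟨δ, hδ⟩ := exists_tensor_splitting hX hM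
  let HR : Set (X ⊗[ℤ] M) := {t | ∃ i j k x s m, x ∈ gX i ∧ s ∈ gS j ∧ m ∈ gM k ∧
    t = (MulOpposite.op s • x) ⊗ₜ[ℤ] m - x ⊗ₜ[ℤ] (s • m)}
  have hrel : ∀ (x : X) (s : S) (m : M), (MulOpposite.op s • x) ⊗ₜ[ℤ] m - x ⊗ₜ[ℤ] (s • m) ∈
      AddSubgroup.closure HR := by
    intro x s m
    refine hom_induction hX (p := fun x => (MulOpposite.op s • x) ⊗ₜ[ℤ] m - x ⊗ₜ[ℤ] (s • m) ∈
      AddSubgroup.closure HR) (by simp) ?_ ?_ x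
    · intro i x hx
      refine hom_induction hS (p := fun s => (MulOpposite.op s • x) ⊗ₜ[ℤ] m - x ⊗ₜ[ℤ] (s • m) ∈
        AddSubgroup.closure HR) (by simp) ?_ ?_ s
      · intro j s hs
        refine hom_induction hM (p := fun m => (MulOpposite.op s • x) ⊗ₜ[ℤ] m - x ⊗ₜ[ℤ] (s • m) ∈
          AddSubgroup.closure HR) (by simp) ?_ ?_ m
        · intro k m hm
          exact AddSubgroup.subset_closure ⟨i, j, k, x, s, m, hx, hs, hm, rfl⟩
        · intro a b ha hb
          convert AddSubgroup.add_mem _ ha hb using 1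
          rw [smul_add, TensorProduct.tmul_add, TensorProduct.tmul_add]; abel
      · intro a b ha hb
        convert AddSubgroup.add_mem _ ha hb using 1
        rw [MulOpposite.op_add, add_smul, add_smul, TensorProduct.tmul_add, TensorProduct.add_tmul]; abel
    · intro a b ha hb
      convert AddSubgroup.add_mem _ ha hb using 1
      rw [smul_add, TensorProduct.add_tmul, TensorProduct.add_tmul]; abel
  have hmem : ∀ t ∈ balancedRelations R S X M, t ∈ AddSubgroup.closure HR := by
    intro t ht
    refine Submodule.closure_induction (p := fun t _ => t ∈ AddSubgroup.closure HR) ?_ ?_ ?_ ht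
    · exact AddSubgroup.zero_mem _
    · intro a b _ _ ha hb; exact AddSubgroup.add_mem _ ha hb
    · rintro r _ ⟨x, s, m, rfl⟩
      have := hrel (r • x) s m
      rw [smul_sub, TensorProduct.smul_tmul', TensorProduct.smul_tmul', smul_comm r (MulOpposite.op s) x]
      exact this
  have hHR : ∀ t ∈ HR, t ∈ balancedRelations R S X M := by
    rintro _ ⟨i, j, k, x, s, m, -, -, -, rfl⟩
    exact Submodule.subset_span ⟨x, s, m, rfl⟩
  have hcomp : ∀ t ∈ AddSubgroup.closure HR, ∀ d, δ t d ∈ balancedRelations R S X M := by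
    intro t ht
    refine AddSubgroup.closure_induction
      (p := fun t _ => ∀ d, δ t d ∈ balancedRelations R S X M) ?_ ?_ ?_ ?_ ht
    · intro t ht d
      have ht' := ht
      obtain ⟨i, j, k, x, s, m, hx, hs, hm, rfl⟩ := ht'
      have e : δ ((MulOpposite.op s • x) ⊗ₜ[ℤ] m - x ⊗ₜ[ℤ] (s • m)) =
          Finsupp.single (i + j + k) ((MulOpposite.op s • x) ⊗ₜ[ℤ] m - x ⊗ₜ[ℤ] (s • m)) := by
        apply hδ.single
        apply AddSubgroup.sub_mem
        · exact AddSubgroup.subset_closure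
            ⟨j + i, k, _, _, h1 j i s x hs hx, hm, by ring, rfl⟩
        · exact AddSubgroup.subset_closure
            ⟨i, j + k, _, _, hx, h2 j k s m hs hm, by ring, rfl⟩
      rw [e]
      by_cases hd : i + j + k = d
      · subst hd
        rw [Finsupp.single_eq_same]; exact hHR _ ht
      · rw [Finsupp.single_eq_of_ne (Ne.symm hd)]; exact Submodule.zero_mem _
    · intro d; simp
    · intro a b _ _ ha hb d
      rw [map_add]; exact Submodule.add_mem _ (ha d) (hb d)
    · intro a _ ha d
      rw [map_neg]; exact Submodule.neg_mem _ (ha d)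
  have h3 := isInternal_quotient hδ (q := (balancedRelations R S X M).mkQ.toAddMonoidHom)
    (Submodule.mkQ_surjective _) (by
      intro t ht d
      have ht' : t ∈ balancedRelations R S X M := (Submodule.Quotient.mk_eq_zero _).1 ht
      exact (Submodule.Quotient.mk_eq_zero _).2 (hcomp t (hmem t ht') d))
  have e : gr R S gX gM = fun d => (AddSubgroup.closure
      {z | ∃ i j x m, x ∈ gX i ∧ m ∈ gM j ∧ i + j = d ∧ z = x ⊗ₜ[ℤ] m}).map
        (balancedRelations R S X M).mkQ.toAddMonoidHom := by
    funext d
    rw [AddMonoidHom.map_closure, gr]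
    congr 1
    ext z
    constructor
    · rintro ⟨i, j, x, m, hx, hm, h, rfl⟩
      exact ⟨_, ⟨i, j, x, m, hx, hm, h, rfl⟩, rfl⟩
    · rintro ⟨_, ⟨i, j, x, m, hx, hm, h, rfl⟩, rfl⟩
      exact ⟨i, j, x, m, hx, hm, h, rfl⟩
  rw [e]
  exact h3

end BalancedTensor

end BalancedTensor

section GradedModules

variable (R : Type) [Ring R] (gR : ℤ → AddSubgroup R)

/-- A finitely generated `ℤ`-graded left module over the graded ring `R`; `gR` is the grading of
`R`. -/
structure GrMod where
  carrier : Type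
  [addCommGroup : AddCommGroup carrier]
  [module : Module R carrier]
  gr : ℤ → AddSubgroup carrier
  isInternal : DirectSum.IsInternal gr
  smul_mem : ∀ i j r m, r ∈ gR i → m ∈ gr j → r • m ∈ gr (i + j)
  finite : Module.Finite R carrier

attribute [instance] GrMod.addCommGroup GrMod.module

namespace GrMod

variable {R gR}

/-- A homomorphism of graded modules: a linear map that preserves degrees. -/
@[ext]
structure Hom (M N : GrMod R gR) where
  toLin : M.carrier →ₗ[R] N.carrier
  map_mem : ∀ d, ∀ m ∈ M.gr d, toLin m ∈ N.gr d

instance : Category (GrMod R gR) where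
  Hom := Hom
  id M := ⟨LinearMap.id, fun _ _ h => h⟩
  comp f g := ⟨g.toLin.comp f.toLin, fun d m h => g.map_mem d _ (f.map_mem d m h)⟩

@[ext] theorem hom_ext {M N : GrMod R gR} {f g : M ⟶ N} (h : ∀ m, f.toLin m = g.toLin m) :
    f = g := Hom.ext (LinearMap.ext h)

@[simp] theorem id_toLin (M : GrMod R gR) (m : M.carrier) : (𝟙 M : M ⟶ M).toLin m = m := rfl

@[simp] theorem comp_toLin {M N P : GrMod R gR} (f : M ⟶ N) (g : N ⟶ P) (m : M.carrier) :
    (f ≫ g).toLin m = g.toLin (f.toLin m) := rfl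

/-- The zero module. -/
def zero : GrMod R gR where
  carrier := PUnit
  gr _ := ⊥
  isInternal := by
    refine IsSplitting.isInternal (δ := 0) ⟨fun _ _ => Subsingleton.elim _ _,
      fun _ => Subsingleton.elim _ _, fun _ m _ => ?_⟩
    ext
  smul_mem _ _ _ _ _ _ := Subsingleton.elim _ _
  finite := inferInstance

/-- The functor `M ↦ M{k}` that shifts the grading up by `k`. -/
def shift (k : ℤ) : GrMod R gR ⥤ GrMod R gR where
  obj M :=
    { carrier := M.carrier
      gr := shiftGr M.gr k
      isInternal := isInternal_shift M.isInternal k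
      smul_mem := fun i j r m hr hm => by
        have := M.smul_mem i (j - k) r m hr hm
        rwa [← add_sub_assoc] at this
      finite := M.finite }
  map f := ⟨f.toLin, fun d m h => f.map_mem (d - k) m h⟩

end GrMod

/-- A graded abelian group. -/
structure GrAb where
  carrier : Type
  [addCommGroup : AddCommGroup carrier]
  gr : ℤ → AddSubgroup carrier
  isInternal : DirectSum.IsInternal gr

attribute [instance] GrAb.addCommGroup

namespace GrAb

/-- A homomorphism of graded abelian groups: an additive map that preserves degrees. -/
@[ext]
structure Hom (M N : GrAb) where
  toHom : M.carrier →+ N.carrier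
  map_mem : ∀ d, ∀ m ∈ M.gr d, toHom m ∈ N.gr d

instance : Category GrAb where
  Hom := Hom
  id M := ⟨AddMonoidHom.id _, fun _ _ h => h⟩
  comp f g := ⟨g.toHom.comp f.toHom, fun d m h => g.map_mem d _ (f.map_mem d m h)⟩

@[ext] theorem hom_ext {M N : GrAb} {f g : M ⟶ N} (h : ∀ m, f.toHom m = g.toHom m) :
    f = g := Hom.ext (AddMonoidHom.ext h)

@[simp] theorem id_toHom (M : GrAb) (m : M.carrier) : (𝟙 M : M ⟶ M).toHom m = m := rfl

@[simp] theorem comp_toHom {M N P : GrAb} (f : M ⟶ N) (g : N ⟶ P) (m : M.carrier) :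
    (f ≫ g).toHom m = g.toHom (f.toHom m) := rfl

/-- The direct sum of a finite family of graded abelian groups. -/
def pi {ι : Type} [Finite ι] (P : ι → GrAb) : GrAb where
  carrier := ∀ l, (P l).carrier
  gr d := AddSubgroup.pi Set.univ fun l => (P l).gr d
  isInternal := isInternal_pi fun l => (P l).isInternal

/-- The homomorphism of direct sums with the given components. -/
def piMap {ι : Type} [Finite ι] {P P' : ι → GrAb} (f : ∀ l, P l ⟶ P' l) : pi P ⟶ pi P' where
  toHom := AddMonoidHom.mk' (fun z l => (f l).toHom (z l))
    fun a b => funext fun l => map_add (f l).toHom (a l) (b l)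
  map_mem d z hz l hl := (f l).map_mem d (z l) (hz l hl)

end GrAb

variable {S : Type} [Ring S] (gS : ℤ → AddSubgroup S)

variable (S) in
/-- A graded `(R, S)`-bimodule, finitely generated as a left module. -/
structure GrBimod where
  carrier : Type
  [addCommGroup : AddCommGroup carrier]
  [left : Module R carrier]
  [right : Module Sᵐᵒᵖ carrier]
  [smulComm : SMulCommClass R Sᵐᵒᵖ carrier]
  gr : ℤ → AddSubgroup carrier
  isInternal : DirectSum.IsInternal gr
  smul_mem : ∀ i j r x, r ∈ gR i → x ∈ gr j → r • x ∈ gr (i + j)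
  op_smul_mem : ∀ i j s x, s ∈ gS i → x ∈ gr j → MulOpposite.op s • x ∈ gr (i + j)
  finite : Module.Finite R carrier

attribute [instance] GrBimod.addCommGroup GrBimod.left GrBimod.right GrBimod.smulComm

namespace GrBimod

variable {R gR gS}

/-- The functor `M ↦ X ⊗ M` given by tensoring with a graded bimodule. -/
noncomputable def tensor [GradedRing gS] (X : GrBimod R gR S gS) :
    GrMod S gS ⥤ GrMod R gR where
  obj M :=
    { carrier := BalancedTensor R S X.carrier M.carrier
      gr := BalancedTensor.gr R S X.gr M.gr
      isInternal := BalancedTensor.isInternal_gr X.isInternal M.isInternal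
        (DirectSum.Decomposition.isInternal gS) X.op_smul_mem M.smul_mem
      smul_mem := fun _ _ _ _ hr hz => BalancedTensor.smul_mem_gr X.smul_mem hr hz
      finite := by
        have := X.finite
        have := M.finite
        exact BalancedTensor.finite }
  map f := ⟨BalancedTensor.map LinearMap.id (fun _ _ => rfl) f.toLin, fun _ _ hz =>
    BalancedTensor.map_mem_gr _ _ _ (fun _ _ h => h) f.map_mem hz⟩
  map_id M := by
    ext z
    exact BalancedTensor.map_id_apply z
  map_comp f g := by
    ext z
    exact BalancedTensor.map_comp_apply LinearMap.id (fun _ _ => rfl) f.toLin LinearMap.id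
      (fun _ _ => rfl) g.toLin z

end GrBimod

end GradedModules

section TangleBimodules

variable {s t : Type} [LinearOrder s] [Fintype s] [LinearOrder t] [Fintype t]

namespace CupDiagram

variable (T : CupDiagram s t)

/-- The group underlying the bimodule `F(T)` of a flat tangle `T` from `s` to `t` with strands and
cups, that is the direct sum of the groups `F(W(b) T a)`. -/
def CupMat : Type := ArcMat (fun b : Matching t => b) T.comp

/-- The group underlying the bimodule `F(W(T))` of the reflected tangle, from `t` to `s`, with strands
and caps, that is the direct sum of the groups `F(W(b) W(T) a) = F(W(T b) a)`. -/
def CapMat : Type := ArcMat T.comp (fun b : Matching t => b)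

noncomputable instance : AddCommGroup T.CupMat :=
  inferInstanceAs (AddCommGroup (ArcMat (fun b : Matching t => b) T.comp))

noncomputable instance : AddCommGroup T.CapMat :=
  inferInstanceAs (AddCommGroup (ArcMat T.comp (fun b : Matching t => b)))

/-- The left action is given by the contractions `F(W(c)b) ⊗ F(W(b) T a) → F(W(c) T a)`. -/
noncomputable instance : Module (ArcRing t) T.CupMat where
  smul y x := ArcMat.mul y x
  one_smul := ArcMat.one_mul
  mul_smul := ArcMat.mul_assoc
  smul_zero := ArcMat.mul_zero
  smul_add := ArcMat.mul_add
  add_smul := ArcMat.add_mul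
  zero_smul := ArcMat.zero_mul

/-- The right action is given by the contractions `F(W(b) T a) ⊗ F(W(a)c) → F(W(b) T c)` of `a` with
`W(a)`. Inserting circles labelled by `1` into `F(W(a)c)`, one for each cup of `T`, and contracting
`T a` with `W(T a)` gives the same map, because the additional saddles merge these circles with
others. -/
noncomputable instance : Module (ArcRing s)ᵐᵒᵖ T.CupMat where
  smul y x := ArcMat.mul x (ArcMat.addCups T y.unop)
  one_smul x := (congrArg (ArcMat.mul x) (ArcMat.addCups_one T)).trans (ArcMat.mul_one x)
  mul_smul _ _ x := (congrArg (ArcMat.mul x) (ArcMat.addCups_mul T _ _)).trans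
    (ArcMat.mul_assoc x _ _).symm
  smul_zero _ := ArcMat.zero_mul _
  smul_add _ x z := ArcMat.add_mul x z _
  add_smul _ _ x := (congrArg (ArcMat.mul x) (ArcMat.addCups_add T _ _)).trans
    (ArcMat.mul_add x _ _)
  zero_smul x := (congrArg (ArcMat.mul x) (ArcMat.addCups_zero T)).trans (ArcMat.mul_zero x)

noncomputable instance : SMulCommClass (ArcRing t) (ArcRing s)ᵐᵒᵖ T.CupMat where
  smul_comm y _ x := (ArcMat.mul_assoc (f := fun b : Matching t => b) y x _).symm

/-- The left action is given by contractions as in the case of the right action on `F(T)`. -/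
noncomputable instance : Module (ArcRing s) T.CapMat where
  smul y x := ArcMat.mul (ArcMat.addCups T y) x
  one_smul x := (congrArg (fun y => ArcMat.mul y x) (ArcMat.addCups_one T)).trans
    (ArcMat.one_mul x)
  mul_smul _ _ x := (congrArg (fun y => ArcMat.mul y x) (ArcMat.addCups_mul T _ _)).trans
    (ArcMat.mul_assoc _ _ x)
  smul_zero _ := ArcMat.mul_zero _
  smul_add _ x z := ArcMat.mul_add _ x z
  add_smul _ _ x := (congrArg (fun y => ArcMat.mul y x) (ArcMat.addCups_add T _ _)).trans
    (ArcMat.add_mul _ _ x)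
  zero_smul x := (congrArg (fun y => ArcMat.mul y x) (ArcMat.addCups_zero T)).trans
    (ArcMat.zero_mul x)

/-- The right action is given by the contractions `F(W(T b) a) ⊗ F(W(a)c) → F(W(T b) c)`. -/
noncomputable instance : Module (ArcRing t)ᵐᵒᵖ T.CapMat where
  smul y x := ArcMat.mul x y.unop
  one_smul := ArcMat.mul_one
  mul_smul y z x := (ArcMat.mul_assoc x z.unop y.unop).symm
  smul_zero _ := ArcMat.zero_mul _
  smul_add _ x z := ArcMat.add_mul x z _
  add_smul _ _ x := ArcMat.mul_add x _ _
  zero_smul x := ArcMat.mul_zero x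

noncomputable instance : SMulCommClass (ArcRing s) (ArcRing t)ᵐᵒᵖ T.CapMat where
  smul_comm _ z x := (ArcMat.mul_assoc _ x (k := fun b : Matching t => b) z.unop).symm

/-- The graded `(H(t), H(s))`-bimodule `F(T)`, the direct sum of the groups `F(W(b) T a){m}`, where
`2 m` is the number of bottom endpoints, which are the points of `s`. -/
noncomputable def cupBimodule :
    GrBimod (ArcRing t) (ArcRing.gr t) (ArcRing s) (ArcRing.gr s) where
  carrier := T.CupMat
  gr := shiftGr (M := ArcMat (fun b : Matching t => b) T.comp) (ArcMat.gr _ _)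
    (Fintype.card (OddPoint s))
  isInternal := isInternal_shift ArcMat.isInternal_gr _
  smul_mem i j y x hy hx := by
    have := ArcMat.mul_mem (f := fun b : Matching t => b) hy hx
    change ArcMat.mul y x ∈ ArcMat.gr _ _ (i + j - _)
    convert this using 1
    ring_nf
  op_smul_mem i j y x hy hx := by
    have := ArcMat.mul_mem hx (ArcMat.addCups_mem T hy)
    change ArcMat.mul x (ArcMat.addCups T y) ∈ ArcMat.gr _ _ (i + j - _)
    convert this using 1
    ring_nf
  finite := by
    have : Module.Finite ℤ T.CupMat := ArcMat.finite (f := fun b : Matching t => b) (g := T.comp)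
    exact Module.Finite.of_restrictScalars_finite ℤ _ _

/-- The graded `(H(s), H(t))`-bimodule `F(W(T))` of the reflected tangle, the direct sum of the groups
`F(W(b) W(T) a){m}`, where `2 m` is the number of bottom endpoints, which are now the points
of `t`. -/
noncomputable def capBimodule :
    GrBimod (ArcRing s) (ArcRing.gr s) (ArcRing t) (ArcRing.gr t) where
  carrier := T.CapMat
  gr := shiftGr (M := ArcMat T.comp (fun b : Matching t => b)) (ArcMat.gr _ _)
    (Fintype.card (OddPoint t))
  isInternal := isInternal_shift ArcMat.isInternal_gr _
  smul_mem i j y x hy hx := by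
    have := ArcMat.mul_mem (ArcMat.addCups_mem T hy) hx
    change ArcMat.mul (ArcMat.addCups T y) x ∈ ArcMat.gr _ _ (i + j - _)
    convert this using 1
    ring_nf
  op_smul_mem i j y x hy hx := by
    have := ArcMat.mul_mem (h := fun b : Matching t => b) hx hy
    change ArcMat.mul x y ∈ ArcMat.gr _ _ (i + j - _)
    convert this using 1
    ring_nf
  finite := by
    have : Module.Finite ℤ T.CapMat := ArcMat.finite (g := fun b : Matching t => b) (f := T.comp)
    exact Module.Finite.of_restrictScalars_finite ℤ _ _

end CupDiagram

end TangleBimodules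

section Weights

variable {n k : ℕ}

/-- The admissible weights: sequences `(l 1, …, l n)` of numbers in `{0, 1, 2}` with sum `2 k`. -/
structure Weight (n k : ℕ) where
  coeff : Fin n → ℕ
  le_two : ∀ j, coeff j ≤ 2
  sum_eq : ∑ j, coeff j = 2 * k

namespace Weight

instance : CoeFun (Weight n k) (fun _ => Fin n → ℕ) := ⟨fun l => l.coeff⟩

@[ext] theorem ext {l l' : Weight n k} (h : ∀ j, l j = l' j) : l = l' := by
  cases l; cases l'
  congr 1
  exact funext h

instance : Finite (Weight n k) := by
  refine Finite.of_injective (β := Fin n → Fin 3)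
    (fun l j => ⟨l j, Nat.lt_succ_of_le (l.le_two j)⟩) fun l l' h => ext fun j => ?_
  exact congrArg Fin.val (congrFun h j)

/-- The sequence `s(l)` of the positions of the coefficients that are equal to `1`. -/
abbrev Pt (l : Weight n k) : Type := {j : Fin n // l j = 1}

/-- The positions `p` and `q` are adjacent, and the weight `y` arises from the weight `x` by increasing
the coefficient at `p` and decreasing the coefficient at `q` by one. -/
structure IsMove (p q : Fin n) (x y : Weight n k) : Prop where
  adj : p.1 + 1 = q.1 ∨ q.1 + 1 = p.1
  at_target : y p = x p + 1
  at_source : x q = y q + 1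
  elsewhere : ∀ j, j ≠ p → j ≠ q → y j = x j

namespace IsMove

variable {p q : Fin n} {x y : Weight n k}

theorem symm (h : IsMove p q x y) : IsMove q p y x :=
  ⟨h.adj.symm, h.at_source, h.at_target, fun j h1 h2 => (h.elsewhere j h2 h1).symm⟩

theorem ne (h : IsMove p q x y) : p ≠ q := by
  rintro rfl
  have := h.adj
  omega

theorem swap_pt (h : IsMove p q x y) (hc : ¬ (x p = 1 ∧ x q = 1)) {j : Fin n} (hj : x j = 1) :
    y (Equiv.swap p q j) = 1 := by
  have h1 := h.at_target
  have h2 := h.at_source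
  have h3 := y.le_two p
  have h4 := x.le_two q
  by_cases hp : j = p
  · subst hp
    rw [Equiv.swap_apply_left]
    omega
  by_cases hq : j = q
  · subst hq
    rw [Equiv.swap_apply_right]
    omega
  rw [Equiv.swap_apply_of_ne_of_ne hp hq, h.elsewhere j hp hq, hj]

theorem swap_lt (h : IsMove p q x y) (hc : ¬ (x p = 1 ∧ x q = 1)) {i j : Fin n} (hi : x i = 1)
    (hj : x j = 1) (hij : i < j) : Equiv.swap p q i < Equiv.swap p q j := by
  have h0 := h.adj
  have e : ∀ m : Fin n, (m = p ∧ Equiv.swap p q m = q) ∨ (m = q ∧ Equiv.swap p q m = p) ∨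
      (m ≠ p ∧ m ≠ q ∧ Equiv.swap p q m = m) := by
    intro m
    by_cases hp : m = p
    · left; subst hp; exact ⟨rfl, Equiv.swap_apply_left _ _⟩
    by_cases hq : m = q
    · right; left; subst hq; exact ⟨rfl, Equiv.swap_apply_right _ _⟩
    exact Or.inr (Or.inr ⟨hp, hq, Equiv.swap_apply_of_ne_of_ne hp hq⟩)
  rcases e i with ⟨a1, a2⟩ | ⟨a1, a2⟩ | ⟨a1, a2, a3⟩ <;>
    rcases e j with ⟨b1, b2⟩ | ⟨b1, b2⟩ | ⟨b1, b2, b3⟩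
  · subst a1; subst b1; exact absurd hij (lt_irrefl _)
  · subst a1; subst b1; exact absurd ⟨hi, hj⟩ hc
  · rw [a2, b3]; subst a1
    rw [Fin.lt_def] at *
    have := Fin.val_ne_of_ne b2
    omega
  · subst a1; subst b1; exact absurd ⟨hj, hi⟩ hc
  · subst a1; subst b1; exact absurd hij (lt_irrefl _)
  · rw [a2, b3]; subst a1
    rw [Fin.lt_def] at *
    have := Fin.val_ne_of_ne b1
    omega
  · rw [a3, b2]; subst b1
    rw [Fin.lt_def] at *
    have := Fin.val_ne_of_ne a2
    omega
  · rw [a3, b2]; subst b1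
    rw [Fin.lt_def] at *
    have := Fin.val_ne_of_ne a1
    omega
  · rwa [a3, b3]

/-- If `x p` and `x q` are not both `1` then every bottom endpoint is joined to the top endpoint in
the same position, except that an endpoint in position `p` or `q` moves to the other one of these
two positions. -/
def strand (h : IsMove p q x y) (hc : ¬ (x p = 1 ∧ x q = 1)) : x.Pt ↪o y.Pt :=
  OrderEmbedding.ofStrictMono (fun j => ⟨Equiv.swap p q j.1, h.swap_pt hc j.2⟩)
    fun i j hij => h.swap_lt hc i.2 j.2 hij

theorem notMem_strand (h : IsMove p q x y) (hc : ¬ (x p = 1 ∧ x q = 1)) {r : y.Pt}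
    (hr : r ∉ Set.range (h.strand hc)) :
    y p = 1 ∧ y q = 1 ∧ (r.1 = p ∨ r.1 = q) ∧ x p ≠ 1 ∧ x q ≠ 1 := by
  have hx : x (Equiv.swap p q r.1) ≠ 1 := by
    intro hh
    apply hr
    refine ⟨⟨Equiv.swap p q r.1, hh⟩, Subtype.ext ?_⟩
    exact Equiv.swap_apply_self p q r.1
  have h1 := h.at_target
  have h2 := h.at_source
  have h3 := y.le_two p
  have h4 := x.le_two q
  have h5 := r.2
  by_cases hp : r.1 = p
  · rw [hp, Equiv.swap_apply_left] at hx
    rw [hp] at h5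
    exact ⟨by omega, by omega, Or.inl hp, by omega, by omega⟩
  by_cases hq : r.1 = q
  · rw [hq, Equiv.swap_apply_right] at hx
    rw [hq] at h5
    exact ⟨by omega, by omega, Or.inr hq, by omega, by omega⟩
  rw [Equiv.swap_apply_of_ne_of_ne hp hq, ← h.elsewhere _ hp hq] at hx
  exact absurd h5 hx

/-- The flat tangle with bottom endpoints `s(x)` and top endpoints `s(y)` if `x p` and `x q` are not
both `1`. If one of them is `1` it consists of strands only, one of which joins the bottom endpoint
in `p` or `q` to the top endpoint in the other position. If `(x p, x q) = (0, 2)` then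
`(y p, y q) = (1, 1)` and the tangle has one cup, which joins the top endpoints `p` and `q`. -/
def tangle (h : IsMove p q x y) (hc : ¬ (x p = 1 ∧ x q = 1)) : CupDiagram x.Pt y.Pt where
  strand := h.strand hc
  cup r := if hr : y (Equiv.swap p q r.1) = 1 then ⟨Equiv.swap p q r.1, hr⟩ else r
  cup_notMem r hr := by
    obtain ⟨h1, h2, h3, h4, h5⟩ := h.notMem_strand hc hr
    have h6 : y (Equiv.swap p q r.1) = 1 ∧ x r.1 ≠ 1 := by
      rcases h3 with h3 | h3 <;> rw [h3]
      · exact ⟨by rwa [Equiv.swap_apply_left], h4⟩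
      · exact ⟨by rwa [Equiv.swap_apply_right], h5⟩
    rw [dif_pos h6.1]
    rintro ⟨j, hj⟩
    have e : Equiv.swap p q j.1 = Equiv.swap p q r.1 := congrArg Subtype.val hj
    have e' := (Equiv.swap p q).injective e
    exact h6.2 (e' ▸ j.2)
  cup_cup r hr := by
    obtain ⟨h1, h2, h3, -, -⟩ := h.notMem_strand hc hr
    have h6 : y (Equiv.swap p q r.1) = 1 := by
      rcases h3 with h3 | h3 <;> rw [h3]
      · rwa [Equiv.swap_apply_left]
      · rwa [Equiv.swap_apply_right]
    have h7 : y (Equiv.swap p q (Equiv.swap p q r.1)) = 1 := by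
      rw [Equiv.swap_apply_self]; exact r.2
    rw [dif_pos h6, dif_pos h7]
    exact Subtype.ext (Equiv.swap_apply_self p q r.1)
  cup_ne r hr := by
    obtain ⟨h1, h2, h3, -, -⟩ := h.notMem_strand hc hr
    have h6 : y (Equiv.swap p q r.1) = 1 ∧ Equiv.swap p q r.1 ≠ r.1 := by
      rcases h3 with h3 | h3 <;> rw [h3]
      · rw [Equiv.swap_apply_left]; exact ⟨h2, h.ne.symm⟩
      · rw [Equiv.swap_apply_right]; exact ⟨h1, h.ne⟩
    rw [dif_pos h6.1]
    exact fun hh => h6.2 (congrArg Subtype.val hh)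
  cup_adj r hr := by
    obtain ⟨h1, h2, h3, -, -⟩ := h.notMem_strand hc hr
    have h0 := h.adj
    have h6 : y (Equiv.swap p q r.1) = 1 ∧
        (r.1.1 + 1 = (Equiv.swap p q r.1).1 ∨ (Equiv.swap p q r.1).1 + 1 = r.1.1) := by
      rcases h3 with h3 | h3 <;> rw [h3]
      · rw [Equiv.swap_apply_left]; exact ⟨h2, h0⟩
      · rw [Equiv.swap_apply_right]; exact ⟨h1, h0.symm⟩
    rw [dif_pos h6.1]
    rintro q' ⟨h7, h8⟩
    have h9 : r.1.1 < q'.1.1 := h7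
    have h10 : q'.1.1 < (Equiv.swap p q r.1).1 := h8
    have := h6.2
    omega

end IsMove

end Weight

end Weights

section ArcCategory

variable {n k : ℕ}

/-- The category `C`, the direct sum over all admissible weights `l` of the categories `C(l)` of
finitely generated graded modules over `H_l = H(s(l))`. There are finitely many weights, so an
object of the direct sum is a family of objects of the summands. -/
abbrev ArcCat (n k : ℕ) : Type 1 :=
  ∀ l : Weight n k, GrMod (ArcRing l.Pt) (ArcRing.gr l.Pt)

namespace ArcCat

/-- The `(H_y, H_x)`-bimodule of a move from `x` to `y`. If `(x p, x q) = (1, 1)` then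
`(y p, y q) = (2, 0)`, and it is the bimodule of the tangle with a cap joining the bottom endpoints
`p` and `q`, the reflection of the tangle of the reversed move. In all the other cases it is the
bimodule of the tangle of the move, with one cup or strands only. -/
noncomputable def moveBimodule {p q : Fin n} {x y : Weight n k} (h : Weight.IsMove p q x y) :
    GrBimod (ArcRing y.Pt) (ArcRing.gr y.Pt) (ArcRing x.Pt) (ArcRing.gr x.Pt) :=
  if hc : x p = 1 ∧ x q = 1 then
    (h.symm.tangle (by have := h.at_target; omega)).capBimodule
  else (h.tangle hc).cupBimodule

open Classical in
/-- The sum over all weights `x` of the functors `C(x) ⥤ C(y)` given by tensoring with the bimodule of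
the move from `x` to the weight `y` that arises by increasing the coefficient at `p` and decreasing
the coefficient at `q` by one, and of zero functors if this `y` is not admissible. The component in
`C(y)` of the image of an object of `C` comes from its component in `C(x)`; it is zero if there is
no such `x`. -/
noncomputable def moveFunctor (p q : Fin n) : ArcCat n k ⥤ ArcCat n k :=
  Functor.pi' fun y =>
    if h : ∃ x, Weight.IsMove p q x y then
      Pi.eval _ h.choose ⋙ (moveBimodule h.choose_spec).tensor
    else (Functor.const _).obj GrMod.zero

/-- The functor `E_i`, which takes `C(l)` to `C(l + ε_i)`, where `ε_i` has coefficients `1` and `-1`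
in the positions `i` and `i + 1`. The positions are numbered from `0` to `n - 1`. -/
noncomputable def E (i : ℕ) (hi : i + 1 < n) : ArcCat n k ⥤ ArcCat n k :=
  moveFunctor ⟨i, by omega⟩ ⟨i + 1, hi⟩

/-- The functor `F_i`, which takes `C(l)` to `C(l - ε_i)`. -/
noncomputable def F (i : ℕ) (hi : i + 1 < n) : ArcCat n k ⥤ ArcCat n k :=
  moveFunctor ⟨i + 1, hi⟩ ⟨i, by omega⟩

/-- The functor that takes an object `M` of `C(l)` to `M{c l}`. -/
noncomputable def shift (c : Weight n k → ℤ) : ArcCat n k ⥤ ArcCat n k :=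
  Functor.pi' fun l => Pi.eval _ l ⋙ GrMod.shift (c l)

/-- The functor `K_i`, which takes an object `M` of `C(l)` to `M{l i - l (i + 1)}`. -/
noncomputable def K (i : ℕ) (hi : i + 1 < n) : ArcCat n k ⥤ ArcCat n k :=
  shift fun l => (l ⟨i, by omega⟩ : ℤ) - l ⟨i + 1, hi⟩

/-- The inverse `K_i⁻¹` of the functor `K_i`. -/
noncomputable def KInv (i : ℕ) (hi : i + 1 < n) : ArcCat n k ⥤ ArcCat n k :=
  shift fun l => -((l ⟨i, by omega⟩ : ℤ) - l ⟨i + 1, hi⟩)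

end ArcCat

section Twist

variable {s : Type} [LinearOrder s] [Fintype s]

/-- The right `H(s)`-module `ψM`: the group `M` with `m h = χ(h) m`, where `χ` is the
anti-involution of `H(s)`. -/
def Twist (M : GrMod (ArcRing s) (ArcRing.gr s)) : Type := M.carrier

noncomputable instance (M : GrMod (ArcRing s) (ArcRing.gr s)) : AddCommGroup (Twist M) :=
  M.addCommGroup

noncomputable instance (M : GrMod (ArcRing s) (ArcRing.gr s)) :
    Module (ArcRing s)ᵐᵒᵖ (Twist M) :=
  Module.compHom M.carrier (ArcRing.chi (s := s)).symm.toRingHom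

namespace Twist

/-- The grading of `ψM`. -/
def gr (M : GrMod (ArcRing s) (ArcRing.gr s)) : ℤ → AddSubgroup (Twist M) := M.gr

/-- The homomorphism `ψM → ψM'` that a homomorphism `M → M'` induces. -/
noncomputable def map {M M' : GrMod (ArcRing s) (ArcRing.gr s)} (f : M ⟶ M') : Twist M →ₗ[ℤ] Twist M' :=
  f.toLin.toAddMonoidHom.toIntLinearMap

theorem map_op_smul {M M' : GrMod (ArcRing s) (ArcRing.gr s)} (f : M ⟶ M') (h : ArcRing s)
    (m : Twist M) : map f (MulOpposite.op h • m) = MulOpposite.op h • map f m :=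
  f.toLin.map_smul _ m

theorem op_smul_mem (M : GrMod (ArcRing s) (ArcRing.gr s)) (i j : ℤ) (h : ArcRing s)
    (m : Twist M) (hh : h ∈ ArcRing.gr s i) (hm : m ∈ gr M j) :
    MulOpposite.op h • m ∈ gr M (i + j) :=
  M.smul_mem i j _ m (ArcMat.flip_mem hh) hm

/-- The graded abelian group `ψM ⊗ N`. -/
noncomputable def tensor (M N : GrMod (ArcRing s) (ArcRing.gr s)) : GrAb where
  carrier := BalancedTensor ℤ (ArcRing s) (Twist M) N.carrier
  gr := BalancedTensor.gr ℤ (ArcRing s) (gr M) N.gr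
  isInternal := BalancedTensor.isInternal_gr (R := ℤ) (X := Twist M) (gX := gr M) M.isInternal
    N.isInternal ArcRing.isInternal_gr (op_smul_mem M) N.smul_mem

/-- The homomorphism `f ⊗ g`. -/
noncomputable def tensorMap {M M' N N' : GrMod (ArcRing s) (ArcRing.gr s)} (f : M ⟶ M')
    (g : N ⟶ N') : tensor M N ⟶ tensor M' N' where
  toHom := (BalancedTensor.map (map f) (map_op_smul f) g.toLin).toAddMonoidHom
  map_mem _ _ hz := BalancedTensor.map_mem_gr (map f) (map_op_smul f) g.toLin (gX := gr M)
    (gX' := gr M') f.map_mem g.map_mem hz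

theorem tensorMap_id (M N : GrMod (ArcRing s) (ArcRing.gr s)) :
    tensorMap (𝟙 M) (𝟙 N) = 𝟙 (tensor M N) :=
  GrAb.hom_ext fun z => BalancedTensor.map_id_apply z

theorem tensorMap_comp {M M' M'' N N' N'' : GrMod (ArcRing s) (ArcRing.gr s)} (f : M ⟶ M')
    (f' : M' ⟶ M'') (g : N ⟶ N') (g' : N' ⟶ N'') :
    tensorMap (f ≫ f') (g ≫ g') = tensorMap f g ≫ tensorMap f' g' :=
  GrAb.hom_ext fun z => BalancedTensor.map_comp_apply (map f) (map_op_smul f) g.toLin (map f')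
    (map_op_smul f') g'.toLin z

end Twist

end Twist

namespace ArcCat

/-- The graded abelian group `ψM ⊗ N`, the direct sum over all weights `l` of the tensor products over
`H_l` of the components of `ψM` and `N` in `C(l)`. -/
noncomputable def pairingObj (M N : ArcCat n k) : GrAb :=
  GrAb.pi fun l => Twist.tensor (M l) (N l)

/-- The homomorphism `ψf ⊗ g`. -/
noncomputable def pairingMap {M M' N N' : ArcCat n k} (f : M ⟶ M') (g : N ⟶ N') :
    pairingObj M N ⟶ pairingObj M' N' :=
  GrAb.piMap fun l => Twist.tensorMap (f l) (g l)

theorem pairingMap_id (M N : ArcCat n k) : pairingMap (𝟙 M) (𝟙 N) = 𝟙 (pairingObj M N) :=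
  GrAb.hom_ext fun z => funext fun l =>
    congrArg (fun h => GrAb.Hom.toHom h (z l)) (Twist.tensorMap_id (M l) (N l))

theorem pairingMap_comp {M M' M'' N N' N'' : ArcCat n k} (f : M ⟶ M')
    (f' : M' ⟶ M'') (g : N ⟶ N') (g' : N' ⟶ N'') :
    pairingMap (f ≫ f') (g ≫ g') = pairingMap f g ≫ pairingMap f' g' :=
  GrAb.hom_ext fun z => funext fun l =>
    congrArg (fun h => GrAb.Hom.toHom h (z l)) (Twist.tensorMap_comp (f l) (f' l) (g l) (g' l))

/-- The bifunctor `(M, N) ↦ ψM ⊗ N` from `C × C` to graded abelian groups. -/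
noncomputable def pairing : ArcCat n k ⥤ ArcCat n k ⥤ GrAb where
  obj M :=
    { obj := fun N => pairingObj M N
      map := fun g => pairingMap (𝟙 M) g
      map_id := fun N => pairingMap_id M N
      map_comp := fun g g' => by rw [← pairingMap_comp, Category.comp_id] }
  map f :=
    { app := fun N => pairingMap f (𝟙 N)
      naturality := fun N N' g => by
        change pairingMap _ _ ≫ pairingMap _ _ = pairingMap _ _ ≫ pairingMap _ _
        simp only [← pairingMap_comp, Category.comp_id, Category.id_comp] }
  map_id M := by
    ext N : 2
    exact pairingMap_id M N
  map_comp f f' := by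
    ext N : 2
    exact (congrArg (pairingMap (f ≫ f')) (Category.comp_id (𝟙 N)).symm).trans
      (pairingMap_comp f f' (𝟙 N) (𝟙 N))

end ArcCat

end ArcCategory

end ArcAlg

/-! The pairing is twisted by `χ`, which is reflection in the line, so a bimodule acting on the
first factor can be moved to the second at the price of being replaced by its mirror image. Let `X`
be an `(H(t), H(s))`-bimodule, `Y` an `(H(s), H(t))`-bimodule, and `e : X → Y` an additive bijection
that turns the left action of `r` into the right action of `χ(r)` and vice versa (`Reflection`).
Then `(x ⊗ m) ⊗ n ↦ m ⊗ (e x ⊗ n)` is an isomorphism `ψ(X ⊗ M) ⊗ N ≅ ψM ⊗ (Y ⊗ N)`: on both sides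
the triple product is divided by the same two families of relations, one for `H(s)` and one for
`H(t)`. If `e` raises degrees by `c`, the right-hand side has to be shifted by `-c`. This is
`Reflection.adjIso`.

For a flat tangle `T` from `s` to `t` the map `e` is the entrywise reflection of `W(b)Ta` to `W(Ta)b
= W(a)W(T)b`. Reflection reverses products, so it exchanges the two actions, and it preserves the
degree of each entry. The bimodules are, however, shifted by half the number of their bottom
endpoints, and these are `s` on one side and `t` on the other; hence `c` is the number of arcs on
`t` minus the number on `s`. The tangle of the reversed move is the reflection of `T`: a cup becomes
a cap, and a tangle consisting of strands only is turned, up to isotopy, into its inverse.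

For a move from `x` to `y` that raises place `p` and lowers place `q`, the degree `c` is `1` for a
cup, `0` for strands and `-1` for a cap. The pairs `(x p, x q)` are `(0, 2)`, then `(0, 1)` or `(1,
2)`, then `(1, 1)`, so in all cases `c = x q - x p - 1`. The shift by `-c` is therefore the one by
`x p - x q`, which is `K_i` or its inverse, followed by `{1}`. This is
`ArcCat.nonempty_reflection_moveBimodule`.

It remains to sum over weights. A move determines its source and its target from each other, so the
two direct sums match along a partial bijection of weights, and the summands outside it vanish
(`GrAb.reindexIso`). The statement for `K_i` only says that a shift can be carried from one tensor
factor to the other. -/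

namespace ArcAlg

set_option linter.unusedSectionVars false

/-! ### Homomorphisms out of balanced tensor products. -/

namespace BalancedTensor

section Lift

variable {R S X M A : Type} [Ring R] [Ring S] [AddCommGroup X] [AddCommGroup M] [AddCommGroup A]
  [Module R X] [Module Sᵐᵒᵖ X] [SMulCommClass R Sᵐᵒᵖ X] [Module S M]

variable (R) in
/-- The homomorphism on `X ⊗ M` that a balanced biadditive map induces. -/
noncomputable def lift (f : X →+ M →+ A)
    (hf : ∀ (x : X) (s : S) (m : M), f (MulOpposite.op s • x) m = f x (s • m)) :
    BalancedTensor R S X M →+ A :=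
  QuotientAddGroup.lift (balancedRelations R S X M).toAddSubgroup
    (TensorProduct.liftAddHom f fun r x m => by simp) (by
      intro t ht
      -- The relations are an `R`-span, but the target is only an abelian group. A multiple `r • (x
      -- s ⊗ m - x ⊗ s m)` is the relation for `r • x` again, because the two actions on `X`
      -- commute.
      refine Submodule.closure_induction
        (p := fun t _ => TensorProduct.liftAddHom f (fun r x m => by simp) t = 0) ?_ ?_ ?_ ht
      · exact map_zero _
      · intro a b _ _ ha hb
        rw [map_add, ha, hb, add_zero]
      · rintro r _ ⟨x, s, m, rfl⟩
        rw [smul_sub, TensorProduct.smul_tmul', TensorProduct.smul_tmul', map_sub,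
          TensorProduct.liftAddHom_tmul, TensorProduct.liftAddHom_tmul,
          smul_comm r (MulOpposite.op s) x, hf, sub_self])

theorem addHom_ext {f g : BalancedTensor R S X M →+ A}
    (h : ∀ x m, f (tmul R S x m) = g (tmul R S x m)) : f = g := by
  ext z
  exact induction_on (p := fun z => f z = g z) z (by simp) h fun a b ha hb => by
    rw [map_add, map_add, ha, hb]

variable (R S X M) in
/-- The biadditive map `(x, m) ↦ x ⊗ m`. -/
noncomputable def tmulHom : X →+ M →+ BalancedTensor R S X M :=
  AddMonoidHom.mk' (fun x => AddMonoidHom.mk' (tmul R S x) (tmul_add x))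
    fun x x' => AddMonoidHom.ext (add_tmul x x')

/-- The graded pieces are generated by pure tensors of homogeneous elements, so degrees need to be
checked on these only. -/
theorem map_mem_of_tmul_mem {gX : ℤ → AddSubgroup X} {gM : ℤ → AddSubgroup M}
    {B : AddSubgroup A} {d : ℤ} (f : BalancedTensor R S X M →+ A)
    (h : ∀ i j x m, x ∈ gX i → m ∈ gM j → i + j = d → f (tmul R S x m) ∈ B)
    {z : BalancedTensor R S X M} (hz : z ∈ gr R S gX gM d) : f z ∈ B := by
  have : gr R S gX gM d ≤ B.comap f := by
    refine (AddSubgroup.closure_le _).2 ?_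
    rintro _ ⟨i, j, x, m, hx, hm, hd, rfl⟩
    exact h i j x m hx hm hd
  exact this hz

end Lift

end BalancedTensor

/-! ### Adjunction for bimodules that are mirror images of each other. -/

section Flip

variable {s t : Type} [LinearOrder s] [Fintype s] [LinearOrder t] [Fintype t]

/-- The anti-involution of `H(s)`, as a map from `H(s)` to itself. -/
noncomputable def ArcRing.flip (h : ArcRing s) : ArcRing s := ArcMat.flip h

theorem ArcRing.flip_flip (h : ArcRing s) : h.flip.flip = h := ArcMat.flip_flip h

/-- An isomorphism between a graded bimodule `X` and the bimodule `Y{-c}`, with the two actions on `Y`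
exchanged by means of the anti-involutions of the arc rings. -/
structure Reflection (X : GrBimod (ArcRing t) (ArcRing.gr t) (ArcRing s) (ArcRing.gr s))
    (Y : GrBimod (ArcRing s) (ArcRing.gr s) (ArcRing t) (ArcRing.gr t)) (c : ℤ) where
  toEquiv : X.carrier ≃+ Y.carrier
  map_smul : ∀ (r : ArcRing t) x, toEquiv (r • x) = MulOpposite.op r.flip • toEquiv x
  map_op_smul : ∀ (r : ArcRing s) x, toEquiv (MulOpposite.op r • x) = r.flip • toEquiv x
  map_mem : ∀ d, ∀ x ∈ X.gr d, toEquiv x ∈ Y.gr (d + c)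
  symm_mem : ∀ d, ∀ y ∈ Y.gr (d + c), toEquiv.symm y ∈ X.gr d

namespace Reflection

variable {X : GrBimod (ArcRing t) (ArcRing.gr t) (ArcRing s) (ArcRing.gr s)}
  {Y : GrBimod (ArcRing s) (ArcRing.gr s) (ArcRing t) (ArcRing.gr t)} {c : ℤ}

/-- The inverse of a reflection. -/
def symm (e : Reflection X Y c) : Reflection Y X (-c) where
  toEquiv := e.toEquiv.symm
  map_smul r y := by
    rw [AddEquiv.symm_apply_eq, e.map_op_smul, ArcRing.flip_flip, AddEquiv.apply_symm_apply]
  map_op_smul r y := by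
    rw [AddEquiv.symm_apply_eq, e.map_smul, ArcRing.flip_flip, AddEquiv.apply_symm_apply]
  map_mem d y hy := e.symm_mem _ _ (by rwa [neg_add_cancel_right])
  symm_mem d x hx := by simpa using e.map_mem _ _ hx

variable (e : Reflection X Y c)
  (M : GrMod (ArcRing s) (ArcRing.gr s)) (N : GrMod (ArcRing t) (ArcRing.gr t))

/-- The element `(x ⊗ m) ⊗ n` of `ψ(X ⊗ M) ⊗ N`. -/
noncomputable def tmulLeft (X : GrBimod (ArcRing t) (ArcRing.gr t) (ArcRing s) (ArcRing.gr s))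
    (M : GrMod (ArcRing s) (ArcRing.gr s)) (N : GrMod (ArcRing t) (ArcRing.gr t))
    (x : X.carrier) (m : M.carrier) (n : N.carrier) :
    BalancedTensor ℤ (ArcRing t) (Twist (X.tensor.obj M)) N.carrier :=
  BalancedTensor.tmul ℤ (ArcRing t) (X := Twist (X.tensor.obj M))
    (BalancedTensor.tmul (ArcRing t) (ArcRing s) x m) n

/-- The element `m ⊗ (y ⊗ n)` of `ψM ⊗ (Y ⊗ N)`. -/
noncomputable def tmulRight (Y : GrBimod (ArcRing s) (ArcRing.gr s) (ArcRing t) (ArcRing.gr t))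
    (M : GrMod (ArcRing s) (ArcRing.gr s)) (N : GrMod (ArcRing t) (ArcRing.gr t))
    (m : M.carrier) (y : Y.carrier) (n : N.carrier) :
    BalancedTensor ℤ (ArcRing s) (Twist M) (Y.tensor.obj N).carrier :=
  BalancedTensor.tmul ℤ (ArcRing s) (X := Twist M) (M := (Y.tensor.obj N).carrier) m
    (BalancedTensor.tmul (ArcRing s) (ArcRing t) y n)

/-- This is balancedness over `H(s)`: the right action of `r` on `ψM` is by definition the left
action of `r.flip` on `M`. -/
theorem tmulRight_smul (Y : GrBimod (ArcRing s) (ArcRing.gr s) (ArcRing t) (ArcRing.gr t))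
    (m : M.carrier) (r : ArcRing s) (y : Y.carrier) (n : N.carrier) :
    tmulRight Y M N m (r • y) n = tmulRight Y M N (r.flip • m) y n :=
  (BalancedTensor.op_smul_tmul (R := ℤ) (S := ArcRing s) (X := Twist M)
    (M := (Y.tensor.obj N).carrier) m r (BalancedTensor.tmul (ArcRing s) (ArcRing t) y n)).symm

/-- The corresponding consequence of balancedness over `H(t)`. Here the twisted module is `X ⊗ M`,
on which `H(t)` acts through `X`. -/
theorem tmulLeft_smul (X : GrBimod (ArcRing t) (ArcRing.gr t) (ArcRing s) (ArcRing.gr s))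
    (m : M.carrier) (r : ArcRing t) (x : X.carrier) (n : N.carrier) :
    tmulLeft X M N (r • x) m n = tmulLeft X M N x m (r.flip • n) := by
  have := BalancedTensor.op_smul_tmul (R := ℤ) (S := ArcRing t) (X := Twist (X.tensor.obj M))
    (BalancedTensor.tmul (ArcRing t) (ArcRing s) x m) r.flip n
  refine Eq.trans ?_ this
  change _ = tmulLeft X M N (r.flip.flip • x) m n
  -- The right action of `r.flip` on the twisted module is the left action of `r.flip.flip`, that is
  -- of `r`.
  rw [ArcRing.flip_flip]

/-- The trilinear map `(x, m, n) ↦ m ⊗ (e x ⊗ n)`, as a homomorphism on `X ⊗ M`. -/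
noncomputable def adjAux : BalancedTensor (ArcRing t) (ArcRing s) X.carrier M.carrier →+
    N.carrier →+ BalancedTensor ℤ (ArcRing s) (Twist M) (Y.tensor.obj N).carrier :=
  BalancedTensor.lift (ArcRing t)
    (AddMonoidHom.mk' (fun x => AddMonoidHom.mk' (fun m =>
      (BalancedTensor.tmulHom ℤ (ArcRing s) (Twist M) (Y.tensor.obj N).carrier m).comp
        (BalancedTensor.tmulHom (ArcRing s) (ArcRing t) Y.carrier N.carrier (e.toEquiv x)))
        (fun m m' => by
          refine AddMonoidHom.ext fun n => ?_
          exact BalancedTensor.add_tmul (R := ℤ) (S := ArcRing s) (X := Twist M) m m' _))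
      (fun x x' => by
        refine AddMonoidHom.ext fun m => AddMonoidHom.ext fun n => ?_
        change tmulRight Y M N m (e.toEquiv (x + x')) n = _
        rw [tmulRight, map_add, BalancedTensor.add_tmul]
        exact BalancedTensor.tmul_add (R := ℤ) (S := ArcRing s) (X := Twist M)
          (M := (Y.tensor.obj N).carrier) m _ _))
    -- Balancedness over `H(s)`: `e` turns `x r` into `r.flip • e x`, and on passing to `ψM` the
    -- factor `r.flip` is flipped once more, which leaves `r • m`.
    (fun x r m => by
      refine AddMonoidHom.ext fun n => ?_
      change tmulRight Y M N m (e.toEquiv (MulOpposite.op r • x)) n =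
        tmulRight Y M N (r • m) (e.toEquiv x) n
      rw [e.map_op_smul, tmulRight_smul, ArcRing.flip_flip])

theorem adjAux_tmul (x : X.carrier) (m : M.carrier) (n : N.carrier) :
    e.adjAux M N (BalancedTensor.tmul (ArcRing t) (ArcRing s) x m) n =
      tmulRight Y M N m (e.toEquiv x) n := rfl

/-- Balancedness over `H(t)`, which lets the map descend to the outer tensor product. The twisted
right action of `r` is the left action of `r.flip`; `e` makes it the right action of `r` on `Y`,
which passes over to `N`. -/
theorem adjAux_smul (r : ArcRing t)
    (z : BalancedTensor (ArcRing t) (ArcRing s) X.carrier M.carrier) (n : N.carrier) :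
    e.adjAux M N (r.flip • z) n = e.adjAux M N z (r • n) := by
  refine BalancedTensor.induction_on
    (p := fun z => e.adjAux M N (r.flip • z) n = e.adjAux M N z (r • n)) z ?_ ?_ ?_
  · rw [smul_zero, map_zero]; rfl
  · intro x m
    rw [BalancedTensor.smul_tmul', adjAux_tmul, adjAux_tmul, e.map_smul, ArcRing.flip_flip,
      tmulRight, tmulRight, BalancedTensor.op_smul_tmul]
  · intro a b ha hb
    rw [smul_add, map_add, map_add, AddMonoidHom.add_apply, AddMonoidHom.add_apply, ha, hb]

/-- The homomorphism `(x ⊗ m) ⊗ n ↦ m ⊗ (e x ⊗ n)`. -/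
noncomputable def adjHom : BalancedTensor ℤ (ArcRing t) (Twist (X.tensor.obj M)) N.carrier →+
    BalancedTensor ℤ (ArcRing s) (Twist M) (Y.tensor.obj N).carrier :=
  BalancedTensor.lift ℤ (X := Twist (X.tensor.obj M)) (e.adjAux M N)
    fun z r n => e.adjAux_smul M N r z n

/-- The bilinear map `(m, n) ↦ (x ⊗ m) ⊗ n`, where `x` is the preimage of `y`, as a homomorphism. -/
noncomputable def adjInvAux (m : M.carrier) :
    BalancedTensor (ArcRing s) (ArcRing t) Y.carrier N.carrier →+
      BalancedTensor ℤ (ArcRing t) (Twist (X.tensor.obj M)) N.carrier :=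
  BalancedTensor.lift (ArcRing s)
    (AddMonoidHom.mk' (fun y =>
      BalancedTensor.tmulHom ℤ (ArcRing t) (Twist (X.tensor.obj M)) N.carrier
        (BalancedTensor.tmul (ArcRing t) (ArcRing s) (e.toEquiv.symm y) m))
      (fun y y' => by
        refine AddMonoidHom.ext fun n => ?_
        change tmulLeft X M N (e.toEquiv.symm (y + y')) m n = _
        rw [tmulLeft, map_add, BalancedTensor.add_tmul]
        exact BalancedTensor.add_tmul (R := ℤ) (S := ArcRing t) (X := Twist (X.tensor.obj M)) _ _ n))
    (fun y r n => by
      change tmulLeft X M N (e.toEquiv.symm (MulOpposite.op r • y)) m n =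
        tmulLeft X M N (e.toEquiv.symm y) m (r • n)
      have h : e.toEquiv.symm (MulOpposite.op r • y) = r.flip • e.toEquiv.symm y :=
        e.symm.map_op_smul r y
      rw [h, tmulLeft_smul, ArcRing.flip_flip])

theorem adjInvAux_tmul (m : M.carrier) (y : Y.carrier) (n : N.carrier) :
    e.adjInvAux M N m (BalancedTensor.tmul (ArcRing s) (ArcRing t) y n) =
      tmulLeft X M N (e.toEquiv.symm y) m n := rfl

/-- Additivity in `m` is separate because the map was built by the universal property of `Y ⊗ N` for
one fixed `m` at a time. -/
theorem adjInvAux_add (m m' : M.carrier)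
    (z : BalancedTensor (ArcRing s) (ArcRing t) Y.carrier N.carrier) :
    e.adjInvAux M N (m + m') z = e.adjInvAux M N m z + e.adjInvAux M N m' z := by
  refine BalancedTensor.induction_on (p := fun z =>
    e.adjInvAux M N (m + m') z = e.adjInvAux M N m z + e.adjInvAux M N m' z) z ?_ ?_ ?_
  · simp
  · intro y n
    rw [adjInvAux_tmul, adjInvAux_tmul, adjInvAux_tmul, tmulLeft, BalancedTensor.tmul_add]
    exact BalancedTensor.add_tmul (R := ℤ) (S := ArcRing t) (X := Twist (X.tensor.obj M)) _ _ n
  · intro a b ha hb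
    rw [map_add, map_add, map_add, ha, hb]; abel

/-- Balancedness over `H(s)` for the inverse map: the inverse of `e` carries the left action on `Y`
back to the right action on `X`, which passes over to `M`. -/
theorem adjInvAux_smul (r : ArcRing s) (m : M.carrier)
    (z : BalancedTensor (ArcRing s) (ArcRing t) Y.carrier N.carrier) :
    e.adjInvAux M N (r.flip • m) z = e.adjInvAux M N m (r • z) := by
  refine BalancedTensor.induction_on (p := fun z =>
    e.adjInvAux M N (r.flip • m) z = e.adjInvAux M N m (r • z)) z ?_ ?_ ?_
  · rw [smul_zero, map_zero, map_zero]
  · intro y n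
    have h : e.toEquiv.symm (r • y) = MulOpposite.op r.flip • e.toEquiv.symm y :=
      e.symm.map_smul r y
    rw [BalancedTensor.smul_tmul', adjInvAux_tmul, adjInvAux_tmul, h, tmulLeft, tmulLeft,
      BalancedTensor.op_smul_tmul]
  · intro a b ha hb
    rw [smul_add, map_add, map_add, ha, hb]

/-- The homomorphism `m ⊗ (e x ⊗ n) ↦ (x ⊗ m) ⊗ n`. -/
noncomputable def adjInv : BalancedTensor ℤ (ArcRing s) (Twist M) (Y.tensor.obj N).carrier →+
    BalancedTensor ℤ (ArcRing t) (Twist (X.tensor.obj M)) N.carrier :=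
  BalancedTensor.lift ℤ (X := Twist M) (M := (Y.tensor.obj N).carrier)
    (AddMonoidHom.mk' (fun m => e.adjInvAux M N m)
      fun m m' => AddMonoidHom.ext (e.adjInvAux_add M N m m'))
    fun m r z => e.adjInvAux_smul M N r m z

theorem adjInv_tmul (m : M.carrier) (y : Y.carrier) (n : N.carrier) :
    e.adjInv M N (tmulRight Y M N m y n) = tmulLeft X M N (e.toEquiv.symm y) m n := rfl

theorem adjHom_tmul (x : X.carrier) (m : M.carrier) (n : N.carrier) :
    e.adjHom M N (tmulLeft X M N x m n) = tmulRight Y M N m (e.toEquiv x) n := rfl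

/-- The iterated tensor product is generated by pure triples, so identities between maps out of it
reduce to identities in `x`, `m` and `n`. -/
theorem addHom_ext_left {A : Type} [AddCommGroup A]
    {f g : BalancedTensor ℤ (ArcRing t) (Twist (X.tensor.obj M)) N.carrier →+ A}
    (h : ∀ x m n, f (tmulLeft X M N x m n) = g (tmulLeft X M N x m n)) : f = g := by
  refine BalancedTensor.addHom_ext fun z n => ?_
  -- With `n` fixed, both sides are additive maps on a group that is by definition `X ⊗ M`;
  -- extensionality is applied a second time, now to the inner tensor product.
  have : (f.comp ((BalancedTensor.tmulHom ℤ (ArcRing t) (Twist (X.tensor.obj M)) N.carrier).flip n) :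
      Twist (X.tensor.obj M) →+ A) =
      g.comp ((BalancedTensor.tmulHom ℤ (ArcRing t) (Twist (X.tensor.obj M)) N.carrier).flip n) :=
    BalancedTensor.addHom_ext (R := ArcRing t) (S := ArcRing s) (X := X.carrier) (M := M.carrier)
      fun x m => h x m n
  exact DFunLike.congr_fun this z

theorem addHom_ext_right {A : Type} [AddCommGroup A]
    {f g : BalancedTensor ℤ (ArcRing s) (Twist M) (Y.tensor.obj N).carrier →+ A}
    (h : ∀ m y n, f (tmulRight Y M N m y n) = g (tmulRight Y M N m y n)) : f = g := by
  refine BalancedTensor.addHom_ext fun m z => ?_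
  have : (f.comp (BalancedTensor.tmulHom ℤ (ArcRing s) (Twist M) (Y.tensor.obj N).carrier m) :
      (Y.tensor.obj N).carrier →+ A) =
      g.comp (BalancedTensor.tmulHom ℤ (ArcRing s) (Twist M) (Y.tensor.obj N).carrier m) :=
    BalancedTensor.addHom_ext (R := ArcRing s) (S := ArcRing t) (X := Y.carrier) (M := N.carrier)
      fun y n => h m y n
  exact DFunLike.congr_fun this z

theorem adjInv_adjHom : (e.adjInv M N).comp (e.adjHom M N) = AddMonoidHom.id _ :=
  addHom_ext_left M N fun x m n => by
    rw [AddMonoidHom.comp_apply, adjHom_tmul, adjInv_tmul, AddEquiv.symm_apply_apply]; rfl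

theorem adjHom_adjInv : (e.adjHom M N).comp (e.adjInv M N) = AddMonoidHom.id _ :=
  addHom_ext_right M N fun m y n => by
    rw [AddMonoidHom.comp_apply, adjInv_tmul, adjHom_tmul, AddEquiv.apply_symm_apply]; rfl

/-- The map `e` raises degrees by `c`, and the two shifts on the right undo this. There are two of
them because the shift by the weight and the shift `{1}` are separate functors in the application.
-/
theorem adjHom_mem {c₁ c₂ : ℤ} (hc : c + c₁ + c₂ = 0) {d : ℤ}
    {z : BalancedTensor ℤ (ArcRing t) (Twist (X.tensor.obj M)) N.carrier}
    (hz : z ∈ (Twist.tensor (X.tensor.obj M) N).gr d) :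
    e.adjHom M N z ∈
      (Twist.tensor M ((GrMod.shift c₂).obj ((GrMod.shift c₁).obj (Y.tensor.obj N)))).gr d := by
  refine BalancedTensor.map_mem_of_tmul_mem (e.adjHom M N) ?_ hz
  intro i j w n hw hn hd
  -- The element `w` is homogeneous in `X ⊗ M` but not necessarily a pure tensor, so the reduction
  -- to generators is repeated with `n` fixed.
  have := BalancedTensor.map_mem_of_tmul_mem
    (B := (Twist.tensor M ((GrMod.shift c₂).obj ((GrMod.shift c₁).obj (Y.tensor.obj N)))).gr d)
    ((AddMonoidHom.eval n).comp (e.adjAux M N)) ?_ hw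
  · exact this
  intro a b x m hx hm hab
  -- In `Y ⊗ N` the element `e x ⊗ n` has degree `a + c + j`; after the shifts by `c₁` and `c₂` its
  -- degree is `a + j`.
  refine BalancedTensor.tmul_mem_gr (R := ℤ) (S := ArcRing s) (X := Twist M)
    (M := (Y.tensor.obj N).carrier) (i := b) (j := a + j) hm ?_ (by omega)
  exact BalancedTensor.tmul_mem_gr (e.map_mem a x hx) hn (by omega)

theorem adjInv_mem {c₁ c₂ : ℤ} (hc : c + c₁ + c₂ = 0) {d : ℤ}
    {z : BalancedTensor ℤ (ArcRing s) (Twist M) (Y.tensor.obj N).carrier}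
    (hz : z ∈
      (Twist.tensor M ((GrMod.shift c₂).obj ((GrMod.shift c₁).obj (Y.tensor.obj N)))).gr d) :
    e.adjInv M N z ∈ (Twist.tensor (X.tensor.obj M) N).gr d := by
  refine BalancedTensor.map_mem_of_tmul_mem (X := Twist M) (M := (Y.tensor.obj N).carrier)
    (e.adjInv M N) ?_ hz
  intro i j m w hm hw hd
  have := BalancedTensor.map_mem_of_tmul_mem
    (B := (Twist.tensor (X.tensor.obj M) N).gr d) (e.adjInvAux M N m) ?_ hw
  · exact this
  intro a b y n hy hn hab
  -- The preimage of `y` has degree `a - c`, while the two shifts give `a + b = j - c₂ - c₁`; so the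
  -- total degree is `i + j`.
  refine BalancedTensor.tmul_mem_gr (R := ℤ) (S := ArcRing t) (X := Twist (X.tensor.obj M))
    (M := N.carrier) (i := a - c + i) (j := b) ?_ hn (by omega)
  exact BalancedTensor.tmul_mem_gr (e.symm_mem (a - c) y (by rwa [sub_add_cancel])) hm rfl

/-- The isomorphism `ψ(X ⊗ M) ⊗ N ≅ ψM ⊗ (Y ⊗ N){-c}`. -/
noncomputable def adjIso {c₁ c₂ : ℤ} (hc : c + c₁ + c₂ = 0) :
    Twist.tensor (X.tensor.obj M) N ≅
      Twist.tensor M ((GrMod.shift c₂).obj ((GrMod.shift c₁).obj (Y.tensor.obj N))) where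
  hom := ⟨e.adjHom M N, fun _ _ hz => e.adjHom_mem M N hc hz⟩
  inv := ⟨e.adjInv M N, fun _ _ hz => e.adjInv_mem M N hc hz⟩
  hom_inv_id := GrAb.hom_ext fun z => DFunLike.congr_fun (e.adjInv_adjHom M N) z
  inv_hom_id := GrAb.hom_ext fun z => DFunLike.congr_fun (e.adjHom_adjInv M N) z

/-- On a pure triple both composites give `f m ⊗ (e x ⊗ g n)`, since neither `f` nor `g` touches the
bimodule. -/
theorem adjIso_naturality {c₁ c₂ : ℤ} (hc : c + c₁ + c₂ = 0)
    {M M' : GrMod (ArcRing s) (ArcRing.gr s)} {N N' : GrMod (ArcRing t) (ArcRing.gr t)}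
    (f : M ⟶ M') (g : N ⟶ N') :
    Twist.tensorMap (X.tensor.map f) g ≫ (e.adjIso M' N' hc).hom =
      (e.adjIso M N hc).hom ≫ Twist.tensorMap f
        ((GrMod.shift c₂).map ((GrMod.shift c₁).map (Y.tensor.map g))) := by
  have : (e.adjHom M' N').comp (Twist.tensorMap (X.tensor.map f) g).toHom =
      (Twist.tensorMap f ((GrMod.shift c₂).map ((GrMod.shift c₁).map
        (Y.tensor.map g)))).toHom.comp (e.adjHom M N) :=
    addHom_ext_left M N fun x m n => rfl
  exact GrAb.hom_ext fun z => DFunLike.congr_fun this z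

end Reflection

end Flip

/-! ### Reflections of the bimodules of flat tangles. -/

section TangleReflections

variable {s t : Type} [LinearOrder s] [Fintype s] [LinearOrder t] [Fintype t]
variable {I J : Type}

/-- Reflection keeps the polynomial that represents an entry and only transposes the matrix, while
inserting circles renames the variables; the two operations do not interact. -/
theorem ArcMat.flip_addCups (T : CupDiagram s t) {f : I → Matching s} {g : J → Matching s}
    (x : ArcMat f g) : (x.addCups T).flip = x.flip.addCups T := by
  ext j i
  obtain ⟨p, hp⟩ := Ideal.Quotient.mk_surjective (x i j)
  simp only [flip, addCups, ← hp]
  rfl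

namespace CupDiagram

variable (T : CupDiagram s t)

/-- The reflection of a tangle with cups is a tangle with caps. -/
noncomputable def reflection : Reflection T.cupBimodule T.capBimodule
    (Fintype.card (OddPoint t) - Fintype.card (OddPoint s)) where
  toEquiv :=
    { toFun := fun x => ArcMat.flip x
      invFun := fun x => ArcMat.flip x
      left_inv := ArcMat.flip_flip
      right_inv := ArcMat.flip_flip
      map_add' := ArcMat.flip_add }
  map_smul r x := ArcMat.flip_mul r x
  -- On the cup side `H(s)` acts through inserted circles from the right, on the cap side through
  -- inserted circles from the left. Reversing the product therefore gives the action of `r.flip`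
  -- once reflection has been moved past the insertion.
  map_op_smul r x := (ArcMat.flip_mul x (ArcMat.addCups T r)).trans
    (congrArg (fun y => ArcMat.mul y _) (ArcMat.flip_addCups T r))
  -- Reflection preserves the unshifted degree. The cup bimodule is shifted by the number of arcs on
  -- `s` and the cap bimodule by the number on `t`; their difference is the degree of the
  -- reflection.
  map_mem d x hx := by
    change ArcMat.flip x ∈ ArcMat.gr _ _ (d + _ - _)
    have := ArcMat.flip_mem (d := d - Fintype.card (OddPoint s)) hx
    convert this using 1
    ring_nf
  symm_mem d x hx := by
    change ArcMat.flip x ∈ ArcMat.gr _ _ (d - _)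
    have := ArcMat.flip_mem
      (d := d + (Fintype.card (OddPoint t) - Fintype.card (OddPoint s)) - Fintype.card (OddPoint t))
      hx
    convert this using 1
    ring_nf

variable {T}

/-- Two tangles without cups are inverse to each other. -/
structure IsInverse (T : CupDiagram s t) (T' : CupDiagram t s) : Prop where
  left : ∀ x, T'.strand (T.strand x) = x
  right : ∀ y, T.strand (T'.strand y) = y

namespace IsInverse

variable {T' : CupDiagram t s}

theorem symm (h : IsInverse T T') : IsInverse T' T := ⟨h.right, h.left⟩

theorem oddStrand_oddStrand (h : IsInverse T T') (o : OddPoint s) :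
    T'.oddStrand (T.oddStrand o) = o := Subtype.ext (h.left o.1)

/-- Strands inject odd points into odd points, and here they do so in both directions. -/
theorem card_oddPoint (_ : IsInverse T T') :
    Fintype.card (OddPoint s) = Fintype.card (OddPoint t) :=
  le_antisymm (Fintype.card_le_of_injective _ T.oddStrand.injective)
    (Fintype.card_le_of_injective _ T'.oddStrand.injective)

theorem comp_apply (h : IsInverse T T') (a : Matching s) (y : t) :
    T.comp a y = T.strand (a (T'.strand y)) := by
  rw [← T.comp_strand, h.right]

/-- This and the next lemma express planar isotopy: pulling the strands straight from one side of
the line to the other does not change the closed manifold, it only relabels the marks along the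
strands. -/
theorem loop_comp_right (h : IsInverse T T') (b : Matching t) (a : Matching s) (o : OddPoint t) :
    loop (T'.comp b) a (T'.oddStrand o) = T'.oddStrand (loop b (T.comp a) o) := by
  apply Subtype.ext
  change T'.comp b (a (T'.strand o.1)) = T'.strand (b (T.comp a o.1))
  rw [h.comp_apply, ← T'.comp_strand, h.left]

theorem loop_comp_left (h : IsInverse T T') (b : Matching t) (a : Matching s) (o : OddPoint t) :
    loop a (T'.comp b) (T'.oddStrand o) = T'.oddStrand (loop (T.comp a) b o) := by
  apply Subtype.ext
  change a (T'.comp b (T'.strand o.1)) = T'.strand (T.comp a (b o.1))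
  rw [h.comp_apply, T'.comp_strand, h.left]

end IsInverse

end CupDiagram

/-- On representatives both maps rename variables. It makes the relabellings along inverse tangles
inverse isomorphisms. -/
theorem addMarks_addMarks {Ω Ω' : Type} [Finite Ω] [Finite Ω'] {u' : Equiv.Perm Ω'}
    {u : Equiv.Perm Ω} {e : Ω' → Ω} {e' : Ω → Ω'} (h : ∀ o, u (e o) = e (u' o))
    (h' : ∀ o, u' (e' o) = e' (u o)) (he : ∀ o, e' (e o) = o) (x : Circ u') :
    addMarks e' h' (addMarks e h x) = x := by
  obtain ⟨p, rfl⟩ := Ideal.Quotient.mk_surjective x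
  rw [addMarks_mk, addMarks_mk, MvPolynomial.rename_rename]
  have : e' ∘ e = id := funext he
  rw [this, MvPolynomial.rename_id_apply]

namespace CupDiagram.IsInverse

variable {T : CupDiagram s t} {T' : CupDiagram t s}

/-- The isomorphism `F(W(T a) b) → F(W(a) T' b)` for inverse tangles `T` and `T'`. -/
noncomputable def straighten (h : IsInverse T T') (x : T.CapMat) : T'.CupMat :=
  fun a b => addMarks T'.oddStrand (h.loop_comp_left b a) (x a b)

/-- The inverse isomorphism `F(W(a) T' b) → F(W(T a) b)`. -/
noncomputable def unstraighten (h : IsInverse T T') (x : T'.CupMat) : T.CapMat :=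
  fun a b => addMarks T.oddStrand (h.symm.loop_comp_right a b) (x a b)

theorem straighten_unstraighten (h : IsInverse T T') (x : T'.CupMat) :
    h.straighten (h.unstraighten x) = x :=
  funext fun _ => funext fun _ => addMarks_addMarks _ _ h.oddStrand_oddStrand _

theorem unstraighten_straighten (h : IsInverse T T') (x : T.CapMat) :
    h.unstraighten (h.straighten x) = x :=
  funext fun _ => funext fun _ => addMarks_addMarks _ _ h.symm.oddStrand_oddStrand _

theorem straighten_add (h : IsInverse T T') (x y : T.CapMat) :
    h.straighten (x + y) = h.straighten x + h.straighten y :=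
  funext fun _ => funext fun _ => map_add (addMarks _ _) _ _

/-- No mark is left over when there are no cups, so the conditions that `addMarks_contract` and
`addMarks_mem` impose on additional circles are vacuous. -/
theorem exists_oddStrand (h : IsInverse T T') (o : OddPoint s) : ∃ o', T'.oddStrand o' = o :=
  ⟨T.oddStrand o, h.oddStrand_oddStrand o⟩

/-- Relabelling commutes with contractions. In the cap bimodule `r` acts after being relabelled
along `T`, so straightening relabels it along `T` and then along `T'`, which restores `r`. -/
theorem straighten_smul (h : IsInverse T T') (r : ArcRing s) (x : T.CapMat) :
    h.straighten (r • x) = r • h.straighten x := by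
  funext a b
  change addMarks _ _ (∑ j, contract _ _ _) = ∑ j, contract _ _ _
  rw [map_sum]
  refine Finset.sum_congr rfl fun j _ => ?_
  refine (addMarks_contract T'.oddStrand _ (loop_mul a j (T'.comp b)) (fun o => ?_)
    (h.loop_comp_left b j) (h.loop_comp_left b a)
    (fun o ho => absurd (h.exists_oddStrand o) ho) _ _).trans ?_
  -- The ring element lies in the entry for `W(Ta)(Tj)`; relabelled along `T'`, this manifold
  -- becomes `W(a)j`.
  · apply Subtype.ext
    change a (j (T'.strand o.1)) = T'.strand (T.comp a (T.comp j o.1))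
    rw [h.comp_apply, h.comp_apply, h.left, h.left]
  · exact congrArg (fun y => contract _ y _)
      (addMarks_addMarks _ _ h.oddStrand_oddStrand _)

/-- Here `r` acts unchanged on the cap side, and the relabelling along `T'` that straightening
applies to it is exactly the one in the right action on the bimodule of `T'`. -/
theorem straighten_op_smul (h : IsInverse T T') (r : ArcRing t) (x : T.CapMat) :
    h.straighten (MulOpposite.op r • x) = MulOpposite.op r • h.straighten x := by
  funext a b
  change addMarks _ _ (∑ j, contract _ _ _) = ∑ j, contract _ _ _
  rw [map_sum]
  refine Finset.sum_congr rfl fun j _ => ?_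
  exact addMarks_contract T'.oddStrand _ _ _ _ _
    (fun o ho => absurd (h.exists_oddStrand o) ho) _ _

/-- Relabelling lowers degrees by the number of circles it adds, which is the difference of the
numbers of odd points and hence zero. -/
theorem straighten_mem (h : IsInverse T T') {d : ℤ} {x : T.CapMat}
    (hx : x ∈ ArcMat.gr T.comp (fun b : Matching t => b) d) :
    h.straighten x ∈ ArcMat.gr (fun b : Matching s => b) T'.comp d := by
  intro a b
  have := addMarks_mem T'.oddStrand (h.loop_comp_left b a)
    (fun o ho => absurd (h.exists_oddStrand o) ho) (hx a b)
  rwa [h.card_oddPoint, sub_self, sub_zero] at this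

theorem unstraighten_mem (h : IsInverse T T') {d : ℤ} {x : T'.CupMat}
    (hx : x ∈ ArcMat.gr (fun b : Matching s => b) T'.comp d) :
    h.unstraighten x ∈ ArcMat.gr T.comp (fun b : Matching t => b) d := by
  intro a b
  have := addMarks_mem T.oddStrand (h.symm.loop_comp_right a b)
    (fun o ho => absurd (h.symm.exists_oddStrand o) ho) (hx a b)
  rwa [h.card_oddPoint, sub_self, sub_zero] at this

/-- The reflection of a tangle without cups is isotopic to the inverse tangle. -/
noncomputable def reflection (h : IsInverse T T') :
    Reflection T.cupBimodule T'.cupBimodule 0 where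
  -- Reflecting `T` gives its cap bimodule, which straightening then identifies with the cup
  -- bimodule of the inverse tangle.
  toEquiv := T.reflection.toEquiv.trans
    { toFun := h.straighten
      invFun := h.unstraighten
      left_inv := h.unstraighten_straighten
      right_inv := h.straighten_unstraighten
      map_add' := h.straighten_add }
  map_smul r x := (congrArg h.straighten (T.reflection.map_smul r x)).trans
    (h.straighten_op_smul _ _)
  map_op_smul r x := (congrArg h.straighten (T.reflection.map_op_smul r x)).trans
    (h.straighten_smul _ _)
  map_mem d x hx := by
    have := h.straighten_mem (T.reflection.map_mem d x hx)
    -- Both `T.capBimodule` and `T'.cupBimodule` have bottom endpoints `t` and carry the same shift,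
    -- so only the degree of the first reflection has to be seen to vanish.
    have hd : d + ((Fintype.card (OddPoint t) : ℤ) - Fintype.card (OddPoint s)) -
        Fintype.card (OddPoint t) = d + 0 - Fintype.card (OddPoint t) := by
      rw [h.card_oddPoint, sub_self]
    rw [hd] at this
    exact this
  symm_mem d y hy := by
    refine T.reflection.symm_mem d _ ?_
    have := h.unstraighten_mem hy
    have hd : d + 0 - Fintype.card (OddPoint t) = d +
        ((Fintype.card (OddPoint t) : ℤ) - Fintype.card (OddPoint s)) -
        Fintype.card (OddPoint t) := by
      rw [h.card_oddPoint, sub_self]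
    rw [hd] at this
    exact this

end CupDiagram.IsInverse

end TangleReflections

/-! ### Counting points in odd position. -/

section OddPoints

variable {s t : Type} [LinearOrder s] [Fintype s] [LinearOrder t] [Fintype t]

/-- Exactly one more point, namely `x`, lies to the left of `y` than to the left of `x`. -/
theorem isOdd_of_covBy {x y : s} (h : x ⋖ y) : IsOdd y ↔ ¬ IsOdd x := by
  have e : (Finset.univ.filter fun z => z < y) = insert x (Finset.univ.filter fun z => z < x) := by
    ext z
    simp only [Finset.mem_filter, Finset.mem_univ, true_and, Finset.mem_insert]
    rw [h.lt_iff_le_left, le_iff_eq_or_lt]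
  rw [IsOdd, IsOdd, e, Finset.card_insert_of_notMem (by simp), Nat.even_add_one]

/-- Strands preserve parity, and of the two neighbouring points not on a strand exactly one is odd.
So one cup adds one odd point, that is one arc. -/
theorem CupDiagram.card_oddPoint_of_one_cup (T : CupDiagram s t) {p q : t} (hpq : p ⋖ q)
    (hp : p ∉ Set.range T.strand) (hq : q ∉ Set.range T.strand)
    (h : ∀ r, r ∉ Set.range T.strand → r = p ∨ r = q) :
    Fintype.card (OddPoint t) = Fintype.card (OddPoint s) + 1 := by
  have ho := isOdd_of_covBy hpq
  -- The point `o` is the odd end of the cup; below, `none` is sent to it and the old odd points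
  -- follow their strands.
  obtain ⟨o, ho1, ho2⟩ : ∃ o : OddPoint t, o.1 ∉ Set.range T.strand ∧
      ∀ o' : OddPoint t, o'.1 ∉ Set.range T.strand → o' = o := by
    by_cases hpo : IsOdd p
    · refine ⟨⟨p, hpo⟩, hp, fun o' h' => Subtype.ext ((h _ h').resolve_right ?_)⟩
      intro hh
      exact ho.1 (hh ▸ o'.2) hpo
    · refine ⟨⟨q, ho.2 hpo⟩, hq, fun o' h' => Subtype.ext ((h _ h').resolve_left ?_)⟩
      intro hh
      exact hpo (hh ▸ o'.2)
  rw [← Fintype.card_option]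
  refine (Fintype.card_of_bijective (f := fun x : Option (OddPoint s) => x.elim o T.oddStrand)
    ⟨?_, ?_⟩).symm
  · rintro (_ | x) (_ | y) hxy
    · rfl
    · exact absurd ⟨y.1, congrArg Subtype.val hxy.symm⟩ ho1
    · exact absurd ⟨x.1, congrArg Subtype.val hxy⟩ ho1
    · exact congrArg some (T.oddStrand.injective hxy)
  · intro y
    by_cases hy : y.1 ∈ Set.range T.strand
    · obtain ⟨x, hx⟩ := hy
      exact ⟨some ⟨x, (T.isOdd_strand x).1 (hx ▸ y.2)⟩, Subtype.ext hx⟩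
    · exact ⟨none, (ho2 y hy).symm⟩

end OddPoints

/-! ### Combinatorics of moves between weights. -/

namespace Weight.IsMove

variable {n k : ℕ} {p q : Fin n} {x y : Weight n k}

/-- The strands of a move and of its reversal are both given by the transposition of `p` and `q`.
The two conditions exclude the cap and the cup. -/
theorem isInverse (h : IsMove p q x y) (hc : ¬ (x p = 1 ∧ x q = 1)) (hc' : ¬ (y q = 1 ∧ y p = 1)) :
    (h.tangle hc).IsInverse (h.symm.tangle hc') where
  left j := Subtype.ext (by
    change Equiv.swap q p (Equiv.swap p q j.1) = j.1
    rw [Equiv.swap_comm q p, Equiv.swap_apply_self])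
  right j := Subtype.ext (by
    change Equiv.swap p q (Equiv.swap q p j.1) = j.1
    rw [Equiv.swap_comm q p, Equiv.swap_apply_self])

/-- A move requires `x p ≤ 1 ≤ x q`. Without the cap `(1, 1)` and the cup `(0, 2)` there remain `(0,
1)` and `(1, 2)`. -/
theorem coeff_of_not_cap (h : IsMove p q x y) (hc : ¬ (x p = 1 ∧ x q = 1))
    (hc' : ¬ (y q = 1 ∧ y p = 1)) : x q = x p + 1 := by
  have h1 := h.at_target
  have h2 := h.at_source
  have h3 := y.le_two p
  have h4 := x.le_two q
  omega

theorem card_oddPoint_of_cup (h : IsMove p q x y) (hc : ¬ (x p = 1 ∧ x q = 1)) (hp : y p = 1)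
    (hq : y q = 1) : Fintype.card (OddPoint y.Pt) = Fintype.card (OddPoint x.Pt) + 1 := by
  have h1 := h.at_target
  have h2 := h.at_source
  -- A strand ending in `p` would start in `q`; but `x q = y q + 1 = 2`, so `q` is not an endpoint.
  -- Similarly a strand ending in `q` would start in `p`, where `x p = 0`.
  have hp' : (⟨p, hp⟩ : y.Pt) ∉ Set.range (h.tangle hc).strand := by
    rintro ⟨j, hj⟩
    have e : Equiv.swap p q j.1 = p := congrArg Subtype.val hj
    have e' : j.1 = q := by rw [← Equiv.swap_apply_self p q j.1, e, Equiv.swap_apply_left]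
    have := j.2
    rw [e'] at this
    omega
  have hq' : (⟨q, hq⟩ : y.Pt) ∉ Set.range (h.tangle hc).strand := by
    rintro ⟨j, hj⟩
    have e : Equiv.swap p q j.1 = q := congrArg Subtype.val hj
    have e' : j.1 = p := by rw [← Equiv.swap_apply_self p q j.1, e, Equiv.swap_apply_right]
    have := j.2
    rw [e'] at this
    omega
  have hr : ∀ r, r ∉ Set.range (h.tangle hc).strand →
      r = (⟨p, hp⟩ : y.Pt) ∨ r = (⟨q, hq⟩ : y.Pt) := fun r hr =>
    (h.notMem_strand hc hr).2.2.1.imp (fun e => Subtype.ext e) (fun e => Subtype.ext e)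
  have hcov : ∀ {a b : y.Pt}, a.1.1 + 1 = b.1.1 → a ⋖ b := by
    intro a b hab
    refine ⟨?_, ?_⟩
    · change a.1.1 < b.1.1
      omega
    · intro c hac hcb
      have h1 : a.1.1 < c.1.1 := hac
      have h2 : c.1.1 < b.1.1 := hcb
      omega
  -- Both orders occur: `p` is to the left of `q` for `E_i` and to the right of it for `F_i`.
  rcases h.adj with ha | ha
  · exact (h.tangle hc).card_oddPoint_of_one_cup (hcov ha) hp' hq' hr
  · exact (h.tangle hc).card_oddPoint_of_one_cup (hcov ha) hq' hp' fun r h' => (hr r h').symm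

/-- With `source_unique` this says that moves form a partial injection on weights, which is what
matches the summands of the two pairings. -/
theorem target_unique {x y y' : Weight n k}
    (h : IsMove p q x y) (h' : IsMove p q x y') : y = y' := by
  refine Weight.ext fun j => ?_
  by_cases hp : j = p
  · rw [hp, h.at_target, h'.at_target]
  by_cases hq : j = q
  · have h1 := h.at_source
    have h2 := h'.at_source
    rw [hq]
    omega
  rw [h.elsewhere j hp hq, h'.elsewhere j hp hq]

theorem source_unique {x x' y : Weight n k}
    (h : IsMove p q x y) (h' : IsMove p q x' y) : x = x' :=
  h.symm.target_unique h'.symm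

end Weight.IsMove

/-! ### Reflection of the bimodule of a move. -/

/-- A reflection of degree `c` is one of degree `c'` if `c = c'`. -/
def Reflection.cast {s t : Type} [LinearOrder s] [Fintype s] [LinearOrder t] [Fintype t]
    {X : GrBimod (ArcRing t) (ArcRing.gr t) (ArcRing s) (ArcRing.gr s)}
    {Y : GrBimod (ArcRing s) (ArcRing.gr s) (ArcRing t) (ArcRing.gr t)} {c c' : ℤ}
    (e : Reflection X Y c) (h : c = c') : Reflection X Y c' := h ▸ e

/-- Reversing a move reflects its tangle: a cap becomes a cup (degree `-1`), a cup becomes a cap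
(degree `1`), and strands become the inverse strands (degree `0`). In each case the degree agrees
with `x q - x p - 1`. Only existence is asserted, so that the case distinctions in `moveBimodule`
can be rewritten inside a proposition. -/
theorem ArcCat.nonempty_reflection_moveBimodule {n k : ℕ} {p q : Fin n} {x y : Weight n k}
    (h : Weight.IsMove p q x y) :
    Nonempty (Reflection (moveBimodule h) (moveBimodule h.symm) ((x q : ℤ) - x p - 1)) := by
  have h1 := h.at_target
  have h2 := h.at_source
  by_cases hc : x p = 1 ∧ x q = 1
  · have hc' : ¬ (y q = 1 ∧ y p = 1) := by omega
    rw [moveBimodule, moveBimodule, dif_pos hc, dif_neg hc']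
    have e := h.symm.card_oddPoint_of_cup hc' hc.2 hc.1
    exact ⟨(h.symm.tangle hc').reflection.symm.cast (by omega)⟩
  · by_cases hc' : y q = 1 ∧ y p = 1
    · rw [moveBimodule, moveBimodule, dif_neg hc, dif_pos hc']
      have e := h.card_oddPoint_of_cup hc hc'.2 hc'.1
      have := x.le_two q
      exact ⟨(h.tangle hc).reflection.cast (by omega)⟩
    · rw [moveBimodule, moveBimodule, dif_neg hc, dif_neg hc']
      have := h.coeff_of_not_cap hc hc'
      exact ⟨(h.isInverse hc hc').reflection.cast (by omega)⟩

/-! ### Direct sums reindexed along a partial bijection. -/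

namespace GrAb

variable {W : Type} [Finite W] {P Q P' Q' : W → GrAb} {r : W → W → Prop}

open Classical in
/-- The homomorphism of direct sums whose components follow a partial injection `r`. -/
noncomputable def reindexHom (θ : ∀ x y, r x y → (P y ⟶ Q x)) : pi P ⟶ pi Q where
  toHom := AddMonoidHom.mk'
    (fun z x => if h : ∃ y, r x y then (θ x h.choose h.choose_spec).toHom (z h.choose) else 0)
    fun a b => funext fun x => by
      change (if h : ∃ y, r x y then (θ x _ h.choose_spec).toHom (a h.choose + b h.choose) else 0) =
        (if h : ∃ y, r x y then (θ x _ h.choose_spec).toHom (a h.choose) else 0) +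
        (if h : ∃ y, r x y then (θ x _ h.choose_spec).toHom (b h.choose) else 0)
      split_ifs
      · rw [map_add]
      · rw [add_zero]
  map_mem d z hz x hx := by
    change (if h : ∃ y, r x y then (θ x _ h.choose_spec).toHom (z h.choose) else 0) ∈ _
    split_ifs with h
    · exact (θ x _ h.choose_spec).map_mem d _ (hz _ trivial)
    · exact AddSubgroup.zero_mem _

/-- Since `y` is determined by `x`, the index picked by choice in the definition is the given one.
-/
theorem reindexHom_apply (θ : ∀ x y, r x y → (P y ⟶ Q x))
    (hr : ∀ x y y', r x y → r x y' → y = y') {x y : W} (h : r x y) (z : (pi P).carrier) :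
    (reindexHom θ).toHom z x = (θ x y h).toHom (z y) := by
  have hex : ∃ y, r x y := ⟨y, h⟩
  -- The groups depend on the index, so the chosen index is generalized to a variable before it is
  -- replaced by `y`.
  have key : ∀ y' (h' : r x y'), (θ x y' h').toHom (z y') = (θ x y h).toHom (z y) := by
    intro y' h'
    obtain rfl := hr x y y' h h'
    rfl
  exact (dif_pos hex).trans (key _ hex.choose_spec)

/-- Direct sums whose nonzero summands are isomorphic under a partial bijection `r` are
isomorphic. -/
noncomputable def reindexIso (θ : ∀ x y, r x y → (P y ≅ Q x))
    (hr : ∀ x y y', r x y → r x y' → y = y') (hr' : ∀ x x' y, r x y → r x' y → x = x')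
    (hP : ∀ y, (¬ ∃ x, r x y) → Subsingleton (P y).carrier)
    (hQ : ∀ x, (¬ ∃ y, r x y) → Subsingleton (Q x).carrier) : pi P ≅ pi Q where
  hom := reindexHom fun x y h => (θ x y h).hom
  inv := reindexHom (r := fun y x => r x y) fun y x h => (θ x y h).inv
  hom_inv_id := GrAb.hom_ext fun z => funext fun y => by
    by_cases hy : ∃ x, r x y
    · obtain ⟨x, h⟩ := hy
      rw [comp_toHom, reindexHom_apply _ (fun y x x' => hr' x x' y) h, reindexHom_apply _ hr h]
      exact congrArg (fun f => Hom.toHom f (z y)) (θ x y h).hom_inv_id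
    · exact (hP y hy).elim _ _
  inv_hom_id := GrAb.hom_ext fun z => funext fun x => by
    by_cases hx : ∃ y, r x y
    · obtain ⟨y, h⟩ := hx
      rw [comp_toHom, reindexHom_apply _ hr h, reindexHom_apply _ (fun y x x' => hr' x x' y) h]
      exact congrArg (fun f => Hom.toHom f (z x)) (θ x y h).inv_hom_id
    · exact (hQ x hx).elim _ _

/-- At an index related to some `y` the square is the given square of summands; at any other index
the target summand is zero. -/
theorem reindexHom_naturality (θ : ∀ x y, r x y → (P y ⟶ Q x)) (θ' : ∀ x y, r x y → (P' y ⟶ Q' x))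
    (hr : ∀ x y y', r x y → r x y' → y = y')
    (hQ : ∀ x, (¬ ∃ y, r x y) → Subsingleton (Q' x).carrier)
    (f : ∀ y, P y ⟶ P' y) (g : ∀ x, Q x ⟶ Q' x)
    (hfg : ∀ x y h, f y ≫ θ' x y h = θ x y h ≫ g x) :
    piMap f ≫ reindexHom θ' = reindexHom θ ≫ piMap g :=
  GrAb.hom_ext fun z => funext fun x => by
    by_cases hx : ∃ y, r x y
    · obtain ⟨y, h⟩ := hx
      rw [comp_toHom, comp_toHom, reindexHom_apply _ hr h]
      change _ = (g x).toHom ((reindexHom θ).toHom z x)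
      rw [reindexHom_apply _ hr h]
      exact congrArg (fun f => Hom.toHom f (z y)) (hfg x y h)
    · exact (hQ x hx).elim _ _

end GrAb

/-! ### Isomorphisms, zero modules and shifts in the twisted tensor product. -/

namespace Twist

variable {s : Type} [LinearOrder s] [Fintype s]

/-- The isomorphism `f ⊗ g`. -/
noncomputable def tensorIso {M M' N N' : GrMod (ArcRing s) (ArcRing.gr s)} (f : M ≅ M')
    (g : N ≅ N') : tensor M N ≅ tensor M' N' where
  hom := tensorMap f.hom g.hom
  inv := tensorMap f.inv g.inv
  hom_inv_id := by rw [← tensorMap_comp, f.hom_inv_id, g.hom_inv_id, tensorMap_id]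
  inv_hom_id := by rw [← tensorMap_comp, f.inv_hom_id, g.inv_hom_id, tensorMap_id]

theorem subsingleton_tensor {M N : GrMod (ArcRing s) (ArcRing.gr s)}
    (h : Subsingleton M.carrier ∨ Subsingleton N.carrier) :
    Subsingleton (tensor M N).carrier := by
  refine subsingleton_of_forall_eq 0 fun z => ?_
  refine BalancedTensor.induction_on (R := ℤ) (S := ArcRing s) (X := Twist M) (M := N.carrier)
    (p := fun z => z = 0) z rfl (fun m n => ?_) fun a b ha hb => by rw [ha, hb, add_zero]
  rcases h with h | h
  · rw [show m = 0 from h.elim m _, BalancedTensor.zero_tmul]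
  · rw [show n = 0 from h.elim n _, BalancedTensor.tmul_zero]

/-- A shift changes neither the group nor the actions, and the degree of `m ⊗ n` is a sum, to which
it contributes `c` in whichever factor it is applied. -/
theorem gr_shift (c : ℤ) (M N : GrMod (ArcRing s) (ArcRing.gr s)) (d : ℤ) :
    (tensor ((GrMod.shift c).obj M) N).gr d = (tensor M ((GrMod.shift c).obj N)).gr d := by
  apply le_antisymm
  · refine (AddSubgroup.closure_le _).2 ?_
    rintro _ ⟨i, j, m, n, hm, hn, hd, rfl⟩
    refine BalancedTensor.tmul_mem_gr (R := ℤ) (S := ArcRing s) (X := Twist M) (M := N.carrier)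
      (i := i - c) (j := j + c) hm ?_ (by omega)
    change n ∈ N.gr (j + c - c)
    rwa [add_sub_cancel_right]
  · refine (AddSubgroup.closure_le _).2 ?_
    rintro _ ⟨i, j, m, n, hm, hn, hd, rfl⟩
    refine BalancedTensor.tmul_mem_gr (R := ℤ) (S := ArcRing s) (X := Twist M) (M := N.carrier)
      (i := i + c) (j := j - c) ?_ hn (by omega)
    change m ∈ M.gr (i + c - c)
    rwa [add_sub_cancel_right]

/-- The isomorphism `ψ(M{c}) ⊗ N ≅ ψM ⊗ N{c}`. -/
noncomputable def shiftIso (c : ℤ) (M N : GrMod (ArcRing s) (ArcRing.gr s)) :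
    tensor ((GrMod.shift c).obj M) N ≅ tensor M ((GrMod.shift c).obj N) where
  hom := ⟨AddMonoidHom.id _, fun d _ h => gr_shift c M N d ▸ h⟩
  inv := ⟨AddMonoidHom.id _, fun d _ h => gr_shift c M N d ▸ h⟩
  hom_inv_id := rfl
  inv_hom_id := rfl

end Twist

/-- Naturality persists after composition with maps that are themselves compatible with `f` and `g`.
In the application `a` and `b` identify components of the move functors with tensor functors;
keeping them abstract here avoids unfolding those identifications. -/
theorem Reflection.adjIso_naturality_of_comm {s t : Type} [LinearOrder s] [Fintype s]
    [LinearOrder t] [Fintype t]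
    {X : GrBimod (ArcRing t) (ArcRing.gr t) (ArcRing s) (ArcRing.gr s)}
    {Y : GrBimod (ArcRing s) (ArcRing.gr s) (ArcRing t) (ArcRing.gr t)} {c c₁ c₂ : ℤ}
    (e : Reflection X Y c) (hc : c + c₁ + c₂ = 0)
    {M M' G G' : GrMod (ArcRing s) (ArcRing.gr s)} {N N' E E' : GrMod (ArcRing t) (ArcRing.gr t)}
    (f : M ⟶ M') (g : N ⟶ N') (a : E ⟶ X.tensor.obj M) (a' : E' ⟶ X.tensor.obj M')
    (b : (GrMod.shift c₂).obj ((GrMod.shift c₁).obj (Y.tensor.obj N)) ⟶ G)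
    (b' : (GrMod.shift c₂).obj ((GrMod.shift c₁).obj (Y.tensor.obj N')) ⟶ G')
    (u : E ⟶ E') (v : G ⟶ G') (hu : u ≫ a' = a ≫ X.tensor.map f)
    (hv : (GrMod.shift c₂).map ((GrMod.shift c₁).map (Y.tensor.map g)) ≫ b' = b ≫ v) :
    Twist.tensorMap u g ≫ Twist.tensorMap a' (𝟙 N') ≫ (e.adjIso M' N' hc).hom ≫
        Twist.tensorMap (𝟙 M') b' =
      (Twist.tensorMap a (𝟙 N) ≫ (e.adjIso M N hc).hom ≫ Twist.tensorMap (𝟙 M) b) ≫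
        Twist.tensorMap f v := by
  have h1 : Twist.tensorMap u g ≫ Twist.tensorMap a' (𝟙 N') =
      Twist.tensorMap a (𝟙 N) ≫ Twist.tensorMap (X.tensor.map f) g := by
    rw [← Twist.tensorMap_comp, ← Twist.tensorMap_comp, hu, Category.comp_id, Category.id_comp]
  have h2 : Twist.tensorMap f ((GrMod.shift c₂).map ((GrMod.shift c₁).map (Y.tensor.map g))) ≫
      Twist.tensorMap (𝟙 M') b' = Twist.tensorMap (𝟙 M) b ≫ Twist.tensorMap f v := by
    rw [← Twist.tensorMap_comp, ← Twist.tensorMap_comp, hv, Category.comp_id, Category.id_comp]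
  rw [← Category.assoc, h1, Category.assoc, ← Category.assoc (Twist.tensorMap (X.tensor.map f) g),
    e.adjIso_naturality hc f g, Category.assoc, h2, Category.assoc, Category.assoc]

/-! ### Assembling the adjunctions over all weights. -/

namespace ArcCat

variable {n k : ℕ} {p q : Fin n}

/-- The component in `C(y)` of the functor of the moves, if there is a move from `x` to `y`. -/
noncomputable def evalMove {x y : Weight n k} (h : Weight.IsMove p q x y) :
    moveFunctor (k := k) p q ⋙ Pi.eval _ y ≅ Pi.eval _ x ⋙ (moveBimodule h).tensor :=
  eqToIso (by
    have hex : ∃ x, Weight.IsMove p q x y := ⟨x, h⟩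
    -- The functor tensors with the bimodule of a source picked by choice. Uniqueness of the source
    -- makes it `x`, and stating this for every `x'` allows substitution although the bimodule
    -- depends on it.
    have key : ∀ x' (h' : Weight.IsMove p q x' y),
        (Pi.eval _ x' ⋙ (moveBimodule h').tensor :
          ArcCat n k ⥤ GrMod (ArcRing y.Pt) (ArcRing.gr y.Pt)) =
        Pi.eval _ x ⋙ (moveBimodule h).tensor := by
      intro x' h'
      obtain rfl := h.source_unique h'
      rfl
    exact (Functor.pi'_eval _ _).trans ((dif_pos hex).trans (key _ hex.choose_spec)))

theorem subsingleton_moveFunctor {y : Weight n k} (h : ¬ ∃ x, Weight.IsMove p q x y)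
    (M : ArcCat n k) : Subsingleton ((moveFunctor p q).obj M y).carrier := by
  have e : moveFunctor (k := k) p q ⋙ Pi.eval _ y = (Functor.const _).obj GrMod.zero :=
    (Functor.pi'_eval _ _).trans (dif_neg h)
  have e' : (moveFunctor p q).obj M y = GrMod.zero := Functor.congr_obj e M
  rw [e']
  exact inferInstanceAs (Subsingleton PUnit)

/-- The reflection of the bimodule of a move. -/
noncomputable def moveReflection {x y : Weight n k} (h : Weight.IsMove p q x y) :
    Reflection (moveBimodule h) (moveBimodule h.symm) ((x q : ℤ) - x p - 1) :=
  (nonempty_reflection_moveBimodule h).some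

variable (c : Weight n k → ℤ)

/-- The component of the adjunction isomorphism for a move from `x` to `y`. -/
noncomputable def moveIso (hc : ∀ l, c l = (l p : ℤ) - l q)
    (M N : ArcCat n k) {x y : Weight n k} (h : Weight.IsMove p q x y) :
    Twist.tensor ((moveFunctor p q).obj M y) (N y) ≅
      Twist.tensor (M x) ((moveFunctor q p ⋙ shift c ⋙ shift fun _ => 1).obj N x) :=
  Twist.tensorIso ((evalMove h).app M) (Iso.refl (N y)) ≪≫
    -- The degrees cancel: `(x q - x p - 1) + (x p - x q) + 1 = 0`. This is where the factor `K_i`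
    -- and the shift `{1}` come from.
    (moveReflection h).adjIso (M x) (N y) (c₁ := c x) (c₂ := 1) (by rw [hc]; ring) ≪≫
    Twist.tensorIso (Iso.refl (M x))
      ((GrMod.shift 1).mapIso ((GrMod.shift (c x)).mapIso ((evalMove h.symm).symm.app N)))

/-- The outer identifications come from the natural isomorphism `evalMove`, whose naturality squares
are exactly the compatibilities that `adjIso_naturality_of_comm` needs. -/
theorem moveIso_naturality (hc : ∀ l, c l = (l p : ℤ) - l q) {M M' N N' : ArcCat n k}
    (f : M ⟶ M') (g : N ⟶ N')
    {x y : Weight n k} (h : Weight.IsMove p q x y) :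
    Twist.tensorMap ((moveFunctor p q).map f y) (g y) ≫ (moveIso c hc M' N' h).hom =
      (moveIso c hc M N h).hom ≫ Twist.tensorMap (f x)
        ((moveFunctor q p ⋙ shift c ⋙ shift fun _ => 1).map g x) := by
  have h1 : (moveFunctor p q).map f y ≫ (evalMove h).hom.app M' =
      (evalMove h).hom.app M ≫ (moveBimodule h).tensor.map (f x) := (evalMove h).hom.naturality f
  have h2 : (moveBimodule h.symm).tensor.map (g y) ≫ (evalMove h.symm).inv.app N' =
      (evalMove h.symm).inv.app N ≫ (moveFunctor q p).map g x := (evalMove h.symm).inv.naturality g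
  have h3 : (GrMod.shift 1).map ((GrMod.shift (c x)).map
        ((moveBimodule h.symm).tensor.map (g y))) ≫
      (GrMod.shift 1).map ((GrMod.shift (c x)).map ((evalMove h.symm).inv.app N')) =
      (GrMod.shift 1).map ((GrMod.shift (c x)).map ((evalMove h.symm).inv.app N)) ≫
      (GrMod.shift 1).map ((GrMod.shift (c x)).map ((moveFunctor q p).map g x)) :=
    congrArg (fun u => (GrMod.shift 1).map ((GrMod.shift (c x)).map u)) h2
  exact (moveReflection h).adjIso_naturality_of_comm _ (f x) (g y) _ _ _ _ _ _ h1 h3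

/-- The component of the adjunction isomorphism. -/
noncomputable def pairingMoveIso (hc : ∀ l, c l = (l p : ℤ) - l q) (M N : ArcCat n k) :
    pairingObj ((moveFunctor p q).obj M) N ≅
      pairingObj M ((moveFunctor q p ⋙ shift c ⋙ shift fun _ => 1).obj N) :=
  GrAb.reindexIso (r := Weight.IsMove p q)
    (P := fun y => Twist.tensor ((moveFunctor p q).obj M y) (N y))
    (Q := fun x => Twist.tensor (M x) ((moveFunctor q p ⋙ shift c ⋙ shift fun _ => 1).obj N x))
    (fun _ _ h => moveIso c hc M N h)
    (fun _ _ _ h h' => h.target_unique h') (fun _ _ _ h h' => h.source_unique h')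
    (fun _ h => Twist.subsingleton_tensor (Or.inl (subsingleton_moveFunctor h M)))
    (fun _ h => Twist.subsingleton_tensor
      -- If no move leaves `x` then no reversed move arrives there, so the component at `x` of the
      -- opposite functor is zero; the shifts keep the underlying group.
      (Or.inr (subsingleton_moveFunctor (fun ⟨y, h'⟩ => h ⟨y, h'.symm⟩) N)))

theorem pairingMoveIso_naturality (hc : ∀ l, c l = (l p : ℤ) - l q) {M M' N N' : ArcCat n k}
    (f : M ⟶ M') (g : N ⟶ N') :
    pairingMap ((moveFunctor p q).map f) g ≫ (pairingMoveIso c hc M' N').hom =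
      (pairingMoveIso c hc M N).hom ≫
        pairingMap f ((moveFunctor q p ⋙ shift c ⋙ shift fun _ => 1).map g) :=
  GrAb.reindexHom_naturality (r := Weight.IsMove p q)
    (P := fun y => Twist.tensor ((moveFunctor p q).obj M y) (N y))
    (Q := fun x => Twist.tensor (M x) ((moveFunctor q p ⋙ shift c ⋙ shift fun _ => 1).obj N x))
    (P' := fun y => Twist.tensor ((moveFunctor p q).obj M' y) (N' y))
    (Q' := fun x => Twist.tensor (M' x) ((moveFunctor q p ⋙ shift c ⋙ shift fun _ => 1).obj N' x))
    (fun _ _ h => (moveIso c hc M N h).hom) (fun _ _ h => (moveIso c hc M' N' h).hom)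
    (fun _ _ _ h h' => h.target_unique h')
    (fun _ h => Twist.subsingleton_tensor
      (Or.inr (subsingleton_moveFunctor (fun ⟨y, h'⟩ => h ⟨y, h'.symm⟩) N')))
    (fun y => Twist.tensorMap ((moveFunctor p q).map f y) (g y))
    (fun x => Twist.tensorMap (f x)
      ((moveFunctor q p ⋙ shift c ⋙ shift fun _ => 1).map g x))
    fun _ _ h => moveIso_naturality c hc f g h

/-- The adjunction between opposite moves with respect to the pairing. -/
noncomputable def movePairingIso (hc : ∀ l, c l = (l p : ℤ) - l q) :
    moveFunctor p q ⋙ pairing ≅ pairing ⋙ (Functor.whiskeringLeft _ _ _).obj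
      (moveFunctor q p ⋙ shift c ⋙ shift fun _ => 1) :=
  NatIso.ofComponents (fun M => NatIso.ofComponents (fun N => pairingMoveIso c hc M N)
    fun {N N'} g => by
      have := pairingMoveIso_naturality c hc (𝟙 M) g
      -- The joint naturality is specialized to an identity in one variable; the functor applied to
      -- it has to be recognized as the identity.
      rw [(moveFunctor p q).map_id] at this
      exact this)
    fun {M M'} f => by
      ext N : 2
      have := pairingMoveIso_naturality c hc f (𝟙 N)
      rw [(moveFunctor q p ⋙ shift c ⋙ shift fun _ => 1).map_id] at this
      exact this

/-- Shifts are self-adjoint with respect to the pairing. -/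
noncomputable def shiftPairingIso : shift c ⋙ pairing ≅
    pairing ⋙ (Functor.whiskeringLeft _ _ _).obj (shift c) :=
  NatIso.ofComponents (fun M => NatIso.ofComponents (fun N =>
    -- On underlying groups all the maps are identities, so the remaining conditions hold by
    -- definition.
    { hom := GrAb.piMap fun l => (Twist.shiftIso (c l) (M l) (N l)).hom
      inv := GrAb.piMap fun l => (Twist.shiftIso (c l) (M l) (N l)).inv
      hom_inv_id := rfl
      inv_hom_id := rfl }) fun _ => rfl) fun _ => rfl

end ArcCat

end ArcAlg

theorem mainTheorem10 (n k : ℕ) (hk : 1 ≤ k) (hkn : k + 1 ≤ n) (i : ℕ) (hi : i + 1 < n) :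
    Nonempty (ArcAlg.ArcCat.E (k := k) i hi ⋙ ArcAlg.ArcCat.pairing ≅
      ArcAlg.ArcCat.pairing ⋙ (Functor.whiskeringLeft _ _ _).obj
        (ArcAlg.ArcCat.F i hi ⋙ ArcAlg.ArcCat.K i hi ⋙ ArcAlg.ArcCat.shift fun _ => 1)) ∧
    Nonempty (ArcAlg.ArcCat.F (k := k) i hi ⋙ ArcAlg.ArcCat.pairing ≅
      ArcAlg.ArcCat.pairing ⋙ (Functor.whiskeringLeft _ _ _).obj
        (ArcAlg.ArcCat.E i hi ⋙ ArcAlg.ArcCat.KInv i hi ⋙ ArcAlg.ArcCat.shift fun _ => 1)) ∧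
    Nonempty (ArcAlg.ArcCat.K (k := k) i hi ⋙ ArcAlg.ArcCat.pairing ≅
      ArcAlg.ArcCat.pairing ⋙ (Functor.whiskeringLeft _ _ _).obj (ArcAlg.ArcCat.K i hi)) :=
  -- The first isomorphism has `p = i` and `q = i + 1`, where the required shift is literally that
  -- of `K_i`. The second exchanges `p` and `q`, so the negated difference in `K_i⁻¹` is rewritten
  -- by `neg_sub`.
  ⟨⟨ArcAlg.ArcCat.movePairingIso _ fun _ => rfl⟩,
    ⟨ArcAlg.ArcCat.movePairingIso _ fun _ => neg_sub _ _⟩,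
    ⟨ArcAlg.ArcCat.shiftPairingIso _⟩⟩
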